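/- Let $d\ge 2$ and let $S\in\{1/2,1,3/2,\dots\}$. For $x\in\mathbb{Z}^d$ let $S_x^{(1)},S_x^{(2)},S_x^{(3)}$ be the spin-$S$ operators at $x$, acting on a copy of $\mathbb{C}^{2S+1}$. Let $\mathfrak{A}_\Gamma=\bigotimes_{x\in\Gamma}M_{2S+1}(\mathbb{C})$ for finite $\Gamma\subset\mathbb{Z}^d$, let $\mathfrak{A}_{\rm loc}=\bigcup_\Gamma\mathfrak{A}_\Gamma$, and let $\mathfrak{A}$ be the quasi-local algebra, i.e. the norm completion of $\mathfrak{A}_{\rm loc}$. For $\Lambda=\{-L+1,\dots,L\}^d$ and $B\in\mathbb{R}$ put $$H_{0}^{(\Lambda)}=\sum_{\{x,y\}\subset\Lambda:\,|x-y|=1}\bigl(S_x^{(1)}S_y^{(1)}+S_x^{(2)}S_y^{(2)}+S_x^{(3)}S_y^{(3)}\bigr)\ \text{(periodic boundary conditions)},$$ $$O^{(\Lambda)}=\sum_{x\in\Lambda}(-1)^{x^{(1)}+\cdots+x^{(d)}}S_x^{(3)},\qquad H^{(\Lambda)}(B)=H_0^{(\Lambda)}-B\,O^{(\Lambda)}.$$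 Let $P_0^{(\Lambda)}(B)$ be the orthogonal projection onto the eigenspace of the smallest eigenvalue of $H^{(\Lambda)}(B)$, and $\omega_B^{(\Lambda)}(a)=\mathrm{Tr}[P_0^{(\Lambda)}(B)\,a]/\mathrm{Tr}\,P_0^{(\Lambda)}(B)$. An infinite-volume ground state (at $B=0$) is a state $\omega$ of $\mathfrak{A}$ with $\lim_{\Lambda\nearrow\mathbb{Z}^d}\omega(a^*[H_0^{(\Lambda)},a])\ge 0$ for all $a\in\mathfrak{A}_{\rm loc}$; its (maximum) spontaneous magnetization is $\lim_{N\to\infty}\sup_{|\Lambda|\ge N}\omega(O^{(\Lambda)})/|\Lambda|$. Suppose that some infinite-volume ground state has a nonvanishing spontaneous magnetization. Let $\omega_0$ be any state of the form $$\omega_0=\operatorname{weak^*-lim}_{B\searrow 0}\ \operatorname{weak^*-lim}_{\Lambda\nearrow\mathbb{Z}^d}\ \omega_B^{(\Lambda)},$$ where the limits are taken along a sequence of positive fields $B$ tending to $0$ and, for each of these fields, along a sequence of boxes $\Lambda$ (with $L\to\infty$) for which they exist. Then the transverse correlation function of $\omega_0$ does not decay rapidly: it is not true that $$|\omega_0(S_x^{(2)}S_y^{(2)})|=o\bigl(|x-y|^{-(d-1)}\bigr)\qquad\text{as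 }|x-y|\to\infty .$$ -/

import Mathlib

open scoped Matrix ComplexOrder
open Filter Topology

noncomputable section

namespace HeisenbergAF

/-- Sites of the `d`-dimensional hypercubic lattice. -/
abbrev Site (d : ℕ) : Type := Fin d → ℤ

/-- Basis labels of `⨂_{x ∈ Γ} ℂ^{n+1}`, where `n = 2S` and `S` is the magnitude of the spin. -/
abbrev Config {d : ℕ} (n : ℕ) (Γ : Finset (Site d)) : Type := Γ → Fin (n + 1)

/-- The algebra of observables `𝔄_Γ = ⨂_{x ∈ Γ} M_{n+1}(ℂ)` of a finite set of sites,
as matrices on `⨂_{x ∈ Γ} ℂ^{n+1}`. -/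
abbrev LocalAlg {d : ℕ} (n : ℕ) (Γ : Finset (Site d)) : Type :=
  Matrix (Config n Γ) (Config n Γ) ℂ

/-! ### The quasi-local algebra

It is realized as the norm closure of the union of the `𝔄_Γ`, each acting faithfully on the
square-summable functions of the configurations of the whole lattice: a matrix `a ∈ 𝔄_Γ` acts on
the coordinates in `Γ` and as the identity on all the other coordinates. -/

/-- Square-summable functions on the set of configurations of the whole lattice. -/
abbrev GlobalSpace (d n : ℕ) : Type := lp (fun _ : Site d → Fin (n + 1) => ℂ) 2

section LocalAction

variable {d n : ℕ} (Γ : Finset (Site d))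

/-- The action of `a ∈ 𝔄_Γ` on functions of the configurations of the whole lattice. -/
def actFun (a : LocalAlg n Γ) (f : (Site d → Fin (n + 1)) → ℂ) (σ : Site d → Fin (n + 1)) : ℂ :=
  ∑ τ : Config n Γ, a (Γ.restrict σ) τ * f (Function.updateFinset σ Γ τ)

theorem sum_update_le {F : (Site d → Fin (n + 1)) → ℝ} {C : ℝ}
    (hF : ∀ s : Finset (Site d → Fin (n + 1)), ∑ σ ∈ s, F σ ≤ C)
    (s : Finset (Site d → Fin (n + 1))) :
    ∑ σ ∈ s, ∑ τ : Config n Γ, F (Function.updateFinset σ Γ τ)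
      ≤ Fintype.card (Config n Γ) * C := by
  classical
  rw [← Finset.sum_fiberwise s (fun σ => Γ.restrict σ)]
  calc _ ≤ ∑ _ρ : Config n Γ, C := by
        refine Finset.sum_le_sum fun ρ _ => ?_
        rw [← Finset.sum_product', ← Finset.sum_image (f := F)
          (g := fun p : (Site d → Fin (n + 1)) × Config n Γ => Function.updateFinset p.1 Γ p.2)]
        · exact hF _
        · rintro ⟨σ, τ⟩ h ⟨σ', τ'⟩ h' heq
          simp only [Finset.coe_product, Finset.coe_filter, Finset.coe_univ, Set.mem_prod,
            Set.mem_ofPred_eq, Set.mem_univ, and_true] at h h'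
          have h1 : τ = τ' := by
            have := congrArg (Γ.restrict) heq
            simpa only [Function.restrict_updateFinset] using this
          have h2 : σ = σ' := by
            have := congrArg (fun η => Function.updateFinset η Γ ρ) heq
            simp only [Function.updateFinset_updateFinset_of_subset subset_rfl] at this
            conv_lhs at this => rw [← h.2, Function.updateFinset_restrict]
            conv_rhs at this => rw [← h'.2, Function.updateFinset_restrict]
            exact this
          rw [h1, h2]
    _ = _ := by simp

theorem actFun_sq_le (a : LocalAlg n Γ) (f : (Site d → Fin (n + 1)) → ℂ)
    (σ : Site d → Fin (n + 1)) :
    ‖actFun Γ a f σ‖ ^ 2 ≤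
      (∑ ρ, ∑ τ, ‖a ρ τ‖ ^ 2) * ∑ τ, ‖f (Function.updateFinset σ Γ τ)‖ ^ 2 := by
  calc ‖actFun Γ a f σ‖ ^ 2
      ≤ (∑ τ, ‖a (Γ.restrict σ) τ‖ * ‖f (Function.updateFinset σ Γ τ)‖) ^ 2 := by
        gcongr
        refine (norm_sum_le _ _).trans (le_of_eq ?_)
        simp only [norm_mul]
    _ ≤ (∑ τ, ‖a (Γ.restrict σ) τ‖ ^ 2) * ∑ τ, ‖f (Function.updateFinset σ Γ τ)‖ ^ 2 :=
        Finset.sum_mul_sq_le_sq_mul_sq _ _ _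
    _ ≤ _ := by
        refine mul_le_mul_of_nonneg_right ?_ (by positivity)
        exact Finset.single_le_sum (f := fun ρ => ∑ τ, ‖a ρ τ‖ ^ 2)
          (fun _ _ => by positivity) (Finset.mem_univ _)

theorem sum_actFun_sq_le (a : LocalAlg n Γ) (f : GlobalSpace d n)
    (s : Finset (Site d → Fin (n + 1))) :
    ∑ σ ∈ s, ‖actFun Γ a f σ‖ ^ 2 ≤
      (∑ ρ, ∑ τ, ‖a ρ τ‖ ^ 2) * (Fintype.card (Config n Γ) * ‖f‖ ^ 2) := by
  have hf : ∀ s : Finset (Site d → Fin (n + 1)), ∑ σ ∈ s, ‖f σ‖ ^ 2 ≤ ‖f‖ ^ 2 := by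
    intro s
    have := lp.sum_rpow_le_norm_rpow (p := 2) (by simp) f s
    simpa using this
  calc _ ≤ ∑ σ ∈ s, (∑ ρ, ∑ τ, ‖a ρ τ‖ ^ 2) *
            ∑ τ, ‖f (Function.updateFinset σ Γ τ)‖ ^ 2 :=
        Finset.sum_le_sum fun σ _ => actFun_sq_le Γ a f σ
    _ ≤ _ := by
        rw [← Finset.mul_sum]
        gcongr
        exact sum_update_le Γ (F := fun σ => ‖f σ‖ ^ 2) hf s

theorem memℓp_actFun (a : LocalAlg n Γ) (f : GlobalSpace d n) :
    Memℓp (actFun Γ a f) 2 := by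
  refine memℓp_gen' (C := (∑ ρ, ∑ τ, ‖a ρ τ‖ ^ 2) * (Fintype.card (Config n Γ) * ‖f‖ ^ 2)) ?_
  intro s
  simpa using sum_actFun_sq_le Γ a f s

/-- The action of `a ∈ 𝔄_Γ` as a bounded operator. -/
def actCLM (a : LocalAlg n Γ) : GlobalSpace d n →L[ℂ] GlobalSpace d n :=
  LinearMap.mkContinuous
    { toFun := fun f => ⟨actFun Γ a f, memℓp_actFun Γ a f⟩
      map_add' := by
        intro f g
        ext σ
        change actFun Γ a (⇑f + ⇑g) σ = actFun Γ a f σ + actFun Γ a g σ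
        simp [actFun, mul_add, Finset.sum_add_distrib]
      map_smul' := by
        intro c f
        ext σ
        simp [actFun, Finset.mul_sum, mul_left_comm] }
    (√((∑ ρ, ∑ τ, ‖a ρ τ‖ ^ 2) * Fintype.card (Config n Γ)))
    (by
      intro f
      refine lp.norm_le_of_forall_sum_le (by simp) (by positivity) ?_
      intro s
      have := sum_actFun_sq_le Γ a f s
      have h0 : 0 ≤ (∑ ρ, ∑ τ, ‖a ρ τ‖ ^ 2) * (Fintype.card (Config n Γ) : ℝ) := by positivity
      simp only [ENNReal.toReal_ofNat, Real.rpow_ofNat, mul_pow, Real.sq_sqrt h0, mul_assoc]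
      exact this)

theorem actCLM_apply (a : LocalAlg n Γ) (f : GlobalSpace d n) (σ : Site d → Fin (n + 1)) :
    actCLM Γ a f σ = ∑ τ : Config n Γ, a (Γ.restrict σ) τ * f (Function.updateFinset σ Γ τ) :=
  rfl

theorem actCLM_mul (a b : LocalAlg n Γ) : actCLM Γ (a * b) = actCLM Γ a * actCLM Γ b := by
  ext f σ
  simp only [mul_apply_eq_comp, actCLM_apply, Function.restrict_updateFinset,
    Function.updateFinset_updateFinset_of_subset subset_rfl, Matrix.mul_apply, Finset.sum_mul,
    Finset.mul_sum, mul_assoc]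
  exact Finset.sum_comm

theorem actCLM_algebraMap (c : ℂ) :
    actCLM Γ (algebraMap ℂ (LocalAlg n Γ) c) = algebraMap ℂ _ c := by
  ext f σ
  simp [actCLM_apply, Algebra.algebraMap_eq_smul_one, Matrix.one_apply,
    Function.updateFinset_restrict]

/-- The involution `(σ, τ) ↦ (σ with τ on Γ, σ restricted to Γ)`. -/
def swapEquiv : ((Site d → Fin (n + 1)) × Config n Γ) ≃ ((Site d → Fin (n + 1)) × Config n Γ) where
  toFun p := (Function.updateFinset p.1 Γ p.2, Γ.restrict p.1)
  invFun p := (Function.updateFinset p.1 Γ p.2, Γ.restrict p.1)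
  left_inv p := by
    simp [Function.updateFinset_updateFinset_of_subset subset_rfl,
      Function.updateFinset_restrict, Function.restrict_updateFinset]
  right_inv p := by
    simp [Function.updateFinset_updateFinset_of_subset subset_rfl,
      Function.updateFinset_restrict, Function.restrict_updateFinset]

theorem summable_actFun_inner (a : LocalAlg n Γ) (f g : GlobalSpace d n) :
    Summable fun p : (Site d → Fin (n + 1)) × Config n Γ =>
      inner ℂ (a (Γ.restrict p.1) p.2 * f (Function.updateFinset p.1 Γ p.2)) (g p.1) := by
  classical
  rw [← summable_norm_iff, summable_prod_of_nonneg (fun _ => norm_nonneg _)]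
  refine ⟨fun _ => Summable.of_finite, ?_⟩
  simp only [tsum_fintype]
  refine summable_sum fun τ _ => ?_
  rw [summable_norm_iff]
  refine (lp.summable_inner (𝕜 := ℂ)
    (actCLM Γ (Matrix.of fun ρ τ' => if τ' = τ then a ρ τ else 0) f) g).congr fun σ => ?_
  simp [actCLM_apply]

theorem actCLM_star (a : LocalAlg n Γ) : actCLM Γ (star a) = star (actCLM Γ a) := by
  rw [ContinuousLinearMap.star_eq_adjoint, ContinuousLinearMap.eq_adjoint_iff]
  intro f g
  have h1 : inner ℂ (actCLM Γ (star a) f) g =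
      ∑' p : (Site d → Fin (n + 1)) × Config n Γ,
        inner ℂ (star a (Γ.restrict p.1) p.2 * f (Function.updateFinset p.1 Γ p.2)) (g p.1) := by
    rw [(summable_actFun_inner Γ (star a) f g).tsum_prod, lp.inner_eq_tsum]
    simp only [tsum_fintype, actCLM_apply, sum_inner]
  have h2 : inner ℂ f (actCLM Γ a g) =
      ∑' p : (Site d → Fin (n + 1)) × Config n Γ,
        inner ℂ (f p.1) (a (Γ.restrict p.1) p.2 * g (Function.updateFinset p.1 Γ p.2)) := by
    rw [Summable.tsum_prod, lp.inner_eq_tsum]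
    · simp only [tsum_fintype, actCLM_apply, inner_sum]
    · have := (summable_actFun_inner Γ a g f).star
      refine this.congr fun p => ?_
      exact inner_conj_symm (𝕜 := ℂ) _ _
  rw [h1, h2, ← (swapEquiv Γ).tsum_eq]
  refine tsum_congr fun p => ?_
  simp [swapEquiv, Function.updateFinset_updateFinset_of_subset subset_rfl,
    Function.updateFinset_restrict, Function.restrict_updateFinset, Matrix.star_apply]
  ring

end LocalAction

/-- The action of `𝔄_Γ` on `GlobalSpace d n`, as a `*`-homomorphism. -/
def actHom {d : ℕ} (n : ℕ) (Γ : Finset (Site d)) :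
    LocalAlg n Γ →⋆ₐ[ℂ] (GlobalSpace d n →L[ℂ] GlobalSpace d n) where
  toFun := actCLM Γ
  map_one' := by simpa using actCLM_algebraMap Γ (1 : ℂ)
  map_mul' := actCLM_mul Γ
  map_zero' := by simpa using actCLM_algebraMap Γ (0 : ℂ)
  map_add' a b := by
    ext f σ
    change actFun Γ (a + b) f σ = actFun Γ a f σ + actFun Γ b f σ
    simp [actFun, add_mul, Finset.sum_add_distrib]
  commutes' := actCLM_algebraMap Γ
  map_star' := actCLM_star Γ

/-- The quasi-local algebra: the norm closure of the local algebra `⋃_Γ 𝔄_Γ`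
(this union is directed, hence equal to the supremum of the `𝔄_Γ`). -/
def quasiLocal (d n : ℕ) : StarSubalgebra ℂ (GlobalSpace d n →L[ℂ] GlobalSpace d n) :=
  (⨆ Γ : Finset (Site d), (actHom n Γ).range).topologicalClosure

/-- The inclusion of `𝔄_Γ` in the quasi-local algebra. -/
def obs {d : ℕ} (n : ℕ) (Γ : Finset (Site d)) : LocalAlg n Γ →⋆ₐ[ℂ] quasiLocal d n :=
  (actHom n Γ).codRestrict (quasiLocal d n) fun a =>
    StarSubalgebra.le_topologicalClosure _
      (le_iSup (fun Γ : Finset (Site d) => (actHom n Γ).range) Γ ⟨a, rfl⟩)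

/-- States of the quasi-local algebra: normalized positive linear functionals. -/
def IsState {d n : ℕ} (ω : quasiLocal d n →L[ℂ] ℂ) : Prop :=
  ω 1 = 1 ∧ ∀ a, 0 ≤ ω (star a * a)

/-! ### Spin operators -/

/-- The raising operator `S⁺ = S^{(1)} + i S^{(2)}` of spin `S = n/2`, in the basis of
eigenvectors of `S^{(3)}` with eigenvalues `S, S - 1, …, -S`. -/
def spinRaise (n : ℕ) : Matrix (Fin (n + 1)) (Fin (n + 1)) ℂ :=
  Matrix.of fun j k =>
    if (j : ℕ) + 1 = k then ((√((k : ℝ) * ((n : ℝ) - k + 1)) : ℝ) : ℂ) else 0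

/-- The spin matrix `S^{(1)}`. -/
def spin1 (n : ℕ) : Matrix (Fin (n + 1)) (Fin (n + 1)) ℂ :=
  (1 / 2 : ℂ) • (spinRaise n + (spinRaise n)ᴴ)

/-- The spin matrix `S^{(2)}`. -/
def spin2 (n : ℕ) : Matrix (Fin (n + 1)) (Fin (n + 1)) ℂ :=
  (1 / (2 * Complex.I)) • (spinRaise n - (spinRaise n)ᴴ)

/-- The spin matrix `S^{(3)}`. -/
def spin3 (n : ℕ) : Matrix (Fin (n + 1)) (Fin (n + 1)) ℂ :=
  Matrix.diagonal fun k => (n : ℂ) / 2 - (k : ℕ)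

open Classical in
/-- The one-site matrix `M` at the site `x ∈ Γ`, tensored with the identity at the other sites. -/
def siteOp {d n : ℕ} {Γ : Finset (Site d)} (x : Γ) (M : Matrix (Fin (n + 1)) (Fin (n + 1)) ℂ) :
    LocalAlg n Γ :=
  Matrix.of fun σ τ => if ∀ y, y ≠ x → σ y = τ y then M (σ x) (τ x) else 0

/-- The spin operator `S_x^{(2)}` in the quasi-local algebra. -/
def spinObs2 {d : ℕ} (n : ℕ) (x : Site d) : quasiLocal d n :=
  obs n {x} (siteOp ⟨x, Finset.mem_singleton_self x⟩ (spin2 n))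

/-! ### The finite-volume Hamiltonians -/

/-- The box `Λ = {-L+1, …, L}^d`. -/
def box (d L : ℕ) : Finset (Site d) :=
  Fintype.piFinset fun _ => Finset.Icc (-(L : ℤ) + 1) L

/-- Nearest neighbours in the box `{-L+1, …, L}^d` with periodic boundary conditions. -/
def PeriodicAdj {d : ℕ} (L : ℕ) (x y : Site d) : Prop :=
  ∃ i, (∀ j, j ≠ i → x j = y j) ∧
    ((2 * L : ℤ) ∣ x i - y i - 1 ∨ (2 * L : ℤ) ∣ x i - y i + 1)

open Classical in
/-- The Heisenberg Hamiltonian `H_{0,p}^{(Λ)} = ∑_{{x,y} : |x-y|=1} 𝐒_x ⬝ 𝐒_y` with periodic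
boundary conditions. Every unordered pair occurs twice in the sum over `x` and `y`. -/
def heisenberg (d n L : ℕ) : LocalAlg n (box d L) :=
  (1 / 2 : ℂ) • ∑ x : box d L, ∑ y : box d L,
    if PeriodicAdj L (x : Site d) y then
      siteOp x (spin1 n) * siteOp y (spin1 n) + siteOp x (spin2 n) * siteOp y (spin2 n) +
        siteOp x (spin3 n) * siteOp y (spin3 n)
    else 0

/-- The order parameter `O^{(Λ)} = ∑_{x ∈ Λ} (-1)^{x^{(1)} + ⋯ + x^{(d)}} S_x^{(3)}`. -/
def orderParam (d n L : ℕ) : LocalAlg n (box d L) :=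
  ∑ x : box d L, ((-1 : ℂ) ^ (∑ i, (x : Site d) i)) • siteOp x (spin3 n)

/-- The Hamiltonian `H_p^{(Λ)}(B) = H_{0,p}^{(Λ)} - B O^{(Λ)}`. -/
def hamiltonian (d n L : ℕ) (B : ℝ) : LocalAlg n (box d L) :=
  heisenberg d n L - (B : ℂ) • orderParam d n L

/-! ### Finite-volume ground states -/

section FiniteGroundState

variable {ι : Type*} [Fintype ι] [DecidableEq ι]

/-- The smallest eigenvalue of a Hermitian matrix. -/
def groundEnergy (H : Matrix ι ι ℂ) : ℝ :=
  sInf {E : ℝ | Module.End.HasEigenvalue (Matrix.toEuclideanLin H) (E : ℂ)}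

/-- The orthogonal projection `P_0` onto the eigenspace of the smallest eigenvalue. -/
def groundProj (H : Matrix ι ι ℂ) : EuclideanSpace ℂ ι →ₗ[ℂ] EuclideanSpace ℂ ι :=
  (Module.End.eigenspace (Matrix.toEuclideanLin H) (groundEnergy H : ℂ)).starProjection

/-- The expectation `a ↦ Tr [P_0 a] / Tr P_0`. -/
def groundExpect (H a : Matrix ι ι ℂ) : ℂ :=
  LinearMap.trace ℂ _ (groundProj H ∘ₗ Matrix.toEuclideanLin a) /
    LinearMap.trace ℂ _ (groundProj H)

end FiniteGroundState

open Classical in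
/-- The embedding `a ↦ a ⊗ I` of `𝔄_Γ` in `𝔄_Λ` for `Γ ⊆ Λ`. -/
def embed {d n : ℕ} {Γ Λ : Finset (Site d)} (h : Γ ⊆ Λ) (a : LocalAlg n Γ) : LocalAlg n Λ :=
  Matrix.of fun σ τ =>
    if ∀ x : Λ, (x : Site d) ∉ Γ → σ x = τ x then
      a (fun x => σ ⟨x, h x.2⟩) (fun x => τ ⟨x, h x.2⟩)
    else 0

open Classical in
/-- `ω_B^{(Λ)}(a)` for an observable `a ∈ 𝔄_Γ`, where `Λ = {-L+1, …, L}^d`. It is given the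
value `0` if `Γ` is not contained in `Λ`, which does not matter for large `Λ`. -/
def finiteGroundState {d n : ℕ} (L : ℕ) (B : ℝ) (Γ : Finset (Site d)) (a : LocalAlg n Γ) : ℂ :=
  if h : Γ ⊆ box d L then groundExpect (hamiltonian d n L B) (embed h a) else 0

/-! ### Infinite-volume ground states -/

/-- `ω` is a weak-* limit of the finite-volume ground states `ω_B^{(Λ)}`, along some sequence of
boxes `Λ` which tends to the whole lattice. -/
def IsFieldGroundState {d n : ℕ} (B : ℝ) (ω : quasiLocal d n →L[ℂ] ℂ) : Prop :=
  IsState ω ∧ ∃ L : ℕ → ℕ, Tendsto L atTop atTop ∧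
    ∀ (Γ : Finset (Site d)) (a : LocalAlg n Γ),
      Tendsto (fun k => finiteGroundState (L k) B Γ a) atTop (𝓝 (ω (obs n Γ a)))

/-- `ω₀` is a weak-* limit, along some sequence of fields `B ↘ 0`, of weak-* limits of the
finite-volume ground states `ω_B^{(Λ)}`. -/
def IsZeroFieldLimit {d n : ℕ} (ω₀ : quasiLocal d n →L[ℂ] ℂ) : Prop :=
  ∃ (B : ℕ → ℝ) (ω : ℕ → quasiLocal d n →L[ℂ] ℂ),
    (∀ k, 0 < B k) ∧ Tendsto B atTop (𝓝 0) ∧ (∀ k, IsFieldGroundState (B k) (ω k)) ∧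
      ∀ a, Tendsto (fun k => ω k a) atTop (𝓝 (ω₀ a))

/-- Infinite-volume ground states at zero field: states with
`lim_{Λ ↗ ℤ^d} ω(a* [H_{0,p}^{(Λ)}, a]) ≥ 0` for all local observables `a`. -/
def IsGroundState {d n : ℕ} (ω : quasiLocal d n →L[ℂ] ℂ) : Prop :=
  IsState ω ∧ ∀ (Γ : Finset (Site d)) (a : LocalAlg n Γ), ∃ r : ℝ, 0 ≤ r ∧
    Tendsto (fun L : ℕ => ω (star (obs n Γ a) * ⁅obs n (box d L) (heisenberg d n L), obs n Γ a⁆))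
      atTop (𝓝 (r : ℂ))

/-- The (maximum) spontaneous magnetization
`lim_{N ↗ ∞} sup_{|Λ| ≥ N} ω(O^{(Λ)}) / |Λ|` of `ω`. -/
def magnetization {d n : ℕ} (ω : quasiLocal d n →L[ℂ] ℂ) : ℝ :=
  limsup (fun L : ℕ => (ω (obs n (box d L) (orderParam d n L))).re / (box d L).card) atTop

/-- The Euclidean distance `|x - y|`. -/
def siteDist {d : ℕ} (x y : Site d) : ℝ := √(∑ i, ((x i : ℝ) - y i) ^ 2)

end HeisenbergAF

end

/-! The contradiction comes from the uncertainty relation. Let T = Σ g_x S_x^(1), where the profile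
g ≥ 0 varies slowly and has height and width of order R, and let X = Σ (-1)^x S_x^(2) over the same
region. Then [T, X] = i Σ g_x (-1)^x S_x^(3). If the staggered magnetization of ω₀ is at least δ > 0
at every site, this commutator has expectation of order R^{d+1}, and the square of that is at most 4
ω₀(T²) ω₀(X²). Decay of the correlations as o(|x-y|^{-(d-1)}) gives ω₀(X²) = o(R^{d+1}), because
|z|^{-(d-1)} sums to order R over a box of size R. So it suffices that ω₀(T²) = O(R^{d+1}), one
power of R below the trivial order of Σ g_x².

The bound on T² is obtained from `groundState_sq_le`: if a field h coupled to T lowers the ground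
state energy by at most K h², then ω(T²)² ≤ K ω([T,[H,T]])/2. The constant K comes from reflection
positivity in the form of Gaussian domination (`groundEnergy_afHam_field`). With g_x = Σ_{y~x} (k_x
+ k_y) for a tent function k, it gives K = (1/4) Σ (k_x + k_y)² over ordered neighbours, which is
O(R^{d+2}). The double commutator is controlled by the Dirichlet form of g, which is O(R^d), since
the uniform sum of S^(1) commutes with the exchange interaction; the field only adds a term |B| Σ
g_x² (`re_doubleComm_afHam_le`). That term disappears if the boxes grow first, then B tends to 0 at
fixed R, and R grows last.

The magnetization of ω₀ is bounded below by an energy comparison. Replacing a state inside a box by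
a ground vector of the box changes the energy outside only through surface terms
(`local_energy_le`), so every infinite-volume ground state minimizes the box energy up to a surface
error. Comparing the given zero-field ground state with a ground state in the field B through the
variational principle (`order_le`), and letting the box grow at fixed B, gives a lower bound δ which
does not depend on B (`IsFieldGroundState.le_staggeredMag`) and hence survives the limit of
vanishing field. -/

set_option linter.unusedSectionVars false

noncomputable section

namespace HeisenbergAF

/-! ### Product operators on a finite tensor product -/

section ProdOp

variable {V κ : Type*} [Fintype V] [DecidableEq V] [Fintype κ] [DecidableEq κ]

/-- The operator `⨂ₓ uₓ` on `⨂ₓ ℂ^κ`. -/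
def prodOp (u : V → Matrix κ κ ℂ) : Matrix (V → κ) (V → κ) ℂ :=
  Matrix.of fun σ τ => ∏ x, u x (σ x) (τ x)

theorem prodOp_apply (u : V → Matrix κ κ ℂ) (σ τ : V → κ) :
    prodOp u σ τ = ∏ x, u x (σ x) (τ x) := rfl

theorem prodOp_mul (u v : V → Matrix κ κ ℂ) : prodOp (u * v) = prodOp u * prodOp v := by
  ext σ τ
  simp only [prodOp_apply, Matrix.mul_apply, Pi.mul_apply, ← Finset.prod_mul_distrib]
  rw [Finset.prod_univ_sum, Fintype.piFinset_univ]

theorem prodOp_one : prodOp (1 : V → Matrix κ κ ℂ) = 1 := by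
  ext σ τ
  simp only [prodOp_apply, Pi.one_apply, Matrix.one_apply]
  rw [Finset.prod_ite_zero]
  simp [funext_iff]

theorem prodOp_star (u : V → Matrix κ κ ℂ) : prodOp (star u) = star (prodOp u) := by
  ext σ τ
  simp [prodOp_apply, Matrix.star_apply]

/-- The one-site operator `M` at the site `x`, tensored with the identity elsewhere. -/
def oneSite (x : V) : Matrix κ κ ℂ →⋆ₐ[ℂ] Matrix (V → κ) (V → κ) ℂ where
  toFun M := prodOp (Pi.mulSingle x M)
  map_one' := by rw [Pi.mulSingle_one, prodOp_one]
  map_mul' M N := by rw [Pi.mulSingle_mul, prodOp_mul]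
  map_zero' := by
    ext σ τ
    rw [prodOp_apply, Matrix.zero_apply, Finset.prod_eq_zero (Finset.mem_univ x)]
    simp
  map_add' M N := by
    ext σ τ
    simp only [Matrix.add_apply, prodOp_apply]
    rw [← Finset.mul_prod_erase _ _ (Finset.mem_univ x), ← Finset.mul_prod_erase _ _ (Finset.mem_univ x),
      ← Finset.mul_prod_erase _ _ (Finset.mem_univ x)]
    have h : ∀ K : Matrix κ κ ℂ, ∏ y ∈ Finset.univ.erase x,
        (Pi.mulSingle x K : V → Matrix κ κ ℂ) y (σ y) (τ y) =
          ∏ y ∈ Finset.univ.erase x, (1 : Matrix κ κ ℂ) (σ y) (τ y) := fun K =>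
      Finset.prod_congr rfl fun y hy => by
        rw [Pi.mulSingle_eq_of_ne (Finset.ne_of_mem_erase hy)]
    rw [h, h, h]
    simp [add_mul]
  commutes' c := by
    ext σ τ
    rw [prodOp_apply, ← Finset.mul_prod_erase _ _ (Finset.mem_univ x)]
    have h : ∏ y ∈ Finset.univ.erase x,
        (Pi.mulSingle x (algebraMap ℂ (Matrix κ κ ℂ) c) : V → Matrix κ κ ℂ) y (σ y) (τ y) =
          ∏ y ∈ Finset.univ.erase x, (1 : Matrix κ κ ℂ) (σ y) (τ y) :=
      Finset.prod_congr rfl fun y hy => by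
        rw [Pi.mulSingle_eq_of_ne (Finset.ne_of_mem_erase hy)]
    rw [h, Pi.mulSingle_eq_same, Algebra.algebraMap_eq_smul_one, Algebra.algebraMap_eq_smul_one,
      Matrix.smul_apply, Matrix.smul_apply, ← prodOp_one, prodOp_apply,
      ← Finset.mul_prod_erase _ _ (Finset.mem_univ x)]
    simp [mul_assoc]
  map_star' M := by
    rw [← prodOp_star]
    congr 1
    ext1 y
    by_cases h : y = x
    · subst h; simp
    · simp [Pi.mulSingle_eq_of_ne h]

theorem oneSite_eq_prodOp (x : V) (M : Matrix κ κ ℂ) :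
    oneSite x M = prodOp (Pi.mulSingle x M) := rfl

theorem oneSite_apply (x : V) (M : Matrix κ κ ℂ) (σ τ : V → κ) [Decidable (∀ y, y ≠ x → σ y = τ y)] :
    oneSite x M σ τ = if ∀ y, y ≠ x → σ y = τ y then M (σ x) (τ x) else 0 := by
  rw [oneSite_eq_prodOp, prodOp_apply, ← Finset.mul_prod_erase _ _ (Finset.mem_univ x),
    Pi.mulSingle_eq_same]
  have h : ∏ y ∈ Finset.univ.erase x, (Pi.mulSingle x M : V → Matrix κ κ ℂ) y (σ y) (τ y) =
      ∏ y ∈ Finset.univ.erase x, (1 : Matrix κ κ ℂ) (σ y) (τ y) :=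
    Finset.prod_congr rfl fun y hy => by
      rw [Pi.mulSingle_eq_of_ne (Finset.ne_of_mem_erase hy)]
  rw [h]
  simp only [Matrix.one_apply]
  rw [Finset.prod_ite_zero]
  simp

theorem oneSite_commute {x y : V} (h : x ≠ y) (M N : Matrix κ κ ℂ) :
    Commute (oneSite x M) (oneSite y N) := by
  rw [Commute, SemiconjBy, oneSite_eq_prodOp, oneSite_eq_prodOp, ← prodOp_mul, ← prodOp_mul]
  exact congrArg prodOp (Pi.mulSingle_commute (f := fun _ : V => Matrix κ κ ℂ) h M N).eq

/-- Conjugation by a product of one-site unitaries acts site by site. -/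
theorem prodOp_conj_oneSite (u : V → Matrix κ κ ℂ) (hu : ∀ x, u x * star (u x) = 1) (x : V)
    (M : Matrix κ κ ℂ) :
    prodOp u * oneSite x M * star (prodOp u) = oneSite x (u x * M * star (u x)) := by
  rw [oneSite_eq_prodOp, oneSite_eq_prodOp, ← prodOp_star, ← prodOp_mul, ← prodOp_mul]
  congr 1
  ext1 y
  by_cases h : y = x
  · subst h; simp
  · simp [Pi.mulSingle_eq_of_ne h, hu]

theorem prodOp_mul_star (u : V → Matrix κ κ ℂ) (hu : ∀ x, u x * star (u x) = 1) :
    prodOp u * star (prodOp u) = 1 := by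
  rw [← prodOp_star, ← prodOp_mul, ← prodOp_one]
  congr 1
  ext1 y
  exact hu y

/-- Relabelling the sites. -/
theorem oneSite_reindex {W : Type*} [Fintype W] [DecidableEq W] (e : V ≃ W) (x : V)
    (M : Matrix κ κ ℂ) (σ τ : W → κ) :
    oneSite x M (σ ∘ e) (τ ∘ e) = oneSite (e x) M σ τ := by
  rw [oneSite_eq_prodOp, oneSite_eq_prodOp, prodOp_apply, prodOp_apply, ← Equiv.prod_comp e]
  refine Finset.prod_congr rfl fun y _ => ?_
  by_cases h : y = x
  · subst h; simp
  · rw [Pi.mulSingle_eq_of_ne h, Pi.mulSingle_eq_of_ne (e.injective.ne h)]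
    rfl

end ProdOp

theorem siteOp_eq_oneSite {d n : ℕ} {Γ : Finset (Site d)} (x : Γ)
    (M : Matrix (Fin (n + 1)) (Fin (n + 1)) ℂ) : siteOp x M = oneSite x M := by
  ext σ τ
  classical
  rw [oneSite_apply]
  simp [siteOp]

/-! ### States on star algebras -/

section States

/-- A normalized positive linear functional on a unital `*`-algebra. -/
structure IsPosState {A : Type*} [Ring A] [StarRing A] [Algebra ℂ A] (φ : A →ₗ[ℂ] ℂ) : Prop where
  one : φ 1 = 1
  nonneg : ∀ a, 0 ≤ φ (star a * a)

variable {A : Type*} [Ring A] [StarRing A] [Algebra ℂ A] [StarModule ℂ A] {φ : A →ₗ[ℂ] ℂ}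

/-- Positivity makes the values at (1 + a)*(1 + a) and (1 + ia)*(1 + ia) real; their cross terms
give the imaginary and the real part of the identity. -/
theorem IsPosState.map_star (hφ : IsPosState φ) (a : A) : φ (star a) = star (φ a) := by
  have h0 := (Complex.le_def.1 (hφ.nonneg a)).2
  have h1 := (Complex.le_def.1 (hφ.nonneg (1 + a))).2
  have h2 := (Complex.le_def.1 (hφ.nonneg (1 + Complex.I • a))).2
  have h3 := (Complex.le_def.1 (hφ.nonneg (Complex.I • a))).2
  simp only [star_add, star_one, star_smul, add_mul, one_mul, mul_add, mul_one, map_add, hφ.one,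
    smul_mul_assoc, mul_smul_comm, map_smul, smul_eq_mul, Complex.add_im, Complex.zero_im,
    Complex.mul_im, Complex.one_im, Complex.I_re, Complex.I_im, RCLike.star_def, Complex.conj_I,
    Complex.neg_re, Complex.neg_im, Complex.mul_re] at h0 h1 h2 h3
  apply Complex.ext <;> simp <;> linarith

/-- The uncertainty relation. -/
theorem IsPosState.uncertainty (hφ : IsPosState φ) {a c : A} (ha : star a = a) (hc : star c = c) :
    (φ (a * c - c * a)).im ^ 2 ≤ 4 * (φ (a * a)).re * (φ (c * c)).re := by
  -- Positivity on a + itc gives a quadratic polynomial in t which is nowhere negative; the relation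
  -- is the sign of its discriminant.
  have h : ∀ t : ℝ, 0 ≤ (φ (c * c)).re * (t * t) + (-(φ (a * c - c * a)).im) * t
      + (φ (a * a)).re := by
    intro t
    have h0 := (Complex.le_def.1 (hφ.nonneg (a + (Complex.I * t : ℂ) • c))).1
    simp only [star_add, star_smul, ha, hc, add_mul, mul_add, smul_mul_assoc, mul_smul_comm,
      map_add, map_smul, smul_eq_mul, map_sub, Complex.sub_im, star_mul', RCLike.star_def,
      Complex.conj_I, Complex.conj_ofReal] at h0 ⊢
    simp at h0
    nlinarith [h0]
  have := discrim_le_zero h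
  rw [discrim] at this
  nlinarith [this]

end States

/-! ### States on matrix algebras are contractions for the operator norm -/

section MatrixStates

variable {ι : Type*} [Fintype ι] [DecidableEq ι]

theorem IsPosState.re_nonneg {φ : Matrix ι ι ℂ →ₗ[ℂ] ℂ} (hφ : IsPosState φ) {a : Matrix ι ι ℂ}
    (ha : a.PosSemidef) : 0 ≤ (φ a).re := by
  obtain ⟨b, rfl⟩ : ∃ b, a = star b * b := by
    open scoped MatrixOrder in
    exact CStarAlgebra.nonneg_iff_eq_star_mul_self.1 (Matrix.nonneg_iff_posSemidef.2 ha)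
  exact (Complex.le_def.1 (hφ.nonneg b)).1

-- The self-adjoint element a + a* is at most its norm, and its expectation is twice the real part
-- of φ a.
open scoped Matrix.Norms.L2Operator in
theorem IsPosState.re_le_norm {φ : Matrix ι ι ℂ →ₗ[ℂ] ℂ} (hφ : IsPosState φ) (a : Matrix ι ι ℂ) :
    (φ a).re ≤ ‖a‖ := by
  have hs : IsSelfAdjoint (a + star a) := IsSelfAdjoint.add_star_self a
  have h1 : (algebraMap ℝ (Matrix ι ι ℂ) ‖a + star a‖ - (a + star a)).PosSemidef := by
    open scoped MatrixOrder in
    exact Matrix.le_iff.1 hs.le_algebraMap_norm_self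
  have h2 := hφ.re_nonneg h1
  have h3 : φ (algebraMap ℝ (Matrix ι ι ℂ) ‖a + star a‖) = ‖a + star a‖ := by
    rw [Algebra.algebraMap_eq_smul_one, ← Complex.coe_smul, map_smul, hφ.one]; simp
  rw [map_sub, map_add, hφ.map_star, h3] at h2
  simp at h2
  have h4 := norm_add_le a (star a)
  rw [norm_star] at h4
  linarith

open scoped Matrix.Norms.L2Operator in
theorem IsPosState.norm_le {φ : Matrix ι ι ℂ →ₗ[ℂ] ℂ} (hφ : IsPosState φ) (a : Matrix ι ι ℂ) :
    ‖φ a‖ ≤ ‖a‖ := by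
  obtain ⟨c, hc, h⟩ : ∃ c : ℂ, ‖c‖ = 1 ∧ ‖φ a‖ = (c * φ a).re := by
    by_cases h0 : φ a = 0
    · exact ⟨1, by simp, by simp [h0]⟩
    · have h1 : (‖φ a‖ : ℂ) ≠ 0 := by simpa using h0
      refine ⟨star (φ a) / ‖φ a‖, by simp [h0], ?_⟩
      have : star (φ a) / ‖φ a‖ * φ a = ‖φ a‖ := by
        rw [div_mul_eq_mul_div, RCLike.star_def, mul_comm, Complex.mul_conj, Complex.normSq_eq_norm_sq]
        field_simp
        push_cast
        ring
      rw [this, Complex.ofReal_re]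
  rw [h, ← smul_eq_mul, ← map_smul]
  refine (hφ.re_le_norm _).trans ?_
  rw [norm_smul, hc, one_mul]

end MatrixStates

/-! ### Ground states of Hermitian matrices -/

section Ground

variable {ι : Type*} [Fintype ι] [DecidableEq ι]

/-- The real numbers among the complex eigenvalues are the Hermitian eigenvalues, so the infimum in
`groundEnergy` runs over a finite set. -/
theorem groundEnergy_eq_iInf {H : Matrix ι ι ℂ} (hH : H.IsHermitian) :
    groundEnergy H = ⨅ i, hH.eigenvalues i := by
  rw [groundEnergy, iInf]
  congr 1
  rw [← hH.spectrum_real_eq_range_eigenvalues]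
  ext E
  rw [Set.mem_ofPred_eq, Module.End.hasEigenvalue_iff_mem_spectrum, Matrix.spectrum_toLpLin,
    ← spectrum.algebraMap_mem_iff ℂ]
  rfl

theorem posSemidef_sub_groundEnergy {H : Matrix ι ι ℂ} (hH : H.IsHermitian) :
    (H - (groundEnergy H : ℂ) • 1).PosSemidef := by
  have hsa : (H - (groundEnergy H : ℂ) • 1).IsHermitian := by
    refine hH.sub ?_
    rw [Matrix.IsHermitian, Matrix.conjTranspose_smul]; simp
  rw [Matrix.posSemidef_iff_isHermitian_and_spectrum_nonneg]
  refine ⟨hsa, fun z hz => ?_⟩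
  rw [← Algebra.algebraMap_eq_smul_one] at hz
  have : z + groundEnergy H ∈ spectrum ℂ H := by
    rw [spectrum.add_mem_iff, neg_add_eq_sub]
    exact hz
  rw [hH.spectrum_eq_image_range] at this
  obtain ⟨_, ⟨i, rfl⟩, hi⟩ := this
  have h1 : groundEnergy H ≤ hH.eigenvalues i := by
    rw [groundEnergy_eq_iInf hH]
    exact ciInf_le (Set.finite_range _).bddBelow i
  have : z = ((hH.eigenvalues i - groundEnergy H : ℝ) : ℂ) := by
    push_cast
    rw [eq_sub_iff_add_eq]; exact hi.symm
  rw [this, Set.mem_ofPred_eq]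
  exact_mod_cast sub_nonneg.2 h1

theorem exists_groundVector [Nonempty ι] {H : Matrix ι ι ℂ} (hH : H.IsHermitian) :
    ∃ ψ : EuclideanSpace ℂ ι, ‖ψ‖ = 1 ∧ Matrix.toEuclideanLin H ψ = (groundEnergy H : ℂ) • ψ := by
  obtain ⟨i, hi⟩ := exists_eq_ciInf_of_finite (f := hH.eigenvalues)
  refine ⟨hH.eigenvectorBasis i, by simp, ?_⟩
  rw [groundEnergy_eq_iInf hH, ← hi]
  ext1
  rw [Matrix.ofLp_toLpLin]
  have h := hH.mulVec_eigenvectorBasis i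
  rw [← Complex.coe_smul] at h
  exact congrFun h _

/-- The matrix of the projection onto the ground states. -/
def groundMat (H : Matrix ι ι ℂ) : Matrix ι ι ℂ := Matrix.toEuclideanLin.symm (groundProj H)

theorem toEuclideanLin_groundMat (H : Matrix ι ι ℂ) :
    Matrix.toEuclideanLin (groundMat H) = groundProj H := LinearEquiv.apply_symm_apply _ _

theorem groundMat_isHermitian (H : Matrix ι ι ℂ) : (groundMat H).IsHermitian := by
  rw [← Matrix.isSymmetric_toEuclideanLin_iff, toEuclideanLin_groundMat]
  exact Submodule.starProjection_isSymmetric _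

theorem groundMat_mul_self (H : Matrix ι ι ℂ) : groundMat H * groundMat H = groundMat H := by
  apply Matrix.toEuclideanLin.injective
  rw [Matrix.toEuclideanLin, Matrix.toLpLin_mul_same]
  change Matrix.toEuclideanLin (groundMat H) ∘ₗ Matrix.toEuclideanLin (groundMat H) =
    Matrix.toEuclideanLin (groundMat H)
  rw [toEuclideanLin_groundMat]
  ext1 v
  exact congrArg (fun f => f v) (Submodule.isIdempotentElem_starProjection
    (Module.End.eigenspace (Matrix.toEuclideanLin H) (groundEnergy H : ℂ))).eq

theorem mul_groundMat (H : Matrix ι ι ℂ) :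
    H * groundMat H = (groundEnergy H : ℂ) • groundMat H := by
  apply Matrix.toEuclideanLin.injective
  rw [Matrix.toEuclideanLin, Matrix.toLpLin_mul_same, map_smul]
  change Matrix.toEuclideanLin H ∘ₗ Matrix.toEuclideanLin (groundMat H) =
    _ • Matrix.toEuclideanLin (groundMat H)
  rw [toEuclideanLin_groundMat]
  ext1 v
  exact Module.End.mem_eigenspace_iff.1 (Submodule.starProjection_apply_mem
    (Module.End.eigenspace (Matrix.toEuclideanLin H) (groundEnergy H : ℂ)) v)

/-- Every column of X lies in the ground eigenspace, which the projection fixes. -/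
theorem groundMat_mul {H X : Matrix ι ι ℂ} (hX : H * X = (groundEnergy H : ℂ) • X) :
    groundMat H * X = X := by
  apply Matrix.toEuclideanLin.injective
  have h := congrArg Matrix.toEuclideanLin hX
  rw [Matrix.toEuclideanLin, Matrix.toLpLin_mul_same, map_smul] at h
  rw [Matrix.toEuclideanLin, Matrix.toLpLin_mul_same]
  change Matrix.toEuclideanLin (groundMat H) ∘ₗ Matrix.toEuclideanLin X =
    Matrix.toEuclideanLin X
  rw [toEuclideanLin_groundMat]
  ext1 v
  refine Submodule.starProjection_eq_self_iff.2 ?_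
  exact Module.End.mem_eigenspace_iff.2 (congrArg (fun f => f v) h)

theorem trace_toEuclideanLin (a : Matrix ι ι ℂ) :
    LinearMap.trace ℂ _ (Matrix.toEuclideanLin a) = a.trace := by
  rw [Matrix.toEuclideanLin, Matrix.toLpLin_eq_toLin, Matrix.trace_toLin_eq]

theorem groundExpect_eq (H a : Matrix ι ι ℂ) :
    groundExpect H a = (groundMat H * a).trace / (groundMat H).trace := by
  rw [groundExpect, ← toEuclideanLin_groundMat, trace_toEuclideanLin]
  congr 1
  rw [← trace_toEuclideanLin, Matrix.toEuclideanLin, Matrix.toLpLin_mul_same]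

/-- `groundExpect H` as a linear functional. -/
def groundState (H : Matrix ι ι ℂ) : Matrix ι ι ℂ →ₗ[ℂ] ℂ where
  toFun := groundExpect H
  map_add' a b := by simp [groundExpect_eq, mul_add, add_div]
  map_smul' c a := by simp [groundExpect_eq, mul_div_assoc]

theorem groundState_apply (H a : Matrix ι ι ℂ) : groundState H a = groundExpect H a := rfl

theorem groundMat_trace_pos [Nonempty ι] {H : Matrix ι ι ℂ} (hH : H.IsHermitian) :
    0 < (groundMat H).trace := by
  have hP : (groundMat H).PosSemidef := by
    have := Matrix.posSemidef_conjTranspose_mul_self (groundMat H)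
    rwa [groundMat_isHermitian, groundMat_mul_self] at this
  refine lt_of_le_of_ne hP.trace_nonneg fun h => ?_
  have h0 : groundMat H = 0 := hP.trace_eq_zero_iff.1 h.symm
  obtain ⟨ψ, hψ, hE⟩ := exists_groundVector hH
  have h1 : groundProj H ψ = ψ :=
    Submodule.starProjection_eq_self_iff.2 (Module.End.mem_eigenspace_iff.2 hE)
  rw [← toEuclideanLin_groundMat, h0] at h1
  simp at h1
  simp [← h1] at hψ

/-- Since P is a projection, Tr(P a) = Tr(P a P), the trace of a positive matrix. -/
theorem groundExpect_nonneg [Nonempty ι] {H a : Matrix ι ι ℂ} (hH : H.IsHermitian)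
    (ha : a.PosSemidef) : 0 ≤ groundExpect H a := by
  rw [groundExpect_eq]
  have h : (groundMat H * a).trace = ((groundMat H)ᴴ * a * groundMat H).trace := by
    rw [groundMat_isHermitian, Matrix.trace_mul_comm (groundMat H * a), ← mul_assoc,
      groundMat_mul_self]
  rw [h]
  have h1 := (ha.conjTranspose_mul_mul_same (groundMat H)).trace_nonneg
  have h2 := groundMat_trace_pos hH
  exact div_nonneg h1 h2.le

theorem groundState_isPosState [Nonempty ι] {H : Matrix ι ι ℂ} (hH : H.IsHermitian) :
    IsPosState (groundState H) where
  one := by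
    rw [groundState_apply, groundExpect_eq, mul_one, div_self (groundMat_trace_pos hH).ne']
  nonneg a := groundExpect_nonneg hH (Matrix.posSemidef_conjTranspose_mul_self a)

theorem groundState_mul_right {H : Matrix ι ι ℂ} (a : Matrix ι ι ℂ) :
    groundState H (a * H) = groundEnergy H * groundState H a := by
  simp only [groundState_apply, groundExpect_eq]
  rw [← mul_assoc, Matrix.trace_mul_comm, ← mul_assoc, mul_groundMat]
  simp [mul_div_assoc]

theorem groundState_mul_left {H : Matrix ι ι ℂ} (hH : H.IsHermitian) (a : Matrix ι ι ℂ) :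
    groundState H (H * a) = groundEnergy H * groundState H a := by
  have h : groundMat H * H = (groundEnergy H : ℂ) • groundMat H := by
    have := congrArg star (mul_groundMat H)
    simp only [Matrix.star_eq_conjTranspose, Matrix.conjTranspose_mul, Matrix.conjTranspose_smul] at this
    rw [groundMat_isHermitian, hH] at this
    simpa using this
  simp only [groundState_apply, groundExpect_eq]
  rw [← mul_assoc, h]
  simp [mul_div_assoc]

/-- In the ground state H acts from the right as its lowest eigenvalue E, so the expectation is that
of a*(H - E)a. This is the finite-volume form of the condition which defines infinite-volume ground
states. -/
theorem groundState_commutator_nonneg [Nonempty ι] {H : Matrix ι ι ℂ} (hH : H.IsHermitian)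
    (a : Matrix ι ι ℂ) : 0 ≤ (groundState H (star a * (H * a - a * H))).re := by
  have h : star a * (H * a - a * H) =
      star a * (H - (groundEnergy H : ℂ) • 1) * a -
        (star a * a * H - (groundEnergy H : ℂ) • (star a * a)) := by
    simp only [mul_sub, sub_mul, mul_smul_comm, smul_mul_assoc, mul_one, mul_assoc]
    abel
  rw [h, map_sub, map_sub, groundState_mul_right, map_smul, smul_eq_mul, sub_self, sub_zero]
  exact (Complex.le_def.1 (groundExpect_nonneg hH
    ((posSemidef_sub_groundEnergy hH).conjTranspose_mul_mul_same a))).1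

/-- A unitary symmetry of the Hamiltonian is a symmetry of its ground state. -/
theorem groundExpect_conj {H U : Matrix ι ι ℂ} (hU : star U * U = 1) (hUH : U * H = H * U)
    (hUH' : star U * H = H * star U) (a : Matrix ι ι ℂ) :
    groundExpect H (star U * a * U) = groundExpect H a := by
  set P := groundMat H with hP
  have hPs : star P = P := groundMat_isHermitian H
  -- Both U and its adjoint map the ground space into itself; hence U commutes with P, and cyclicity
  -- of the trace finishes the proof.
  have h1 : P * (U * P) = U * P := groundMat_mul (by
    rw [← mul_assoc, ← hUH, mul_assoc, mul_groundMat, mul_smul_comm])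
  have h2 : P * (star U * P) = star U * P := groundMat_mul (by
    rw [← mul_assoc, ← hUH', mul_assoc, mul_groundMat, mul_smul_comm])
  have h3 : P * U * P = P * U := by
    have := congrArg star h2
    simpa [hPs, mul_assoc] using this
  have h4 : U * P = P * U := by rw [← h1, ← mul_assoc, h3]
  have hU' : U * star U = 1 := mul_eq_one_comm.1 hU
  rw [groundExpect_eq, groundExpect_eq]
  congr 1
  rw [← mul_assoc, Matrix.trace_mul_comm, ← mul_assoc, ← mul_assoc, ← hP, h4, mul_assoc P, hU',
    mul_one]

/-- The variational principle, for mixed states. -/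
theorem groundEnergy_le_re {H : Matrix ι ι ℂ} (hH : H.IsHermitian) {φ : Matrix ι ι ℂ →ₗ[ℂ] ℂ}
    (hφ : IsPosState φ) : groundEnergy H ≤ (φ H).re := by
  have := hφ.re_nonneg (posSemidef_sub_groundEnergy hH)
  rw [map_sub, map_smul, hφ.one] at this
  simpa using this

end Ground

/-! ### Reflection positivity at the level of matrices -/

section Reflection

variable {α : Type*} [Fintype α] [DecidableEq α]

open scoped MatrixOrder in
/-- The absolute values of `c` and `c*` dominate `c` in the off-diagonal corner. -/
theorem exists_abs_dominating (c : Matrix α α ℂ) : ∃ cL cR : Matrix α α ℂ,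
    cL.IsHermitian ∧ cR.IsHermitian ∧ cL * cL = c * cᴴ ∧ cR * cR = cᴴ * c ∧
    (Matrix.fromBlocks cL c cᴴ cR).PosSemidef ∧ (Matrix.fromBlocks cL (-c) (-cᴴ) cR).PosSemidef := by
  have hL : 0 ≤ c * cᴴ := Matrix.nonneg_iff_posSemidef.2 (Matrix.posSemidef_self_mul_conjTranspose c)
  have hR : 0 ≤ cᴴ * c := Matrix.nonneg_iff_posSemidef.2 (Matrix.posSemidef_conjTranspose_mul_self c)
  set cL := CFC.sqrt (c * cᴴ)
  set cR := CFC.sqrt (cᴴ * c)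
  have hL0 : cL.PosSemidef := Matrix.nonneg_iff_posSemidef.1 (CFC.sqrt_nonneg _)
  have hR0 : cR.PosSemidef := Matrix.nonneg_iff_posSemidef.1 (CFC.sqrt_nonneg _)
  have hL1 : cL * cL = c * cᴴ := CFC.sqrt_mul_sqrt_self _ hL
  have hR1 : cR * cR = cᴴ * c := CFC.sqrt_mul_sqrt_self _ hR
  -- The off-diagonal block matrix Z is self-adjoint with |Z| = diag(|c*|, |c|), and |Z| ± Z is
  -- twice its positive or negative part. No polar decomposition of c is needed.
  set Z : Matrix (α ⊕ α) (α ⊕ α) ℂ := Matrix.fromBlocks 0 c cᴴ 0 with hZdef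
  have hZ : IsSelfAdjoint Z := by
    rw [IsSelfAdjoint, Matrix.star_eq_conjTranspose, hZdef, Matrix.fromBlocks_conjTranspose]
    simp
  have hQ : (Matrix.fromBlocks cL 0 0 cR).PosSemidef := by
    obtain ⟨x, hx⟩ := CStarAlgebra.nonneg_iff_eq_star_mul_self.1 (CFC.sqrt_nonneg (c * cᴴ))
    obtain ⟨y, hy⟩ := CStarAlgebra.nonneg_iff_eq_star_mul_self.1 (CFC.sqrt_nonneg (cᴴ * c))
    have := Matrix.posSemidef_conjTranspose_mul_self (Matrix.fromBlocks x 0 0 y)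
    rw [Matrix.fromBlocks_conjTranspose, Matrix.fromBlocks_multiply] at this
    have hx' : xᴴ * x = cL := hx.symm
    have hy' : yᴴ * y = cR := hy.symm
    simpa [hx', hy'] using this
  have habs : CFC.abs Z = Matrix.fromBlocks cL 0 0 cR := by
    refine CFC.sqrt_unique ?_ (Matrix.nonneg_iff_posSemidef.2 hQ)
    rw [hZ.star_eq, hZdef, Matrix.fromBlocks_multiply, Matrix.fromBlocks_multiply]
    simp [hL1, hR1]
  refine ⟨cL, cR, hL0.1, hR0.1, hL1, hR1, ?_, ?_⟩
  · have h : Matrix.fromBlocks cL c cᴴ cR = CFC.abs Z + Z := by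
      rw [habs, hZdef, Matrix.fromBlocks_add]; simp
    rw [h, CFC.abs_add_self Z hZ]
    exact Matrix.nonneg_iff_posSemidef.1 (nsmul_nonneg (CFC.posPart_nonneg Z) 2)
  · have h : Matrix.fromBlocks cL (-c) (-cᴴ) cR = CFC.abs Z - Z := by
      rw [habs, hZdef, sub_eq_add_neg, Matrix.fromBlocks_neg, Matrix.fromBlocks_add]; simp
    rw [h, CFC.abs_sub_self Z hZ]
    exact Matrix.nonneg_iff_posSemidef.1 (nsmul_nonneg (CFC.negPart_nonneg Z) 2)

/-- With Q = b*b, the trace becomes that of (bX) Q' (bX)*. -/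
theorem trace_mul_mul_conjTranspose_nonneg {β : Type*} [Fintype β] [DecidableEq β]
    {Q Q' : Matrix β β ℂ} (hQ : Q.PosSemidef) (hQ' : Q'.PosSemidef) (X : Matrix β β ℂ) :
    0 ≤ (Q * X * Q' * Xᴴ).trace := by
  obtain ⟨b, rfl⟩ : ∃ b, Q = star b * b := by
    open scoped MatrixOrder in
    exact CStarAlgebra.nonneg_iff_eq_star_mul_self.1 (Matrix.nonneg_iff_posSemidef.2 hQ)
  have h : (star b * b * X * Q' * Xᴴ).trace = ((b * X) * Q' * (b * X)ᴴ).trace := by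
    rw [Matrix.conjTranspose_mul, mul_assoc (star b), mul_assoc (star b), mul_assoc (star b),
      Matrix.trace_mul_comm]
    simp only [mul_assoc, Matrix.star_eq_conjTranspose]
  rw [h]
  exact (hQ'.mul_mul_conjTranspose_same _).trace_nonneg

theorem trace_blocks (a b c d : Matrix α α ℂ) :
    (Matrix.fromBlocks a b c d).trace = a.trace + d.trace := by
  simp [Matrix.trace, Fintype.sum_sum_type]

/-- The Schwarz inequality of reflection positivity. It is the positivity of the trace of (|Z| + Z)
D (|Z| - Z) D*, with Z the off-diagonal block matrix of c and D = diag(T, S): the diagonal blocks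
give the right side, and the opposite signs of the corners give the cross term. -/
theorem exists_reflected (c : Matrix α α ℂ) : ∃ cL cR : Matrix α α ℂ,
    cL.IsHermitian ∧ cR.IsHermitian ∧ cL * cL = c * cᴴ ∧ cR * cR = cᴴ * c ∧
    ∀ T S : Matrix α α ℂ, 2 * (cᴴ * T * c * Sᴴ).trace.re ≤
      (cLᴴ * T * cL * Tᴴ).trace.re + (cRᴴ * S * cR * Sᴴ).trace.re := by
  obtain ⟨cL, cR, hL, hR, hL1, hR1, h1, h2⟩ := exists_abs_dominating c
  refine ⟨cL, cR, hL, hR, hL1, hR1, fun T S => ?_⟩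
  have h := trace_mul_mul_conjTranspose_nonneg h1 h2 (Matrix.fromBlocks T 0 0 S)
  rw [Matrix.fromBlocks_conjTranspose, Matrix.fromBlocks_multiply, Matrix.fromBlocks_multiply,
    Matrix.fromBlocks_multiply, trace_blocks] at h
  simp only [mul_zero, add_zero, zero_add, Matrix.conjTranspose_zero, Matrix.trace_add, mul_neg,
    neg_mul, add_mul, Matrix.trace_neg] at h
  have h3 : (c * S * cᴴ * Tᴴ).trace.re = (cᴴ * T * c * Sᴴ).trace.re := by
    have : (c * S * cᴴ * Tᴴ) = (T * (c * Sᴴ * cᴴ))ᴴ := by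
      simp [Matrix.conjTranspose_mul, mul_assoc]
    rw [this, Matrix.trace_conjTranspose, Matrix.trace_mul_comm, mul_assoc (c * Sᴴ),
      Matrix.trace_mul_comm, ← mul_assoc, mul_assoc (cᴴ * T)]
    simp
  have h4 := (Complex.le_def.1 h).1
  simp only [Complex.add_re, Complex.neg_re, Complex.zero_re] at h4
  rw [hL, hR]
  rw [h3] at h4
  linarith

/-- The quadratic form of `H` is bounded below by `e`. -/
def FormGe {β : Type*} [Fintype β] (H : Matrix β β ℂ) (e : ℝ) : Prop :=
  ∀ ψ : β → ℂ, e * (star ψ ⬝ᵥ ψ).re ≤ (star ψ ⬝ᵥ H *ᵥ ψ).re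

-- A vector on two copies of a system is a matrix c, on which A ⊗ B acts as c ↦ A c Bᵀ. Thus the
-- coupling of the two halves becomes a trace to which `exists_reflected` applies.
open scoped Kronecker in
theorem dotProduct_kronecker_mulVec (A B : Matrix α α ℂ) (ψ : α × α → ℂ) :
    star ψ ⬝ᵥ (A ⊗ₖ B) *ᵥ ψ = ((Matrix.of fun i j => ψ (i, j))ᴴ * A *
      (Matrix.of fun i j => ψ (i, j)) * Bᵀ).trace := by
  set c : Matrix α α ℂ := Matrix.of fun i j => ψ (i, j) with hc
  have h1 : ∀ p : α × α, ((A ⊗ₖ B) *ᵥ ψ) p = (A * c * Bᵀ) p.1 p.2 := by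
    rintro ⟨i, j⟩
    simp only [Matrix.mulVec, dotProduct, Fintype.sum_prod_type, Matrix.kronecker_apply,
      Matrix.mul_apply, Matrix.transpose_apply, Finset.sum_mul]
    rw [Finset.sum_comm]
    refine Finset.sum_congr rfl fun l _ => Finset.sum_congr rfl fun k _ => ?_
    simp [hc]; ring
  rw [mul_assoc (cᴴ), mul_assoc cᴴ, Matrix.trace, dotProduct]
  simp only [h1, Fintype.sum_prod_type, Matrix.diag_apply, Matrix.mul_apply (M := cᴴ)]
  rw [Finset.sum_comm]
  refine Finset.sum_congr rfl fun j _ => Finset.sum_congr rfl fun i _ => ?_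
  simp [hc]

open scoped Kronecker in
/-- A Hamiltonian on two copies of a system, coupled by the terms `-T ⊗ conj S`. -/
def doubled {J : Type*} [Fintype J] (A B : Matrix α α ℂ) (T S : J → Matrix α α ℂ) :
    Matrix (α × α) (α × α) ℂ :=
  A ⊗ₖ 1 + 1 ⊗ₖ (B.map star) - ∑ j, T j ⊗ₖ ((S j).map star)

theorem form_doubled {J : Type*} [Fintype J] {A B : Matrix α α ℂ} 
    (T S : J → Matrix α α ℂ) (c : Matrix α α ℂ) :
    (star (fun p : α × α => c p.1 p.2) ⬝ᵥ doubled A B T S *ᵥ fun p => c p.1 p.2) =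
      (c * cᴴ * A).trace + (cᴴ * c * Bᴴ).trace - ∑ j, (cᴴ * T j * c * (S j)ᴴ).trace := by
  have hc : (Matrix.of fun i j => (fun p : α × α => c p.1 p.2) (i, j)) = c := rfl
  rw [doubled, Matrix.sub_mulVec, Matrix.add_mulVec, dotProduct_sub, dotProduct_add,
    dotProduct_kronecker_mulVec, dotProduct_kronecker_mulVec, hc, Matrix.sum_mulVec, dotProduct_sum]
  simp only [dotProduct_kronecker_mulVec, hc, mul_one, Matrix.transpose_one]
  rw [mul_assoc, Matrix.trace_mul_comm, Matrix.trace_mul_comm (c * cᴴ), ← mul_assoc]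
  rfl

theorem form_one (c : Matrix α α ℂ) :
    (star (fun p : α × α => c p.1 p.2) ⬝ᵥ fun p : α × α => c p.1 p.2) = (cᴴ * c).trace := by
  rw [Matrix.trace, dotProduct, Fintype.sum_prod_type, Finset.sum_comm]
  rfl

/-- Reflection positivity for the ground state energy. -/
theorem FormGe.of_doubled {J : Type*} [Fintype J] {A B : Matrix α α ℂ} (hA : A.IsHermitian)
    (hB : B.IsHermitian) {T S : J → Matrix α α ℂ} {e e' : ℝ}
    (h : FormGe (doubled A A T T) e) (h' : FormGe (doubled B B S S) e') :
    FormGe (doubled A B T S) ((e + e') / 2) := by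
  intro ψ
  -- The moduli cL and cR serve as trial vectors for the two symmetric Hamiltonians. They have the
  -- norm of c, and as cL² = c c* and cR² = c* c the one-sided energies are unchanged; only the
  -- coupling changes, in the favourable direction.
  obtain ⟨cL, cR, hL, hR, hL1, hR1, hTS⟩ := exists_reflected (Matrix.of fun i j => ψ (i, j))
  set c : Matrix α α ℂ := Matrix.of fun i j => ψ (i, j) with hc
  have hψ : ψ = fun p : α × α => c p.1 p.2 := rfl
  have h1 := h (fun p => cL p.1 p.2)
  have h2 := h' (fun p => cR p.1 p.2)
  rw [form_doubled, form_one] at h1 h2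
  rw [hψ, form_doubled, form_one]
  have hcc : (c * cᴴ).trace = (cᴴ * c).trace := Matrix.trace_mul_comm _ _
  simp only [hA.eq, hB.eq] at h1 h2 ⊢
  rw [hL.eq, hL1, hcc] at h1
  rw [hR.eq, hR1] at h2
  simp only [Complex.add_re, Complex.sub_re, Complex.re_sum] at h1 h2 ⊢
  have h3 := Finset.sum_le_sum fun j (_ : j ∈ Finset.univ) => hTS (T j) (S j)
  rw [← Finset.mul_sum, Finset.sum_add_distrib, hL.eq, hR.eq] at h3
  linarith

end Reflection

/-! ### Invariance of lower bounds -/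

section FormGe

variable {β γ : Type*} [Fintype β] [DecidableEq β] [Fintype γ] [DecidableEq γ]

theorem FormGe.conj {H U : Matrix β β ℂ} {e : ℝ} (hU : U * star U = 1) (h : FormGe H e) :
    FormGe (U * H * star U) e := by
  intro ψ
  have h1 := h (star U *ᵥ ψ)
  have h2 : star (star U *ᵥ ψ) = star ψ ᵥ* U := by
    rw [Matrix.star_mulVec, Matrix.star_eq_conjTranspose, Matrix.conjTranspose_conjTranspose]
  rw [h2, ← Matrix.dotProduct_mulVec, ← Matrix.dotProduct_mulVec, Matrix.mulVec_mulVec,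
    Matrix.mulVec_mulVec, Matrix.mulVec_mulVec, hU, Matrix.one_mulVec] at h1
  exact h1

theorem FormGe.conj_iff {H U : Matrix β β ℂ} {e : ℝ} (hU : U * star U = 1) :
    FormGe (U * H * star U) e ↔ FormGe H e := by
  have hU' : star U * U = 1 := mul_eq_one_comm.1 hU
  refine ⟨fun h => ?_, fun h => h.conj hU⟩
  have := h.conj (U := star U) (by rwa [star_star])
  rwa [star_star, ← mul_assoc, ← mul_assoc, hU', one_mul, mul_assoc, hU', mul_one] at this

theorem FormGe.reindex_iff {H : Matrix β β ℂ} {e : ℝ} (E : β ≃ γ) :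
    FormGe (Matrix.reindexAlgEquiv ℂ ℂ E H) e ↔ FormGe H e := by
  have key : ∀ ψ : γ → ℂ, (star ψ ⬝ᵥ Matrix.reindexAlgEquiv ℂ ℂ E H *ᵥ ψ) =
      star (ψ ∘ E) ⬝ᵥ H *ᵥ (ψ ∘ E) := by
    intro ψ
    simp only [dotProduct, Matrix.mulVec, Matrix.coe_reindexAlgEquiv, Matrix.reindex_apply,
      Matrix.submatrix_apply]
    rw [← Equiv.sum_comp E]
    refine Finset.sum_congr rfl fun i _ => ?_
    rw [← Equiv.sum_comp E]
    simp
  have key' : ∀ ψ : γ → ℂ, (star ψ ⬝ᵥ ψ) = star (ψ ∘ E) ⬝ᵥ (ψ ∘ E) := by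
    intro ψ
    simp only [dotProduct]
    rw [← Equiv.sum_comp E]
    rfl
  constructor
  · intro h ψ
    have := h (ψ ∘ E.symm)
    rw [key, key'] at this
    simpa [Function.comp_assoc] using this
  · intro h ψ
    rw [key, key']
    exact h _

/-- Links lower bounds on quadratic forms, which move easily through unitaries and relabellings of
the basis, with the least eigenvalue. -/
theorem formGe_iff_le_groundEnergy [Nonempty β] {H : Matrix β β ℂ} (hH : H.IsHermitian) {e : ℝ} :
    FormGe H e ↔ e ≤ groundEnergy H := by
  constructor
  · intro h
    obtain ⟨ψ, hψ, hE⟩ := exists_groundVector hH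
    have h1 := h ψ.ofLp
    have h2 : H *ᵥ ψ.ofLp = (groundEnergy H : ℂ) • ψ.ofLp := congrArg WithLp.ofLp hE
    have h3 : star ψ.ofLp ⬝ᵥ ψ.ofLp = 1 := by
      have := EuclideanSpace.inner_eq_star_dotProduct ψ ψ
      rw [inner_self_eq_norm_sq_to_K, hψ, dotProduct_comm] at this
      simpa using this.symm
    rw [h2, dotProduct_smul, h3] at h1
    simpa using h1
  · intro h ψ
    have h1 := (posSemidef_sub_groundEnergy hH).re_dotProduct_nonneg ψ
    rw [Matrix.sub_mulVec, dotProduct_sub, Matrix.smul_mulVec, Matrix.one_mulVec,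
      dotProduct_smul] at h1
    have h2 : 0 ≤ (star ψ ⬝ᵥ ψ).re := by
      simpa using Matrix.PosSemidef.one.re_dotProduct_nonneg (𝕜 := ℂ) ψ
    simp at h1
    nlinarith

end FormGe

/-! ### Antiferromagnets in shifted form -/

section SpinH

variable {V κ : Type*} [Fintype V] [DecidableEq V] [Fintype κ] [DecidableEq κ]

/-- The spin vector, with first component shifted by `k`. -/
def shiftedSpin (s : Fin 3 → Matrix κ κ ℂ) (k : ℝ) (a : Fin 3) : Matrix κ κ ℂ :=
  s a - ((if a = 0 then k else 0 : ℝ) : ℂ) • 1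

/-- The one-site terms which accompany the shift. -/
def shiftedSite (s : Fin 3 → Matrix κ κ ℂ) (D b k : ℝ) : Matrix κ κ ℂ :=
  -- These are the terms left when S_x S_y is written as ((S_x + S_y)² - S_x² - S_y²)/2 and only the
  -- first square is shifted, to (S_x + S_y - k_x - k_y)². Each bond contributes to both of its
  -- ends, which gives the factor D, the degree of the site.
  (-(D * k) : ℝ) • s 0 + (D * k ^ 2 / 2 : ℝ) • 1 - b • s 2

open Classical in
/-- The antiferromagnetic Hamiltonian with shifted first components, and field `b` in the third
direction. -/
def shiftedHam (s : Fin 3 → Matrix κ κ ℂ) (adj : V → V → Prop) (D b k : V → ℝ) :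
    Matrix (V → κ) (V → κ) ℂ :=
  (1 / 2 : ℝ) • ∑ x, ∑ y, (if adj x y then ∑ a, oneSite x (shiftedSpin s (k x) a) *
    oneSite y (shiftedSpin s (k y) a) else 0) + ∑ x, oneSite x (shiftedSite s (D x) (b x) (k x))

theorem shiftedSpin_isSelfAdjoint {s : Fin 3 → Matrix κ κ ℂ} (hs : ∀ a, IsSelfAdjoint (s a)) (k : ℝ)
    (a : Fin 3) : IsSelfAdjoint (shiftedSpin s k a) := by
  refine (hs a).sub ?_
  rw [IsSelfAdjoint, star_smul, star_one]
  simp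

theorem shiftedSite_isSelfAdjoint {s : Fin 3 → Matrix κ κ ℂ} (hs : ∀ a, IsSelfAdjoint (s a))
    (D b k : ℝ) : IsSelfAdjoint (shiftedSite s D b k) := by
  refine (IsSelfAdjoint.add ?_ ?_).sub ?_ <;> rw [IsSelfAdjoint, star_smul]
  · rw [(hs 0).star_eq]; rfl
  · rw [star_one]; rfl
  · rw [(hs 2).star_eq]; rfl

theorem shiftedHam_isHermitian {s : Fin 3 → Matrix κ κ ℂ} (hs : ∀ a, IsSelfAdjoint (s a))
    {adj : V → V → Prop} (hadj : ∀ x y, adj x y → adj y x) (D b k : V → ℝ) :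
    (shiftedHam s adj D b k).IsHermitian := by
  classical
  refine IsSelfAdjoint.add ?_ ?_
  · rw [IsSelfAdjoint, star_smul]
    congr 1
    simp only [star_sum]
    rw [Finset.sum_comm]
    refine Finset.sum_congr rfl fun x _ => Finset.sum_congr rfl fun y _ => ?_
    by_cases h : adj x y
    · rw [if_pos h, if_pos (hadj _ _ h), star_sum]
      refine Finset.sum_congr rfl fun a _ => ?_
      rw [star_mul, ← map_star, ← map_star, (shiftedSpin_isSelfAdjoint hs _ _).star_eq,
        (shiftedSpin_isSelfAdjoint hs _ _).star_eq]
    · rw [if_neg h, if_neg fun h' => h (hadj _ _ h'), star_zero]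
  · simp only [IsSelfAdjoint, star_sum, ← map_star, (shiftedSite_isSelfAdjoint hs _ _ _).star_eq]

/-- A decomposition of the sites in two halves, which are mirror images. -/
structure Mirror (adj : V → V → Prop) (P : Type*) where
  e : V ≃ P ⊕ P
  adj_iff : ∀ x y, adj (e.symm (.inl x)) (e.symm (.inl y)) ↔ adj (e.symm (.inr x)) (e.symm (.inr y))
  cross : ∀ x y, adj (e.symm (.inl x)) (e.symm (.inr y)) → x = y

variable {P : Type*} [Fintype P] [DecidableEq P]

/-- The rotation of the spins in the right half. -/
def Mirror.rot {adj : V → V → Prop} (m : Mirror adj P) (u : Matrix κ κ ℂ) (x : V) :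
    Matrix κ κ ℂ := Sum.elim (fun _ => 1) (fun _ => u) (m.e x)

/-- The configurations are pairs of configurations of the halves. -/
def Mirror.split {adj : V → V → Prop} (m : Mirror adj P) (κ : Type*) :
    (V → κ) ≃ (P → κ) × (P → κ) :=
  (Equiv.arrowCongr m.e (Equiv.refl κ)).trans (Equiv.sumArrowEquivProdArrow P P κ)

theorem Mirror.rot_mul_star {adj : V → V → Prop} (m : Mirror adj P) {u : Matrix κ κ ℂ}
    (hu : u * star u = 1) (x : V) : m.rot u x * star (m.rot u x) = 1 := by
  rw [Mirror.rot]
  rcases m.e x with p | p <;> simp [hu]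

/-- Rotation of the right half, followed by the splitting. -/
def Mirror.hom {adj : V → V → Prop} (m : Mirror adj P) {u : Matrix κ κ ℂ}
    (hu : u * star u = 1) : Matrix (V → κ) (V → κ) ℂ →ₐ[ℂ]
      Matrix ((P → κ) × (P → κ)) ((P → κ) × (P → κ)) ℂ :=
  (Matrix.reindexAlgEquiv ℂ ℂ (m.split κ)).toAlgHom.comp
    (AlgHom.ofLinearMap
      { toFun := fun a => prodOp (m.rot u) * a * star (prodOp (m.rot u))
        map_add' := by intros; simp [mul_add, add_mul]
        map_smul' := by intros; simp }
      (by
        change prodOp (m.rot u) * 1 * star (prodOp (m.rot u)) = 1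
        rw [mul_one, prodOp_mul_star _ (m.rot_mul_star hu)])
      (by
        intro a b
        have h : star (prodOp (m.rot u)) * prodOp (m.rot u) = 1 :=
          mul_eq_one_comm.1 (prodOp_mul_star _ (m.rot_mul_star hu))
        change prodOp (m.rot u) * (a * b) * star (prodOp (m.rot u)) =
          prodOp (m.rot u) * a * star (prodOp (m.rot u)) *
            (prodOp (m.rot u) * b * star (prodOp (m.rot u)))
        calc _ = prodOp (m.rot u) * a * 1 * b * star (prodOp (m.rot u)) := by
              simp only [mul_one, mul_assoc]
          _ = _ := by rw [← h]; simp only [mul_assoc]))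

theorem Mirror.hom_apply {adj : V → V → Prop} (m : Mirror adj P) {u : Matrix κ κ ℂ}
    (hu : u * star u = 1) (a : Matrix (V → κ) (V → κ) ℂ) :
    m.hom hu a = Matrix.reindexAlgEquiv ℂ ℂ (m.split κ)
      (prodOp (m.rot u) * a * star (prodOp (m.rot u))) := rfl

theorem Mirror.formGe_hom_iff {adj : V → V → Prop} (m : Mirror adj P) {u : Matrix κ κ ℂ}
    (hu : u * star u = 1) {a : Matrix (V → κ) (V → κ) ℂ} {e : ℝ} :
    FormGe (m.hom hu a) e ↔ FormGe a e := by
  rw [m.hom_apply, FormGe.reindex_iff, FormGe.conj_iff (prodOp_mul_star _ (m.rot_mul_star hu))]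

open scoped Kronecker in
/-- The embedding of the observables of the left half. -/
def leftHom (β : Type*) [Fintype β] [DecidableEq β] : Matrix β β ℂ →+* Matrix (β × β) (β × β) ℂ where
  toFun A := A ⊗ₖ 1
  map_one' := by simp
  map_mul' A B := by rw [← Matrix.mul_kronecker_mul, mul_one]
  map_zero' := by simp
  map_add' A B := by rw [Matrix.add_kronecker]

open scoped Kronecker in
/-- The conjugate-linear embedding of the observables of the right half. -/
def rightHom (β : Type*) [Fintype β] [DecidableEq β] : Matrix β β ℂ →+* Matrix (β × β) (β × β) ℂ where
  toFun A := 1 ⊗ₖ (A.map star)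
  map_one' := by simp
  map_mul' A B := by
    rw [← Matrix.mul_kronecker_mul, mul_one]
    congr 1
    exact Matrix.map_mul (f := starRingEnd ℂ)
  map_zero' := by simp
  map_add' A B := by rw [← Matrix.kronecker_add]; congr 1; ext; simp

theorem leftHom_smul {β : Type*} [Fintype β] [DecidableEq β] (c : ℝ) (A : Matrix β β ℂ) :
    leftHom β (c • A) = c • leftHom β A := Matrix.smul_kronecker _ _ _

theorem rightHom_smul {β : Type*} [Fintype β] [DecidableEq β] (c : ℝ) (A : Matrix β β ℂ) :
    rightHom β (c • A) = c • rightHom β A := by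
  ext p q
  simp [rightHom, mul_left_comm]

theorem commute_leftHom_rightHom {β : Type*} [Fintype β] [DecidableEq β] (A B : Matrix β β ℂ) :
    rightHom β B * leftHom β A = leftHom β A * rightHom β B := by
  change Matrix.kronecker _ _ * Matrix.kronecker _ _ = Matrix.kronecker _ _ * Matrix.kronecker _ _ 
  simp only [Matrix.kronecker, ← Matrix.mul_kronecker_mul, mul_one, one_mul]

theorem doubled_eq {β J : Type*} [Fintype β] [DecidableEq β] [Fintype J] (A B : Matrix β β ℂ)
    (T S : J → Matrix β β ℂ) :
    doubled A B T S = leftHom β A + rightHom β B - ∑ j, leftHom β (T j) * rightHom β (S j) := by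
  rw [doubled]
  congr 1
  refine Finset.sum_congr rfl fun j _ => ?_
  change _ = Matrix.kronecker _ _ * Matrix.kronecker _ _
  simp only [Matrix.kronecker, ← Matrix.mul_kronecker_mul, mul_one, one_mul]

theorem Mirror.hom_left {adj : V → V → Prop} (m : Mirror adj P) {u : Matrix κ κ ℂ}
    (hu : u * star u = 1) (x : P) (M : Matrix κ κ ℂ) :
    m.hom hu (oneSite (m.e.symm (.inl x)) M) = leftHom _ (oneSite x M) := by
  rw [m.hom_apply, prodOp_conj_oneSite _ (m.rot_mul_star hu)]
  have h : m.rot u (m.e.symm (.inl x)) = 1 := by simp [Mirror.rot]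
  rw [h, star_one, mul_one, one_mul]
  ext ⟨σ, σ'⟩ ⟨τ, τ'⟩
  have h1 : ∀ q : (P → κ) × (P → κ), (m.split κ).symm q = Sum.elim q.1 q.2 ∘ m.e := fun q => rfl
  rw [Matrix.coe_reindexAlgEquiv, Matrix.reindex_apply, Matrix.submatrix_apply, h1, h1,
    oneSite_reindex, Equiv.apply_symm_apply]
  change _ = oneSite x M σ τ * (1 : Matrix (P → κ) (P → κ) ℂ) σ' τ'
  rw [oneSite_eq_prodOp, oneSite_eq_prodOp, prodOp_apply, ← prodOp_one, prodOp_apply, prodOp_apply,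
    Fintype.prod_sum_type]
  congr 1
  refine Finset.prod_congr rfl fun y _ => ?_
  by_cases h : y = x
  · subst h; simp
  · simp [Pi.mulSingle_eq_of_ne h, Pi.mulSingle_eq_of_ne (Sum.inl_injective.ne h)]

-- The right half is represented through complex conjugation, so a matrix M there appears as the N
-- whose conjugate is the rotated M.
open scoped Kronecker in
theorem Mirror.hom_right {adj : V → V → Prop} (m : Mirror adj P) {u : Matrix κ κ ℂ}
    (hu : u * star u = 1) (x : P) {M N : Matrix κ κ ℂ} (hMN : u * M * star u = N.map star) :
    m.hom hu (oneSite (m.e.symm (.inr x)) M) = rightHom _ (oneSite x N) := by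
  rw [m.hom_apply, prodOp_conj_oneSite _ (m.rot_mul_star hu)]
  have h : m.rot u (m.e.symm (.inr x)) = u := by simp [Mirror.rot]
  rw [h, hMN]
  ext ⟨σ, σ'⟩ ⟨τ, τ'⟩
  have h1 : ∀ q : (P → κ) × (P → κ), (m.split κ).symm q = Sum.elim q.1 q.2 ∘ m.e := fun q => rfl
  rw [Matrix.coe_reindexAlgEquiv, Matrix.reindex_apply, Matrix.submatrix_apply, h1, h1,
    oneSite_reindex, Equiv.apply_symm_apply]
  change _ = (1 : Matrix (P → κ) (P → κ) ℂ) σ τ * star (oneSite x N σ' τ')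
  rw [oneSite_eq_prodOp, oneSite_eq_prodOp, prodOp_apply, ← prodOp_one, prodOp_apply, prodOp_apply,
    Fintype.prod_sum_type]
  congr 1
  rw [star_prod]
  refine Finset.prod_congr rfl fun y _ => ?_
  by_cases h : y = x
  · subst h; simp
  · rw [Pi.mulSingle_eq_of_ne h, Pi.mulSingle_eq_of_ne (Sum.inr_injective.ne h)]
    by_cases h2 : σ' y = τ' y <;> simp [Matrix.one_apply, h2]

end SpinH

/-! ### Reflection positivity and Gaussian domination for the antiferromagnet -/

section GaussianDomination

variable {V κ : Type*} [Fintype V] [DecidableEq V] [Fintype κ] [DecidableEq κ]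
variable {P : Type*} [Fintype P] [DecidableEq P]

theorem Mirror.sum_eq {adj : V → V → Prop} (m : Mirror adj P) {M : Type*} [AddCommMonoid M]
    (f : V → M) : ∑ x, f x = ∑ p, f (m.e.symm (.inl p)) + ∑ p, f (m.e.symm (.inr p)) := by
  rw [← Equiv.sum_comp m.e.symm, Fintype.sum_sum_type]

/-- The rotation sends each spin component to minus its conjugate but fixes the scalar k; after the
overall sign is taken out, the shift has changed sign. -/
theorem conj_shiftedSpin {u : Matrix κ κ ℂ} (hu : u * star u = 1) {s : Fin 3 → Matrix κ κ ℂ}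
    (hs : ∀ a, u * s a * star u = -(s a).map star) (k : ℝ) (a : Fin 3) :
    u * shiftedSpin s k a * star u = (-shiftedSpin s (-k) a).map star := by
  have h : ∀ c : ℝ, ((c : ℂ) • (1 : Matrix κ κ ℂ)).map star = (c : ℂ) • 1 := by
    intro c
    ext i j
    by_cases h : i = j <;> simp [h]
  have h2 : (-shiftedSpin s (-k) a).map star = -(s a).map star -
      (((if a = 0 then k else 0 : ℝ) : ℂ) • (1 : Matrix κ κ ℂ)).map star := by
    ext i j
    by_cases h : a = 0 <;> simp [shiftedSpin, h]
    ring
  rw [h2, h, shiftedSpin, mul_sub, sub_mul, hs, mul_smul_comm, smul_mul_assoc, mul_one, hu]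

theorem conj_shiftedSite {u : Matrix κ κ ℂ} (hu : u * star u = 1) {s : Fin 3 → Matrix κ κ ℂ}
    (hs : ∀ a, u * s a * star u = -(s a).map star) (D b k : ℝ) :
    u * shiftedSite s D b k * star u = (shiftedSite s D (-b) (-k)).map star := by
  have h : ∀ c : ℝ, (c • (1 : Matrix κ κ ℂ)).map star = c • 1 := by
    intro c
    ext i j
    by_cases h : i = j <;> simp [h]
  have h2 : (shiftedSite s D (-b) (-k)).map star = (D * k) • (s 0).map star +
      ((D * k ^ 2 / 2) • (1 : Matrix κ κ ℂ)).map star + b • (s 2).map star := by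
    ext i j
    simp [shiftedSite]
  rw [h2, h, shiftedSite, mul_sub, sub_mul, mul_add, add_mul, mul_smul_comm, smul_mul_assoc, hs,
    mul_smul_comm, smul_mul_assoc, mul_one, hu, mul_smul_comm, smul_mul_assoc, hs]
  simp

open Classical in
/-- The interaction through the reflection plane. -/
def Mirror.bond {adj : V → V → Prop} (m : Mirror adj P) (s : Fin 3 → Matrix κ κ ℂ) (k : P → ℝ)
    (j : P × Fin 3) : Matrix (P → κ) (P → κ) ℂ :=
  if adj (m.e.symm (.inl j.1)) (m.e.symm (.inr j.1)) then
    oneSite j.1 (shiftedSpin s (k j.1) j.2) else 0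

/-- The Hamiltonian of one half. -/
def Mirror.half {adj : V → V → Prop} (m : Mirror adj P) (s : Fin 3 → Matrix κ κ ℂ)
    (D b k : P → ℝ) : Matrix (P → κ) (P → κ) ℂ :=
  shiftedHam s (fun x y => adj (m.e.symm (.inl x)) (m.e.symm (.inl y))) D b k

/-- Rotating the right half turns each crossing term S·S into -T ⊗ conj T', the coupling needed for
reflection positivity. Bonds inside the right half contain two rotated spins and keep their sign,
while b and k change sign there. -/
theorem Mirror.hom_shiftedHam {adj : V → V → Prop} (m : Mirror adj P)
    (hadj : ∀ x y, adj x y → adj y x) {u : Matrix κ κ ℂ}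
    (hu : u * star u = 1) {s : Fin 3 → Matrix κ κ ℂ}
    (hs : ∀ a, u * s a * star u = -(s a).map star) {D : V → ℝ} {D' : P → ℝ}
    (hD : ∀ p, D (m.e.symm (.inl p)) = D' p) (hD' : ∀ p, D (m.e.symm (.inr p)) = D' p)
    (b k : V → ℝ) :
    m.hom hu (shiftedHam s adj D b k) =
      doubled (m.half s D' (fun p => b (m.e.symm (.inl p))) (fun p => k (m.e.symm (.inl p))))
        (m.half s D' (fun p => -b (m.e.symm (.inr p))) (fun p => -k (m.e.symm (.inr p))))
        (m.bond s (fun p => k (m.e.symm (.inl p)))) (m.bond s (fun p => -k (m.e.symm (.inr p)))) := by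
  classical
  have hL : ∀ (x : P) (M : Matrix κ κ ℂ), m.hom hu (oneSite (m.e.symm (.inl x)) M) =
    leftHom _ (oneSite x M) := m.hom_left hu
  have hR : ∀ (x : P) (k : ℝ) (a : Fin 3),
      m.hom hu (oneSite (m.e.symm (.inr x)) (shiftedSpin s k a)) =
        -rightHom _ (oneSite x (shiftedSpin s (-k) a)) := by
    intro x k a
    rw [m.hom_right hu x (conj_shiftedSpin hu hs k a), map_neg, map_neg]
  have hR' : ∀ (x : P) (D b k : ℝ),
      m.hom hu (oneSite (m.e.symm (.inr x)) (shiftedSite s D b k)) =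
        rightHom _ (oneSite x (shiftedSite s D (-b) (-k))) := by
    intro x D b k
    rw [m.hom_right hu x (conj_shiftedSite hu hs D b k)]
  have hcross : ∀ (f : P → P → Matrix ((P → κ) × (P → κ)) ((P → κ) × (P → κ)) ℂ),
      (∑ x, ∑ y, if adj (m.e.symm (.inl x)) (m.e.symm (.inr y)) then f x y else 0) =
        ∑ x, if adj (m.e.symm (.inl x)) (m.e.symm (.inr x)) then f x x else 0 := by
    intro f
    refine Finset.sum_congr rfl fun x _ => ?_
    rw [Finset.sum_eq_single x]
    · intro y _ hy
      rw [if_neg fun h => hy (m.cross x y h).symm]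
    · simp
  have hsymm : ∀ x y, adj (m.e.symm (.inr x)) (m.e.symm (.inl y)) ↔
      adj (m.e.symm (.inl y)) (m.e.symm (.inr x)) := fun x y => ⟨hadj _ _, hadj _ _⟩
  have hhom : ∀ (r : ℝ) (a : Matrix (V → κ) (V → κ) ℂ), m.hom hu (r • a) = r • m.hom hu a := by
    intro r a
    rw [← Complex.coe_smul, map_smul, Complex.coe_smul]
  have hite : ∀ (p : Prop) [Decidable p] (a : Matrix (V → κ) (V → κ) ℂ),
      m.hom hu (if p then a else 0) = if p then m.hom hu a else 0 := by
    intro p _ a; split_ifs <;> simp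
  rw [doubled_eq, shiftedHam, map_add, hhom]
  simp only [map_sum, hite, map_mul]
  simp only [m.sum_eq, hL, hR, hR', hD, hD']
  simp only [Finset.sum_add_distrib, ← m.adj_iff, hsymm, mul_neg, neg_mul,
    commute_leftHom_rightHom, neg_neg]
  rw [Finset.sum_comm (f := fun x y => if adj (m.e.symm (.inl y)) (m.e.symm (.inr x)) then _ else _),
    hcross, Mirror.half, Mirror.half, shiftedHam, shiftedHam, map_add, map_add, leftHom_smul,
    rightHom_smul, Fintype.sum_prod_type]
  have hiteL : ∀ (p : Prop) [Decidable p] (a : Matrix (P → κ) (P → κ) ℂ),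
      leftHom _ (if p then a else 0) = if p then leftHom _ a else 0 := by
    intro p _ a; split_ifs <;> simp
  have hiteR : ∀ (p : Prop) [Decidable p] (a : Matrix (P → κ) (P → κ) ℂ),
      rightHom _ (if p then a else 0) = if p then rightHom _ a else 0 := by
    intro p _ a; split_ifs <;> simp
  simp only [map_sum, map_mul, hiteL, hiteR, Mirror.bond]
  have hb : ∀ x, (∑ a, (if adj (m.e.symm (.inl x)) (m.e.symm (.inr x)) then
        leftHom (P → κ) (oneSite x (shiftedSpin s (k (m.e.symm (.inl x))) a)) else 0) *
      (if adj (m.e.symm (.inl x)) (m.e.symm (.inr x)) then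
        rightHom (P → κ) (oneSite x (shiftedSpin s (-k (m.e.symm (.inr x))) a)) else 0)) =
      -(if adj (m.e.symm (.inl x)) (m.e.symm (.inr x)) then
        ∑ a, -(leftHom (P → κ) (oneSite x (shiftedSpin s (k (m.e.symm (.inl x))) a)) *
        rightHom (P → κ) (oneSite x (shiftedSpin s (-k (m.e.symm (.inr x))) a))) else 0) := by
    intro x
    split_ifs <;> simp
  simp only [hb, Finset.sum_neg_distrib, sub_neg_eq_add]
  set X := ∑ x, (if adj (m.e.symm (.inl x)) (m.e.symm (.inr x)) then
        ∑ a, -(leftHom (P → κ) (oneSite x (shiftedSpin s (k (m.e.symm (.inl x))) a)) *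
        rightHom (P → κ) (oneSite x (shiftedSpin s (-k (m.e.symm (.inr x))) a))) else 0)
  module

/-- The field on the left half, reflected to the right half. -/
def Mirror.reflL {adj : V → V → Prop} (m : Mirror adj P) (k : V → ℝ) (x : V) : ℝ :=
  Sum.elim (fun p => k (m.e.symm (.inl p))) (fun p => -k (m.e.symm (.inl p))) (m.e x)

/-- The field on the right half, reflected to the left half. -/
def Mirror.reflR {adj : V → V → Prop} (m : Mirror adj P) (k : V → ℝ) (x : V) : ℝ :=
  Sum.elim (fun p => -k (m.e.symm (.inr p))) (fun p => k (m.e.symm (.inr p))) (m.e x)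

/-- The field b is odd under the reflection, so after the rotation both halves carry the same field,
and the two symmetric Hamiltonians are those of the reflected shifts. -/
theorem Mirror.formGe_shiftedHam {adj : V → V → Prop} (m : Mirror adj P)
    (hadj : ∀ x y, adj x y → adj y x) {u : Matrix κ κ ℂ}
    (hu : u * star u = 1) {s : Fin 3 → Matrix κ κ ℂ} (hsa : ∀ a, IsSelfAdjoint (s a))
    (hs : ∀ a, u * s a * star u = -(s a).map star) {D b : V → ℝ}
    (hD : ∀ p, D (m.e.symm (.inl p)) = D (m.e.symm (.inr p)))
    (hb : ∀ p, b (m.e.symm (.inr p)) = -b (m.e.symm (.inl p))) (k : V → ℝ) {e e' : ℝ}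
    (h : FormGe (shiftedHam s adj D b (m.reflL k)) e)
    (h' : FormGe (shiftedHam s adj D b (m.reflR k)) e') :
    FormGe (shiftedHam s adj D b k) ((e + e') / 2) := by
  rw [← m.formGe_hom_iff hu, m.hom_shiftedHam hadj hu hs hD (fun _ => rfl)] at h h' ⊢
  simp only [hb, neg_neg, Mirror.reflL, Mirror.reflR, Equiv.apply_symm_apply, Sum.elim_inl,
    Sum.elim_inr] at h h' ⊢
  refine FormGe.of_doubled ?_ ?_ h h' <;>
  exact shiftedHam_isHermitian hsa (fun x y h => hadj _ _ h) _ _ _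

open Classical in
/-- The number of bonds on which the field is perfectly staggered. -/
def staggeredBonds (adj : V → V → Prop) (k : V → ℝ) : ℕ :=
  ∑ x, ∑ y, if adj x y ∧ k x + k y = 0 then 1 else 0

/-- Reflecting either half makes all the crossing bonds staggered and doubles the count inside that
half. Hence the two reflected counts add up to twice the original count, plus a multiple of the
number of crossing bonds that are not staggered. -/
theorem Mirror.staggered_of_le {adj : V → V → Prop} (m : Mirror adj P)
    (hadj : ∀ x y, adj x y → adj y x) (k : V → ℝ)
    (h : staggeredBonds adj (m.reflL k) ≤ staggeredBonds adj k)
    (h' : staggeredBonds adj (m.reflR k) ≤ staggeredBonds adj k) {x y : P}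
    (hxy : adj (m.e.symm (.inl x)) (m.e.symm (.inr y))) :
    k (m.e.symm (.inl x)) + k (m.e.symm (.inr y)) = 0 := by
  classical
  have hsymm : ∀ x y, adj (m.e.symm (.inr x)) (m.e.symm (.inl y)) ↔
      adj (m.e.symm (.inl y)) (m.e.symm (.inr x)) := fun x y => ⟨hadj _ _, hadj _ _⟩
  simp only [staggeredBonds, m.sum_eq, Finset.sum_add_distrib, Mirror.reflL, Mirror.reflR,
    Equiv.apply_symm_apply, Sum.elim_inl, Sum.elim_inr, ← m.adj_iff, hsymm] at h h'
  rw [Finset.sum_comm (f := fun x y => if adj (m.e.symm (.inl y)) (m.e.symm (.inr x)) ∧ _ then _ else _),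
    Finset.sum_comm (f := fun x y => if adj (m.e.symm (.inl y)) (m.e.symm (.inr x)) ∧
      k (m.e.symm (.inr x)) + k (m.e.symm (.inl y)) = 0 then _ else _)] at h h'
  have e1 : ∀ a b : ℝ, -a + -b = 0 ↔ a + b = 0 := fun a b => by
    constructor <;> intro h <;> linarith
  have e2 : ∀ a b : ℝ, -a + b = 0 ↔ b + -a = 0 := fun a b => by rw [add_comm]
  have e3 : ∀ x y, (adj (m.e.symm (.inl x)) (m.e.symm (.inr y)) ∧
      k (m.e.symm (.inl x)) + -k (m.e.symm (.inl y)) = 0) ↔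
      adj (m.e.symm (.inl x)) (m.e.symm (.inr y)) := fun x y =>
    ⟨fun h => h.1, fun h => ⟨h, by rw [m.cross _ _ h]; simp⟩⟩
  have e4 : ∀ x y, (adj (m.e.symm (.inl x)) (m.e.symm (.inr y)) ∧
      k (m.e.symm (.inr y)) + -k (m.e.symm (.inr x)) = 0) ↔
      adj (m.e.symm (.inl x)) (m.e.symm (.inr y)) := fun x y =>
    ⟨fun h => h.1, fun h => ⟨h, by rw [m.cross _ _ h]; simp⟩⟩
  have e5 : ∀ x y, k (m.e.symm (.inr y)) + k (m.e.symm (.inl x)) = 0 ↔ 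
    k (m.e.symm (.inl x)) + k (m.e.symm (.inr y)) = 0 := fun x y => by rw [add_comm]
  simp only [e1, e2, e3, e4, e5] at h h'
  -- The sum of the two hypotheses, from which the counts inside the halves cancel.
  have hle : (∑ x, ∑ y, if adj (m.e.symm (.inl x)) (m.e.symm (.inr y)) then 1 else 0) ≤
      ∑ x, ∑ y, if adj (m.e.symm (.inl x)) (m.e.symm (.inr y)) ∧
        k (m.e.symm (.inl x)) + k (m.e.symm (.inr y)) = 0 then 1 else 0 := by omega
  by_contra hne
  have hmono : ∀ x y, (if adj (m.e.symm (.inl x)) (m.e.symm (.inr y)) ∧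
        k (m.e.symm (.inl x)) + k (m.e.symm (.inr y)) = 0 then 1 else 0) ≤
      if adj (m.e.symm (.inl x)) (m.e.symm (.inr y)) then 1 else 0 := by
    intro x y
    split_ifs with h1 h2 <;> first | exact (h2 h1.1).elim | simp
  refine absurd hle (not_le.2 (Finset.sum_lt_sum
    (fun x _ => Finset.sum_le_sum fun y _ => hmono x y)
    ⟨x, Finset.mem_univ _, Finset.sum_lt_sum (fun y _ => hmono x y) ⟨y, Finset.mem_univ _, ?_⟩⟩))
  simp [hxy, hne]

/-- Among the shifts of least energy one with the most staggered bonds is chosen. By reflection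
positivity its two reflections also have least energy, so neither has more staggered bonds, and
therefore no bond bisected by a mirror can fail to be staggered. -/
theorem exists_staggered_minimizer [Nonempty κ] {adj : V → V → Prop}
    (hadj : ∀ x y, adj x y → adj y x) {u : Matrix κ κ ℂ}
    (hu : u * star u = 1) {s : Fin 3 → Matrix κ κ ℂ} (hsa : ∀ a, IsSelfAdjoint (s a))
    (hs : ∀ a, u * s a * star u = -(s a).map star) {D b : V → ℝ}
    (hm : ∀ x y, adj x y → ∃ (P : Type) (_ : Fintype P) (_ : DecidableEq P) (m : Mirror adj P),
      (∃ p, m.e x = .inl p) ∧ (∃ q, m.e y = .inr q) ∧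
      (∀ p, D (m.e.symm (.inl p)) = D (m.e.symm (.inr p))) ∧
      (∀ p, b (m.e.symm (.inr p)) = -b (m.e.symm (.inl p)))) (k₀ : V → ℝ) :
    ∃ k : V → ℝ, (∀ x y, adj x y → k x + k y = 0) ∧
      groundEnergy (shiftedHam s adj D b k) ≤ groundEnergy (shiftedHam s adj D b k₀) := by
  -- Reflections only permute values and change signs, so shifts with values in ±k₀ form a finite
  -- set stable under them. This makes the minimum exist without compactness.
  set S : Set ℝ := Set.range k₀ ∪ Set.range fun x => -k₀ x with hS
  have hneg : ∀ r ∈ S, -r ∈ S := by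
    rintro _ (⟨x, rfl⟩ | ⟨x, rfl⟩)
    · exact Or.inr ⟨x, rfl⟩
    · exact Or.inl ⟨x, by simp⟩
  set F : Set (V → ℝ) := Set.univ.pi fun _ => S with hF
  have hFfin : F.Finite := Set.Finite.pi fun _ => (Set.finite_range _).union (Set.finite_range _)
  have hk₀ : k₀ ∈ F := fun x _ => Or.inl ⟨x, rfl⟩
  set E : (V → ℝ) → ℝ := fun k => groundEnergy (shiftedHam s adj D b k) with hE
  obtain ⟨k₁, hk₁, hmin⟩ := Set.exists_min_image F E hFfin ⟨k₀, hk₀⟩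
  obtain ⟨k, ⟨hkF, hkE⟩, hmax⟩ := Set.exists_max_image {k | k ∈ F ∧ E k ≤ E k₁}
    (staggeredBonds adj) (hFfin.subset fun k hk => hk.1) ⟨k₁, hk₁, le_rfl⟩
  refine ⟨k, fun x y hxy => ?_, hkE.trans (hmin k₀ hk₀)⟩
  obtain ⟨P, _, _, m, ⟨p, hp⟩, ⟨q, hq⟩, hmD, hmb⟩ := hm x y hxy
  have hLF : m.reflL k ∈ F := by
    intro x _
    rw [Mirror.reflL]
    rcases m.e x with p | p
    · exact hkF _ trivial
    · exact hneg _ (hkF _ trivial)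
  have hRF : m.reflR k ∈ F := by
    intro x _
    rw [Mirror.reflR]
    rcases m.e x with p | p
    · exact hneg _ (hkF _ trivial)
    · exact hkF _ trivial
  have hherm : ∀ k, (shiftedHam s adj D b k).IsHermitian :=
    fun k => shiftedHam_isHermitian hsa hadj D b k
  have hRP := m.formGe_shiftedHam hadj hu hsa hs hmD hmb k
    ((formGe_iff_le_groundEnergy (hherm _)).2 le_rfl) ((formGe_iff_le_groundEnergy (hherm _)).2 le_rfl)
  rw [formGe_iff_le_groundEnergy (hherm _)] at hRP
  change (E (m.reflL k) + E (m.reflR k)) / 2 ≤ E k at hRP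
  have h1 := hmin _ hLF
  have h2 := hmin _ hRF
  have hx : x = m.e.symm (.inl p) := by rw [← hp, Equiv.symm_apply_apply]
  have hy : y = m.e.symm (.inr q) := by rw [← hq, Equiv.symm_apply_apply]
  rw [hx, hy] at hxy ⊢
  exact m.staggered_of_le hadj k (hmax _ ⟨hLF, by linarith⟩) (hmax _ ⟨hRF, by linarith⟩) hxy

open Classical in
/-- The Heisenberg antiferromagnet in a field `b`. -/
def afHam (s : Fin 3 → Matrix κ κ ℂ) (adj : V → V → Prop) (b : V → ℝ) :
    Matrix (V → κ) (V → κ) ℂ :=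
  (1 / 2 : ℝ) • ∑ x, ∑ y, (if adj x y then ∑ a, oneSite x (s a) * oneSite y (s a) else 0) -
    ∑ x, b x • oneSite x (s 2)

-- Completing the square bond by bond: when D is the degree, the shift is a field coupled to the
-- first component plus a constant quadratic in k. Only the sums k_x + k_y over bonds occur, so a
-- staggered shift has no effect.
open Classical in
theorem shiftedHam_eq (s : Fin 3 → Matrix κ κ ℂ) {adj : V → V → Prop}
    (hadj : ∀ x y, adj x y → adj y x) (b k : V → ℝ) :
    shiftedHam s adj (fun x => ∑ y, if adj x y then 1 else 0) b k = afHam s adj b -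
      ∑ x, (∑ y, if adj x y then k x + k y else 0) • oneSite x (s 0) +
      (1 / 4 * ∑ x, ∑ y, if adj x y then (k x + k y) ^ 2 else 0) • 1 := by
  have h1 : ∀ (x : V) (c : ℝ) (M : Matrix κ κ ℂ), oneSite x (c • M) = c • oneSite x M := by
    intro x c M
    rw [← Complex.coe_smul, map_smul, Complex.coe_smul]
  have h2 : ∀ x y : V, (∑ a, oneSite x (shiftedSpin s (k x) a) * oneSite y (shiftedSpin s (k y) a)) =
      ∑ a, oneSite x (s a) * oneSite y (s a) - k y • oneSite x (s 0) - k x • oneSite y (s 0)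
        + (k x * k y) • 1 := by
    intro x y
    simp only [Fin.sum_univ_three, shiftedSpin, Complex.coe_smul, map_sub, h1, map_one]
    simp [sub_mul, mul_sub]
    module
  have h3 : ∀ x : V, oneSite x (shiftedSite s (∑ y, if adj x y then 1 else 0) (b x) (k x)) =
      ∑ y, (if adj x y then -(k x) • oneSite x (s 0) + (k x ^ 2 / 2) • 1 else 0)
        - b x • oneSite x (s 2) := by
    intro x
    have : ∀ y, (if adj x y then -(k x) • oneSite x (s 0) + (k x ^ 2 / 2) • 1 else 0) =
      (if adj x y then (1 : ℝ) else 0) • (-(k x) • oneSite x (s 0) + (k x ^ 2 / 2) • 1) := by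
      intro y; split_ifs <;> simp
    simp only [this, ← Finset.sum_smul]
    simp only [shiftedSite, map_sub, map_add, h1, map_one]
    module
  have h4 : ∑ x, ∑ y, (if adj x y then -(k x) • oneSite x (s 0) + (k x ^ 2 / 2) • 1 else 0) =
      (1 / 2 : ℝ) • ∑ x, ∑ y, (if adj x y then -(k x) • oneSite x (s 0) - k y • oneSite y (s 0) +
        ((k x ^ 2 + k y ^ 2) / 2) • (1 : Matrix (V → κ) (V → κ) ℂ) else 0) := by
    have hc : ∑ x, ∑ y, (if adj x y then -(k x) • oneSite x (s 0) +
          (k x ^ 2 / 2) • (1 : Matrix (V → κ) (V → κ) ℂ) else 0) =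
        ∑ x, ∑ y, (if adj x y then -(k y) • oneSite y (s 0) + (k y ^ 2 / 2) • 1 else 0) := by
      rw [Finset.sum_comm]
      refine Finset.sum_congr rfl fun x _ => Finset.sum_congr rfl fun y _ => ?_
      simp only [show adj y x ↔ adj x y from ⟨hadj _ _, hadj _ _⟩]
    have h5 : ∀ x y : V, (if adj x y then -(k x) • oneSite x (s 0) - k y • oneSite y (s 0) +
        ((k x ^ 2 + k y ^ 2) / 2) • (1 : Matrix (V → κ) (V → κ) ℂ) else 0) =
        (if adj x y then -(k x) • oneSite x (s 0) + (k x ^ 2 / 2) • 1 else 0) +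
        (if adj x y then -(k y) • oneSite y (s 0) + (k y ^ 2 / 2) • 1 else 0) := by
      intro x y
      split_ifs
      · module
      · simp
    simp only [h5, Finset.sum_add_distrib]
    rw [← hc]
    module
  have h6 : ∑ x, (∑ y, if adj x y then k x + k y else 0) • oneSite x (s 0) =
      (1 / 2 : ℝ) • ∑ x, ∑ y, (if adj x y then (k x + k y) • (oneSite x (s 0) + oneSite y (s 0))
        else (0 : Matrix (V → κ) (V → κ) ℂ)) := by
    have hc : ∑ x, ∑ y, (if adj x y then (k x + k y) • oneSite x (s 0) else 0) =
        ∑ x, ∑ y, (if adj x y then (k x + k y) • oneSite y (s 0) else 0) := by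
      rw [Finset.sum_comm]
      refine Finset.sum_congr rfl fun x _ => Finset.sum_congr rfl fun y _ => ?_
      simp only [show adj y x ↔ adj x y from ⟨hadj _ _, hadj _ _⟩, add_comm (k y)]
    have h7 : ∀ x y : V, (if adj x y then (k x + k y) • (oneSite x (s 0) + oneSite y (s 0))
        else (0 : Matrix (V → κ) (V → κ) ℂ)) = (if adj x y then (k x + k y) • oneSite x (s 0) else 0) +
         (if adj x y then (k x + k y) • oneSite y (s 0) else 0) := by
      intro x y
      split_ifs <;> simp
    simp only [h7, Finset.sum_add_distrib]
    rw [← hc]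
    simp only [Finset.sum_smul, ite_smul, zero_smul]
    module
  rw [shiftedHam, afHam, h6]
  simp only [h2, h3, Finset.sum_sub_distrib]
  rw [h4]
  have h8 : (1 / 4 * ∑ x, ∑ y, if adj x y then (k x + k y) ^ 2 else 0) •
      (1 : Matrix (V → κ) (V → κ) ℂ) =
      (1 / 2 : ℝ) • ∑ x, ∑ y, if adj x y then ((k x + k y) ^ 2 / 2) • 1 else 0 := by
    simp only [Finset.sum_smul, ite_smul, zero_smul, Finset.mul_sum, Finset.smul_sum, smul_ite,
      smul_smul, smul_zero, mul_ite, mul_zero]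
    refine Finset.sum_congr rfl fun x _ => Finset.sum_congr rfl fun y _ => ?_
    split_ifs
    · congr 1; ring
    · rfl
  rw [h8, add_sub, sub_add_eq_add_sub, sub_add_eq_add_sub, sub_right_comm _ (∑ x, b x • oneSite x (s 2)),
    sub_left_inj]
  rw [← smul_add, ← smul_add, ← smul_sub]
  congr 1
  simp only [← Finset.sum_add_distrib, ← Finset.sum_sub_distrib]
  refine Finset.sum_congr rfl fun x _ => Finset.sum_congr rfl fun y _ => ?_
  split_ifs
  · module
  · simp

open Classical in
/-- Gaussian domination: a field in the first direction lowers the ground state energy at most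
quadratically. -/
theorem groundEnergy_afHam_field [Nonempty κ] {adj : V → V → Prop}
    (hadj : ∀ x y, adj x y → adj y x) {u : Matrix κ κ ℂ}
    (hu : u * star u = 1) {s : Fin 3 → Matrix κ κ ℂ} (hsa : ∀ a, IsSelfAdjoint (s a))
    (hs : ∀ a, u * s a * star u = -(s a).map star) {b : V → ℝ}
    (hm : ∀ x y, adj x y → ∃ (P : Type) (_ : Fintype P) (_ : DecidableEq P) (m : Mirror adj P),
      (∃ p, m.e x = .inl p) ∧ (∃ q, m.e y = .inr q) ∧
      (∀ p, b (m.e.symm (.inr p)) = -b (m.e.symm (.inl p)))) (k : V → ℝ) :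
    (afHam s adj b - ∑ x, (∑ y, if adj x y then k x + k y else 0) • oneSite x (s 0) +
      (1 / 4 * ∑ x, ∑ y, if adj x y then (k x + k y) ^ 2 else 0) • 1 -
        (groundEnergy (afHam s adj b) : ℂ) • 1).PosSemidef := by
  obtain ⟨k', hk', hle⟩ := exists_staggered_minimizer hadj hu hsa hs
    (D := fun x => ∑ y, if adj x y then 1 else 0) (b := b) (by
      intro x y hxy
      obtain ⟨P, i1, i2, m, hx, hy, hb⟩ := hm x y hxy
      -- The degree is the same at mirror sites, since crossing bonds join mirror pairs only.
      refine ⟨P, i1, i2, m, hx, hy, fun p => ?_, hb⟩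
      simp only [m.sum_eq, m.adj_iff]
      rw [add_comm]
      congr 1
      refine Finset.sum_congr rfl fun q _ => ?_
      have : adj (m.e.symm (.inl p)) (m.e.symm (.inr q)) ↔
          adj (m.e.symm (.inr p)) (m.e.symm (.inl q)) := by
        constructor
        · intro h
          have := m.cross _ _ h
          subst this
          exact hadj _ _ h
        · intro h
          have h' := hadj _ _ h
          have := m.cross _ _ h'
          subst this
          exact h'
      simp only [this]) k
  -- The minimizing shift is staggered on every bond, so its energy is that of the unshifted
  -- Hamiltonian.
  have h1 : shiftedHam s adj (fun x => ∑ y, if adj x y then 1 else 0) b k' = afHam s adj b := by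
    rw [shiftedHam_eq s hadj]
    have e1 : ∀ x y : V, (if adj x y then k' x + k' y else 0) = 0 := fun x y => by
      split_ifs with h
      · exact hk' x y h
      · rfl
    have e2 : ∀ x y : V, (if adj x y then (k' x + k' y) ^ 2 else 0) = 0 := fun x y => by
      split_ifs with h
      · rw [hk' x y h]; simp
      · rfl
    simp only [e1, e2]
    simp
  rw [h1] at hle
  rw [← shiftedHam_eq s hadj]
  have h2 := posSemidef_sub_groundEnergy (shiftedHam_isHermitian hsa hadj
    (fun x => ∑ y, if adj x y then 1 else 0) b k)
  set H := shiftedHam s adj (fun x => ∑ y, if adj x y then 1 else 0) b k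
  have h3 : H - (groundEnergy (afHam s adj b) : ℂ) • 1 = (H - (groundEnergy H : ℂ) • 1) +
      ((groundEnergy H - groundEnergy (afHam s adj b) : ℝ) : ℂ) • 1 := by
    push_cast
    module
  rw [h3]
  refine h2.add (Matrix.PosSemidef.one.smul ?_)
  exact_mod_cast sub_nonneg.2 hle

end GaussianDomination

/-! ### Spin matrices -/

section Spin

variable (n : ℕ)

theorem spinRaise_apply (j k : Fin (n + 1)) : spinRaise n j k =
    if (j : ℕ) + 1 = k then ((√((k : ℝ) * ((n : ℝ) - k + 1)) : ℝ) : ℂ) else 0 := rfl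

theorem spin3_mul_spinRaise : spin3 n * spinRaise n - spinRaise n * spin3 n = spinRaise n := by
  ext j k
  rw [Matrix.sub_apply, spin3, Matrix.diagonal_mul, Matrix.mul_diagonal, spinRaise_apply]
  split_ifs with h
  · rw [← h]; push_cast; ring
  · simp

theorem sq_sqrt_spin (k : ℕ) (hk : k ≤ n + 1) :
    ((√((k : ℝ) * ((n : ℝ) - k + 1)) : ℝ) : ℂ) * ((√((k : ℝ) * ((n : ℝ) - k + 1)) : ℝ) : ℂ) =
      (k : ℂ) * ((n : ℂ) - k + 1) := by
  rw [← Complex.ofReal_mul, Real.mul_self_sqrt]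
  · push_cast; ring
  · have : (k : ℝ) ≤ n + 1 := by exact_mod_cast hk
    have h2 : (0 : ℝ) ≤ k := by positivity
    nlinarith

theorem spinRaise_mul_lower (j k : Fin (n + 1)) : (spinRaise n * (spinRaise n)ᴴ) j k =
    if j = k then ((j : ℕ) + 1 : ℂ) * ((n : ℂ) - (j : ℕ)) else 0 := by
  simp only [Matrix.mul_apply, Matrix.conjTranspose_apply, spinRaise_apply]
  by_cases hj : (j : ℕ) + 1 < n + 1
  · rw [Finset.sum_eq_single (⟨(j : ℕ) + 1, hj⟩ : Fin (n + 1))]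
    · by_cases h : j = k
      · subst h
        simp only [if_true, RCLike.star_def, Complex.conj_ofReal]
        rw [sq_sqrt_spin n _ hj.le]
        push_cast; ring
      · rw [if_neg h, if_neg (fun h' => h (Fin.ext (by simp at h'; omega))) (c := (k : ℕ) + 1 = _)]
        simp
    · intro l _ hl
      rw [if_neg fun h => hl (Fin.ext h.symm)]
      simp
    · simp
  -- At the edge of the spin multiplet no intermediate state exists, and the factor n - j on the
  -- right side vanishes as well.
  · have hjn : (j : ℕ) = n := by omega
    rw [Finset.sum_eq_zero]
    · simp [hjn]
    · intro l _
      rw [if_neg (by omega)]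
      simp

theorem spinLower_mul_raise (j k : Fin (n + 1)) : ((spinRaise n)ᴴ * spinRaise n) j k =
    if j = k then ((j : ℕ) : ℂ) * ((n : ℂ) - (j : ℕ) + 1) else 0 := by
  simp only [Matrix.mul_apply, Matrix.conjTranspose_apply, spinRaise_apply]
  by_cases hj : 0 < (j : ℕ)
  · rw [Finset.sum_eq_single (⟨(j : ℕ) - 1, by omega⟩ : Fin (n + 1))]
    · rw [if_pos (by simp; omega)]
      by_cases h : j = k
      · subst h
        rw [if_pos (by simp; omega), if_pos rfl]
        simp only [RCLike.star_def, Complex.conj_ofReal]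
        rw [sq_sqrt_spin n _ (by omega)]
      · rw [if_neg h, if_neg (fun h' => h (Fin.ext (by simp at h'; omega)))]
        simp
    · intro l _ hl
      rw [if_neg fun h => hl (Fin.ext (by simp; omega))]
      simp
    · simp
  · have hj0 : (j : ℕ) = 0 := by omega
    rw [Finset.sum_eq_zero]
    · simp [hj0]
    · intro l _
      rw [if_neg (by omega)]
      simp

theorem spinRaise_comm_lower :
    spinRaise n * (spinRaise n)ᴴ - (spinRaise n)ᴴ * spinRaise n = (2 : ℂ) • spin3 n := by
  ext j k
  rw [Matrix.sub_apply, spinRaise_mul_lower, spinLower_mul_raise, spin3, Matrix.smul_apply,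
    Matrix.diagonal_apply]
  split_ifs with h
  · simp; ring
  · simp

theorem spin3_star : star (spin3 n) = spin3 n := by
  rw [spin3, Matrix.star_eq_conjTranspose, Matrix.diagonal_conjTranspose]
  congr 1
  ext k
  simp

theorem spin1_star : star (spin1 n) = spin1 n := by
  rw [spin1, star_smul, star_add, Matrix.star_eq_conjTranspose, Matrix.star_eq_conjTranspose,
    Matrix.conjTranspose_conjTranspose, add_comm (spinRaise n)ᴴ]
  simp

theorem spin2_star : star (spin2 n) = spin2 n := by
  rw [spin2, star_smul, star_sub, Matrix.star_eq_conjTranspose, Matrix.star_eq_conjTranspose,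
    Matrix.conjTranspose_conjTranspose, ← neg_sub (spinRaise n), smul_neg, ← neg_smul]
  congr 1
  simp

theorem spin3_mul_lower :
    spin3 n * (spinRaise n)ᴴ - (spinRaise n)ᴴ * spin3 n = -(spinRaise n)ᴴ := by
  have h := congrArg star (spin3_mul_spinRaise n)
  rw [star_sub, star_mul, star_mul, spin3_star, Matrix.star_eq_conjTranspose] at h
  rw [← neg_sub, h]

theorem spin_comm12 : spin1 n * spin2 n - spin2 n * spin1 n = Complex.I • spin3 n := by
  have h := spinRaise_comm_lower n
  set r := spinRaise n
  set l := (spinRaise n)ᴴ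
  have : spin1 n * spin2 n - spin2 n * spin1 n = (-(1 / (2 * Complex.I))) • (r * l - l * r) := by
    simp only [spin1, spin2, smul_mul_assoc, mul_smul_comm, add_mul, mul_add, sub_mul, mul_sub]
    module
  rw [this, h, smul_smul]
  congr 1
  field_simp
  simp

theorem spin_comm31 : spin3 n * spin1 n - spin1 n * spin3 n = Complex.I • spin2 n := by
  have h := spin3_mul_spinRaise n
  have h' := spin3_mul_lower n
  set r := spinRaise n
  set l := (spinRaise n)ᴴ
  have : spin3 n * spin1 n - spin1 n * spin3 n =
      (1 / 2 : ℂ) • ((spin3 n * r - r * spin3 n) + (spin3 n * l - l * spin3 n)) := by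
    simp only [spin1, smul_mul_assoc, mul_smul_comm, add_mul, mul_add]
    module
  rw [this, h, h', spin2, smul_smul, ← sub_eq_add_neg]
  congr 1
  field_simp

/-- The spin vector. -/
def spinVec (a : Fin 3) : Matrix (Fin (n + 1)) (Fin (n + 1)) ℂ := ![spin1 n, spin2 n, spin3 n] a

theorem spinVec_isSelfAdjoint (a : Fin 3) : IsSelfAdjoint (spinVec n a) := by
  fin_cases a
  · exact spin1_star n
  · exact spin2_star n
  · exact spin3_star n

/-- The rotation by `π` about the second axis. -/
def rotation : Matrix (Fin (n + 1)) (Fin (n + 1)) ℂ :=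
  Matrix.of fun j k => if j = k.rev then (-1) ^ (k : ℕ) else 0

theorem rotation_conj (M : Matrix (Fin (n + 1)) (Fin (n + 1)) ℂ) (j k : Fin (n + 1)) :
    (rotation n * M * star (rotation n)) j k =
      (-1) ^ (j.rev : ℕ) * M j.rev k.rev * (-1) ^ (k.rev : ℕ) := by
  rw [Matrix.mul_apply, Finset.sum_eq_single k.rev, Matrix.mul_apply, Finset.sum_eq_single j.rev]
  · simp [rotation, Matrix.star_apply]
  · intro l _ hl
    have : j ≠ l.rev := fun h => hl (by rw [h, Fin.rev_rev])
    simp [rotation, this]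
  · simp
  · intro l _ hl
    have : k ≠ l.rev := fun h => hl (by rw [h, Fin.rev_rev])
    simp [rotation, Matrix.star_apply, this]
  · simp

theorem rotation_mul_star : rotation n * star (rotation n) = 1 := by
  have : rotation n * star (rotation n) = rotation n * 1 * star (rotation n) := by rw [mul_one]
  rw [this]
  ext j k
  rw [rotation_conj, Matrix.one_apply, Matrix.one_apply]
  by_cases h : j = k
  · subst h
    simp [← pow_add, ← two_mul]
  · rw [if_neg h, if_neg fun h' => h (Fin.rev_injective h')]; simp

theorem spinRaise_rev (j k : Fin (n + 1)) : spinRaise n j.rev k.rev = spinRaise n k j := by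
  rw [spinRaise_apply, spinRaise_apply]
  have hj := j.is_lt
  have hk := k.is_lt
  by_cases h : (k : ℕ) + 1 = j
  · rw [if_pos h, if_pos (by simp only [Fin.val_rev]; omega)]
    congr 2
    rw [Fin.val_rev, Nat.cast_sub (by omega), ← h]
    push_cast
    ring
  · rw [if_neg h, if_neg (by simp only [Fin.val_rev]; omega)]

theorem star_spinRaise_apply (j k : Fin (n + 1)) : star (spinRaise n j k) = spinRaise n j k := by
  rw [spinRaise_apply]; split_ifs <;> simp

theorem spinRaise_sign (j k : Fin (n + 1)) :
    (-1 : ℂ) ^ (j.rev : ℕ) * spinRaise n k j * (-1) ^ (k.rev : ℕ) = -spinRaise n k j := by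
  have hj := j.is_lt
  have hk := k.is_lt
  rw [spinRaise_apply]
  split_ifs with h
  · have : (k.rev : ℕ) = (j.rev : ℕ) + 1 := by simp only [Fin.val_rev]; omega
    rw [this, mul_right_comm, ← pow_add, ← add_assoc, pow_succ, ← two_mul, pow_mul]
    simp
  · simp

/-- The first and third components are real and reversed by the rotation; the second is imaginary
and fixed by it. So all three go to minus their conjugates. -/
theorem rotation_spin (a : Fin 3) :
    rotation n * spinVec n a * star (rotation n) = -(spinVec n a).map star := by
  ext j k
  rw [rotation_conj]
  have hs := spinRaise_sign n j k
  have hs' := spinRaise_sign n k j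
  rw [mul_right_comm] at hs hs'
  rw [mul_right_comm]
  rw [mul_comm ((-1 : ℂ) ^ (k.rev : ℕ))] at hs'
  set c : ℂ := (-1) ^ (j.rev : ℕ) * (-1) ^ (k.rev : ℕ) with hc
  fin_cases a
  · simp only [spinVec, spin1, Matrix.neg_apply, Matrix.map_apply]
    simp [spinRaise_rev, Matrix.conjTranspose_apply, star_spinRaise_apply]
    linear_combination (1 / 2 : ℂ) * hs + (1 / 2 : ℂ) * hs'
  · simp only [spinVec, spin2, Matrix.neg_apply, Matrix.map_apply]
    simp [spinRaise_rev, Matrix.conjTranspose_apply, star_spinRaise_apply]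
    linear_combination (Complex.I / 2 : ℂ) * hs - (Complex.I / 2 : ℂ) * hs'
  · simp only [spinVec, spin3, Matrix.neg_apply, Matrix.map_apply]
    by_cases h : j = k
    · subst h
      have hj := j.is_lt
      have h1 : c = 1 := by rw [hc, ← pow_add, ← two_mul, pow_mul]; simp
      simp [h1, Fin.val_rev, Nat.cast_sub (show (j : ℕ) ≤ n by omega)]
      ring
    · simp [h, Fin.rev_injective.ne h]

/-- Reversal of the third spin component. -/
theorem spin1_rev (j k : Fin (n + 1)) : spin1 n j.rev k.rev = spin1 n j k := by
  simp [spin1, spinRaise_rev, Matrix.conjTranspose_apply, star_spinRaise_apply,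
    add_comm]

theorem spin2_rev (j k : Fin (n + 1)) : spin2 n j.rev k.rev = -spin2 n j k := by
  simp [spin2, spinRaise_rev, Matrix.conjTranspose_apply, star_spinRaise_apply]
  ring

theorem spin3_rev (j k : Fin (n + 1)) : spin3 n j.rev k.rev = -spin3 n j k := by
  by_cases h : j = k
  · subst h
    have hj := j.is_lt
    simp [spin3, Fin.val_rev, Nat.cast_sub (show (j : ℕ) ≤ n by omega)]
    ring
  · simp [spin3, h, Fin.rev_injective.ne h]

end Spin

/-! ### Geometry of the periodic box -/

section Involution

variable {V : Type*} [Fintype V] [DecidableEq V]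

open Classical in
/-- The mirror decomposition given by an involution which exchanges a set with its complement. -/
def Mirror.ofInvolution {adj : V → V → Prop} (θ : V → V) (p : V → Prop)
    (hθ : ∀ x, θ (θ x) = x) (hp : ∀ x, p (θ x) ↔ ¬ p x) (hadj : ∀ x y, adj (θ x) (θ y) ↔ adj x y)
    (hcross : ∀ x y, p x → ¬ p y → adj x y → y = θ x) : Mirror adj {x // p x} where
  e :=
    { toFun := fun x => if h : p x then .inl ⟨x, h⟩ else .inr ⟨θ x, (hp x).2 h⟩
      invFun := Sum.elim (fun x => x.1) (fun x => θ x.1)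
      left_inv := by
        intro x
        by_cases h : p x <;> simp [h, hθ]
      right_inv := by
        rintro (⟨x, h⟩ | ⟨x, h⟩)
        · simp [h]
        · have : ¬ p (θ x) := fun h' => (hp x).1 h' h
          simp [this, hθ] }
  adj_iff x y := (hadj _ _).symm
  cross := by
    rintro ⟨x, hx⟩ ⟨y, hy⟩ h
    have := hcross x (θ y) hx (fun h' => (hp y).1 h' hy) h
    have := congrArg θ this
    rw [hθ, hθ] at this
    exact Subtype.ext this.symm

theorem Mirror.ofInvolution_symm_inl {adj : V → V → Prop} (θ : V → V) (p : V → Prop)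
    (hθ : ∀ x, θ (θ x) = x) (hp : ∀ x, p (θ x) ↔ ¬ p x) (hadj : ∀ x y, adj (θ x) (θ y) ↔ adj x y)
    (hcross : ∀ x y, p x → ¬ p y → adj x y → y = θ x) (x : {x // p x}) :
    (Mirror.ofInvolution θ p hθ hp hadj hcross).e.symm (.inl x) = x := rfl

theorem Mirror.ofInvolution_symm_inr {adj : V → V → Prop} (θ : V → V) (p : V → Prop)
    (hθ : ∀ x, θ (θ x) = x) (hp : ∀ x, p (θ x) ↔ ¬ p x) (hadj : ∀ x y, adj (θ x) (θ y) ↔ adj x y)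
    (hcross : ∀ x y, p x → ¬ p y → adj x y → y = θ x) (x : {x // p x}) :
    (Mirror.ofInvolution θ p hθ hp hadj hcross).e.symm (.inr x) = θ x := rfl

end Involution

section Box

variable {d : ℕ} {L : ℕ}

theorem mem_box_iff {x : Site d} : x ∈ box d L ↔ ∀ i, -(L : ℤ) + 1 ≤ x i ∧ x i ≤ L := by
  simp [box]

theorem PeriodicAdj.symm {x y : Site d} (h : PeriodicAdj L x y) : PeriodicAdj L y x := by
  obtain ⟨i, h1, h2⟩ := h
  refine ⟨i, fun j hj => (h1 j hj).symm, ?_⟩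
  rcases h2 with h2 | h2
  · right
    have := (dvd_neg).2 h2
    rwa [show -(x i - y i - 1) = y i - x i + 1 by ring] at this
  · left
    have := (dvd_neg).2 h2
    rwa [show -(x i - y i + 1) = y i - x i - 1 by ring] at this

/-- The discrete torus. -/
abbrev Torus (d L : ℕ) : Type := Fin d → ZMod (2 * L)

/-- The periodic box is a discrete torus. -/
def boxEquiv (d L : ℕ) (hL : 0 < L) : box d L ≃ Torus d L where
  toFun x i := ((x : Site d) i : ZMod (2 * L))
  invFun z := ⟨fun i => (z i).valMinAbs, mem_box_iff.2 fun i => by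
    have : NeZero (2 * L) := ⟨by omega⟩
    have := ZMod.valMinAbs_mem_Ioc (z i)
    rw [Set.mem_Ioc] at this
    push_cast at this
    omega⟩
  left_inv := by
    rintro ⟨x, hx⟩
    have : NeZero (2 * L) := ⟨by omega⟩
    ext i
    have := (mem_box_iff.1 hx) i
    refine (ZMod.valMinAbs_spec _ _).2 ⟨rfl, ?_⟩
    rw [Set.mem_Ioc]
    push_cast
    omega
  right_inv := by
    intro z
    ext i
    simp

/-- Nearest neighbours in the torus. -/
def TorusAdj (x y : Torus d L) : Prop :=
  ∃ i, (∀ j, j ≠ i → x j = y j) ∧ (y i = x i + 1 ∨ x i = y i + 1)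

theorem boxEquiv_apply (hL : 0 < L) (x : box d L) (i : Fin d) :
    boxEquiv d L hL x i = ((x : Site d) i : ZMod (2 * L)) := rfl

theorem periodicAdj_iff (hL : 0 < L) (x y : box d L) :
    PeriodicAdj L (x : Site d) y ↔ TorusAdj (boxEquiv d L hL x) (boxEquiv d L hL y) := by
  refine exists_congr fun i => and_congr ?_ ?_
  · refine forall_congr' fun j => imp_congr_right fun _ => ?_
    constructor
    · intro h; rw [boxEquiv_apply, boxEquiv_apply, h]
    · intro h
      have h1 := (mem_box_iff.1 x.2) j
      have h2 := (mem_box_iff.1 y.2) j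
      rw [boxEquiv_apply, boxEquiv_apply, ZMod.intCast_eq_intCast_iff_dvd_sub] at h
      obtain ⟨c, hc⟩ := h
      push_cast at hc
      have : c = 0 := by
        by_contra hne
        rcases lt_or_gt_of_ne hne with h | h
        · nlinarith
        · nlinarith
      subst this
      omega
  · rw [or_comm]
    have e1 : ∀ a : ℤ, ((2 * L : ℤ) ∣ a) ↔ ((a : ℤ) : ZMod (2 * L)) = 0 := by
      intro a
      rw [ZMod.intCast_zmod_eq_zero_iff_dvd]
      push_cast
      rfl
    rw [e1, e1, boxEquiv_apply, boxEquiv_apply]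
    push_cast
    refine or_congr ?_ ?_
    · constructor <;> intro h <;> linear_combination -h
    · constructor <;> intro h <;> linear_combination h

/-- The parity of a site. -/
def parity (x : Torus d L) : ZMod 2 := ∑ i, ZMod.castHom (dvd_mul_right 2 L) (ZMod 2) (x i)

/-- The sign attached to a parity. -/
def paritySign (a : ZMod 2) : ℝ := if a = 0 then 1 else -1

theorem paritySign_add_one (a : ZMod 2) : paritySign (a + 1) = -paritySign a := by
  have h : ∀ a : ZMod 2, a + 1 = 0 ↔ ¬ a = 0 := by decide
  by_cases h0 : a = 0 <;> simp [paritySign, h, h0]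

/-- The staggered sign of a site. -/
def stagger (x : Site d) : ℝ := (-1) ^ (∑ i, x i)

/-- The period 2L is even, so the parity of a coordinate is well defined on the torus and the
staggered sign agrees with the periodic boundary conditions. -/
theorem stagger_eq (hL : 0 < L) (x : box d L) :
    stagger (x : Site d) = paritySign (parity (boxEquiv d L hL x)) := by
  have h : parity (boxEquiv d L hL x) = ((∑ i, (x : Site d) i : ℤ) : ZMod 2) := by
    simp [parity, boxEquiv_apply]
  rw [h, paritySign, stagger]
  have h2 : (((∑ i, (x : Site d) i : ℤ) : ZMod 2) = 0) ↔ Even (∑ i, (x : Site d) i) := by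
    rw [ZMod.intCast_zmod_eq_zero_iff_dvd]
    exact even_iff_two_dvd.symm
  split_ifs with h3
  · exact (h2.1 h3).neg_one_zpow
  · exact (Int.not_even_iff_odd.1 fun h4 => h3 (h2.2 h4)).neg_one_zpow

/-- The reflection of the torus in the plane between `a` and `a - 1`, in the direction `i`. -/
def torusRefl (i : Fin d) (a : ZMod (2 * L)) (z : Torus d L) : Torus d L :=
  Function.update z i (2 * a - 1 - z i)

theorem torusRefl_same (i : Fin d) (a : ZMod (2 * L)) (z : Torus d L) :
    torusRefl i a z i = 2 * a - 1 - z i := by simp [torusRefl]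

theorem torusRefl_of_ne {i j : Fin d} (h : j ≠ i) (a : ZMod (2 * L)) (z : Torus d L) :
    torusRefl i a z j = z j := by simp [torusRefl, h]

theorem torusRefl_torusRefl (i : Fin d) (a : ZMod (2 * L)) (z : Torus d L) :
    torusRefl i a (torusRefl i a z) = z := by
  ext j
  by_cases h : j = i
  · subst h; rw [torusRefl_same, torusRefl_same]; ring
  · rw [torusRefl_of_ne h, torusRefl_of_ne h]

/-- The plane lies between sites, so z ↦ 2a - 1 - z exchanges the sublattices. Hence the staggered
field is odd under these reflections. -/
theorem parity_torusRefl (i : Fin d) (a : ZMod (2 * L)) (z : Torus d L) :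
    parity (torusRefl i a z) = parity z + 1 := by
  rw [parity, parity, ← Finset.add_sum_erase _ _ (Finset.mem_univ i),
    ← Finset.add_sum_erase _ _ (Finset.mem_univ i), torusRefl_same]
  have h : ∀ j ∈ Finset.univ.erase i, ZMod.castHom (dvd_mul_right 2 L) (ZMod 2) (torusRefl i a z j) =
      ZMod.castHom (dvd_mul_right 2 L) (ZMod 2) (z j) := fun j hj => by
    rw [torusRefl_of_ne (Finset.ne_of_mem_erase hj)]
  rw [Finset.sum_congr rfl h, map_sub, map_sub, map_mul, map_one, map_ofNat]
  have h2 : ∀ b c e : ZMod 2, 2 * b - 1 - c + e = c + e + 1 := by decide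
  exact h2 _ _ _

theorem torusAdj_torusRefl {i : Fin d} {a : ZMod (2 * L)} {x y : Torus d L} (h : TorusAdj x y) :
    TorusAdj (torusRefl i a x) (torusRefl i a y) := by
  obtain ⟨j, h1, h2⟩ := h
  refine ⟨j, fun k hk => ?_, ?_⟩
  · by_cases hki : k = i
    · subst hki
      rw [torusRefl_same, torusRefl_same, h1 _ hk]
    · rw [torusRefl_of_ne hki, torusRefl_of_ne hki, h1 _ hk]
  · by_cases hji : j = i
    · subst hji
      rw [torusRefl_same, torusRefl_same]
      rcases h2 with h2 | h2
      · right; rw [h2]; ring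
      · left; rw [h2]; ring
    · rw [torusRefl_of_ne hji, torusRefl_of_ne hji]
      exact h2

/-- The half of the torus which begins at `a` in the direction `i`. -/
def torusHalf (i : Fin d) (a : ZMod (2 * L)) (z : Torus d L) : Prop := (z i - a).val < L

/-- The offset w from a, taken in 0, …, 2L - 1, is sent to 2L - 1 - w. -/
theorem torusHalf_torusRefl (hL : 0 < L) (i : Fin d) (a : ZMod (2 * L)) (z : Torus d L) :
    torusHalf i a (torusRefl i a z) ↔ ¬ torusHalf i a z := by
  have : NeZero (2 * L) := ⟨by omega⟩
  rw [torusHalf, torusHalf, torusRefl_same]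
  set w := z i - a with hw
  have hlt := w.val_lt
  have h : 2 * a - 1 - z i - a = ((2 * L - 1 - w.val : ℕ) : ZMod (2 * L)) := by
    rw [Nat.cast_sub (by omega), Nat.cast_sub (by omega), ZMod.natCast_self, ZMod.natCast_val,
      ZMod.cast_id', id, hw]
    push_cast
    ring
  rw [h, ZMod.val_natCast_of_lt (by omega)]
  omega

/-- A bond leaves the half only between the offsets L - 1 and L, or between 0 and -1. Both pairs are
mirror images, because a reflection of the torus has two planes. -/
theorem torusRefl_of_cross (hL : 0 < L) {i : Fin d} {a : ZMod (2 * L)} {x y : Torus d L}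
    (hx : torusHalf i a x) (hy : ¬ torusHalf i a y) (h : TorusAdj x y) : y = torusRefl i a x := by
  have : NeZero (2 * L) := ⟨by omega⟩
  have : Fact (1 < 2 * L) := ⟨by omega⟩
  obtain ⟨j, h1, h2⟩ := h
  have hji : j = i := by
    by_contra hne
    have := h1 i fun h => hne h.symm
    rw [torusHalf] at hx hy
    rw [this] at hx
    exact hy hx
  subst hji
  ext k
  by_cases hk : k = j
  · subst hk
    rw [torusRefl_same]
    rw [torusHalf] at hx hy
    set w := x k - a with hw
    have hwc : w = (w.val : ZMod (2 * L)) := by rw [ZMod.natCast_val, ZMod.cast_id', id]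
    rcases h2 with h2 | h2
    · have h3 : y k - a = ((w.val + 1 : ℕ) : ZMod (2 * L)) := by
        rw [Nat.cast_add, ← hwc, h2, hw]; push_cast; ring
      rw [h3, ZMod.val_natCast_of_lt (by omega)] at hy
      have h4 : w.val + 1 = L := by omega
      have h5 : 2 * (w + 1) = 0 := by
        have : 2 * (w + 1) = ((2 * (w.val + 1) : ℕ) : ZMod (2 * L)) := by
          push_cast; rw [← hwc]
        rw [this, h4, ZMod.natCast_self]
      rw [h2]
      linear_combination h5
    · have h6 : w = 0 := by
        by_contra hne
        have h0 : 0 < w.val := Nat.pos_of_ne_zero fun h => hne ((ZMod.val_eq_zero w).1 h)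
        have h3 : y k - a = ((w.val - 1 : ℕ) : ZMod (2 * L)) := by
          rw [Nat.cast_sub (by omega), ← hwc, hw, h2]; push_cast; ring
        rw [h3, ZMod.val_natCast_of_lt (by omega)] at hy
        omega
      linear_combination 2 * h6 - h2
  · rw [torusRefl_of_ne hk, h1 k hk]

theorem TorusAdj.symm {x y : Torus d L} (h : TorusAdj x y) : TorusAdj y x := by
  obtain ⟨i, h1, h2⟩ := h
  exact ⟨i, fun j hj => (h1 j hj).symm, h2.symm⟩

/-- Every bond of the torus is bisected by a mirror plane. -/
theorem exists_mirror (hL : 0 < L) (B : ℝ) (x y : box d L) (hxy : PeriodicAdj L (x : Site d) y) :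
    ∃ (P : Type) (_ : Fintype P) (_ : DecidableEq P)
      (m : Mirror (fun x y : box d L => PeriodicAdj L (x : Site d) y) P),
      (∃ p, m.e x = .inl p) ∧ (∃ q, m.e y = .inr q) ∧
      (∀ p, B * stagger (m.e.symm (.inr p) : Site d) =
        -(B * stagger (m.e.symm (.inl p) : Site d))) := by
  classical
  have : NeZero (2 * L) := ⟨by omega⟩
  set f := boxEquiv d L hL with hf
  have hsub : ∀ (i : Fin d) (a : ZMod (2 * L)) (p : box d L → Prop)
      (hp : ∀ z, p (f.symm (torusRefl i a (f z))) ↔ ¬ p z)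
      (hc : ∀ z z', p z → ¬ p z' → PeriodicAdj L (z : Site d) z' →
        z' = f.symm (torusRefl i a (f z))) (_ : p x) (_ : ¬ p y),
      ∃ (P : Type) (_ : Fintype P) (_ : DecidableEq P)
      (m : Mirror (fun x y : box d L => PeriodicAdj L (x : Site d) y) P),
      (∃ p, m.e x = .inl p) ∧ (∃ q, m.e y = .inr q) ∧
      (∀ p, B * stagger (m.e.symm (.inr p) : Site d) =
        -(B * stagger (m.e.symm (.inl p) : Site d))) := by
    intro i a p hp hc hx hy
    refine ⟨{z // p z}, inferInstance, inferInstance,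
      Mirror.ofInvolution (fun z => f.symm (torusRefl i a (f z))) p ?_ hp ?_ hc,
      ⟨⟨x, hx⟩, ?_⟩, ⟨⟨f.symm (torusRefl i a (f y)), (hp y).2 hy⟩, ?_⟩, ?_⟩
    · intro z; simp [torusRefl_torusRefl]
    · intro z z'
      rw [periodicAdj_iff hL, periodicAdj_iff hL, ← hf, Equiv.apply_symm_apply,
        Equiv.apply_symm_apply]
      refine ⟨fun h => ?_, torusAdj_torusRefl⟩
      have := torusAdj_torusRefl (i := i) (a := a) h
      rwa [torusRefl_torusRefl, torusRefl_torusRefl] at this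
    · simp [Mirror.ofInvolution, hx]
    · simp [Mirror.ofInvolution, hy]
    · intro q
      rw [Mirror.ofInvolution_symm_inl, Mirror.ofInvolution_symm_inr, stagger_eq hL, stagger_eq hL,
        ← hf, Equiv.apply_symm_apply, parity_torusRefl, paritySign_add_one]
      ring
  have hflip : ∀ i a z, torusHalf i a (f (f.symm (torusRefl i a (f z)))) ↔ ¬ torusHalf i a (f z) := by
    intro i a z
    rw [Equiv.apply_symm_apply, torusHalf_torusRefl hL]
  obtain ⟨i, h1, h2⟩ := (periodicAdj_iff hL x y).1 hxy
  rcases h2 with h2 | h2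
  -- The half is taken to begin at whichever of x and y comes second in the direction i; in this
  -- case that is y, so x belongs to the complementary half, which plays the role of the left one.
  · refine hsub i (f y i) (fun z => ¬ torusHalf i (f y i) (f z)) (fun z => not_congr (hflip _ _ z))
      (fun z z' hz hz' h => ?_) ?_ ?_
    · rw [not_not] at hz'
      have := torusRefl_of_cross hL hz' hz ((periodicAdj_iff hL _ _).1 h).symm
      rw [this, torusRefl_torusRefl, Equiv.symm_apply_apply]
    · have : f x i - f y i = ((2 * L - 1 : ℕ) : ZMod (2 * L)) := by
        rw [h2, Nat.cast_sub (by omega), ZMod.natCast_self]; push_cast; ring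
      rw [torusHalf, this, ZMod.val_natCast_of_lt (by omega)]
      omega
    · simp [torusHalf, hL]
  · refine hsub i (f x i) (fun z => torusHalf i (f x i) (f z)) (fun z => hflip _ _ z)
      (fun z z' hz hz' h => ?_) ?_ ?_
    · rw [← torusRefl_of_cross hL hz hz' ((periodicAdj_iff hL _ _).1 h), Equiv.symm_apply_apply]
    · simp [torusHalf, hL]
    · have : f y i - f x i = ((2 * L - 1 : ℕ) : ZMod (2 * L)) := by
        rw [h2, Nat.cast_sub (by omega), ZMod.natCast_self]; push_cast; ring
      rw [torusHalf, this, ZMod.val_natCast_of_lt (by omega)]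
      omega

end Box

/-! ### The fluctuations of the transverse magnetization in the ground state -/

section Fluctuation

variable {ι : Type*} [Fintype ι] [DecidableEq ι]

/-- Divide by t² and let t tend to 0. -/
theorem nonneg_of_quartic {c₀ c₁ c₂ : ℝ} (h : ∀ t : ℝ, 0 ≤ t ^ 2 * (c₀ + t * c₁ + t ^ 2 * c₂)) :
    0 ≤ c₀ := by
  have hlim : Tendsto (fun t : ℝ => c₀ + t * c₁ + t ^ 2 * c₂) (𝓝[≠] 0) (𝓝 c₀) := by
    have : Continuous fun t : ℝ => c₀ + t * c₁ + t ^ 2 * c₂ := by fun_prop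
    have h0 := this.tendsto 0
    simp only [zero_mul, add_zero, ne_eq, OfNat.ofNat_ne_zero, not_false_eq_true, zero_pow] at h0
    exact h0.mono_left nhdsWithin_le_nhds
  refine ge_of_tendsto hlim ?_
  filter_upwards [self_mem_nhdsWithin] with t ht
  have ht2 : 0 < t ^ 2 := by
    have : t ≠ 0 := ht
    positivity
  exact nonneg_of_mul_nonneg_right (h t) ht2

/-- If a perturbation `A` lowers the ground state energy at most quadratically, then its
fluctuations are bounded in terms of a double commutator. -/
theorem groundState_sq_le [Nonempty ι] {H A : Matrix ι ι ℂ} (hH : H.IsHermitian)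
    (hA : star A = A) {K : ℝ}
    (hK : ∀ h : ℝ, (H - (h : ℂ) • A + ((h ^ 2 * K : ℝ) : ℂ) • 1 -
      (groundEnergy H : ℂ) • 1).PosSemidef) :
    (groundState H (A * A)).re ^ 2 ≤
      K * ((groundState H (A * (H * A - A * H) - (H * A - A * H) * A)).re / 2) := by
  have hρ := groundState_isPosState hH
  set ρ := groundState H with hρdef
  set E := groundEnergy H with hE
  have hr : ∀ X, ρ (X * H) = E * ρ X := groundState_mul_right
  have hl : ∀ X, ρ (H * X) = E * ρ X := groundState_mul_left hH
  set f : ℝ := (ρ (A * (H * A - A * H) - (H * A - A * H) * A)).re / 2 with hf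
  -- Half the double commutator has the expectation of A(H - E)A, because H acts as E in the ground
  -- state on either side.
  have hf' : (ρ (A * H * A)).re = f + E * (ρ (A * A)).re := by
    have : A * (H * A - A * H) - (H * A - A * H) * A =
        (2 : ℂ) • (A * H * A) - A * A * H - H * (A * A) := by
      simp only [mul_sub, sub_mul, mul_assoc]
      module
    rw [hf, this, map_sub, map_sub, map_smul, hr, hl]
    simp
    ring
  set a := (ρ A).re
  set s := (ρ (A * A)).re with hs
  set s₃ := (ρ (A * A * A)).re
  -- Trial vectors (1 + tA)ψ, with ψ a ground state, are tested in the inequality assumed for the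
  -- perturbed Hamiltonian.
  have key : ∀ h t : ℝ, 0 ≤ t ^ 2 * f - h * (a + 2 * t * s + t ^ 2 * s₃) +
      h ^ 2 * K * (1 + 2 * t * a + t ^ 2 * s) := by
    intro h t
    have h1 := (hK h).conjTranspose_mul_mul_same (1 + (t : ℂ) • A)
    have h2 := hρ.re_nonneg h1
    have h3 : (1 + (t : ℂ) • A)ᴴ = 1 + (t : ℂ) • A := by
      rw [Matrix.conjTranspose_add, Matrix.conjTranspose_smul, ← Matrix.star_eq_conjTranspose A, hA]
      simp
    have h4 : (1 + (t : ℂ) • A)ᴴ * (H - (h : ℂ) • A + ((h ^ 2 * K : ℝ) : ℂ) • 1 -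
        (E : ℂ) • 1) * (1 + (t : ℂ) • A) =
        1 * H + (t : ℂ) • (A * H) + (t : ℂ) • (H * A) + ((t : ℂ) ^ 2) • (A * H * A) -
          (h : ℂ) • (A + (2 * t : ℂ) • (A * A) + ((t : ℂ) ^ 2) • (A * A * A)) +
          (((h ^ 2 * K : ℝ) : ℂ) - (E : ℂ)) • (1 + (2 * t : ℂ) • A + ((t : ℂ) ^ 2) • (A * A)) := by
      rw [h3]
      simp only [mul_add, add_mul, mul_sub, sub_mul, smul_mul_assoc, mul_smul_comm, mul_one, one_mul,
        mul_assoc]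
      module
    rw [h4] at h2
    simp only [map_add, map_sub, map_smul, hr, hl, hρ.one, smul_eq_mul, mul_one] at h2
    have e1 : ∀ (r : ℝ) (z : ℂ), ((r : ℂ) * z).re = r * z.re := fun r z => by simp
    have e2 : ∀ (r : ℝ) (z : ℂ), ((r : ℂ) ^ 2 * z).re = r ^ 2 * z.re := fun r z => by
      rw [← Complex.ofReal_pow, e1]
    have e3 : ∀ (r : ℝ) (z : ℂ), ((2 * r : ℂ) * z).re = 2 * r * z.re := fun r z => by
      have : (2 * r : ℂ) = ((2 * r : ℝ) : ℂ) := by push_cast; rfl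
      rw [this, e1]
    have e4 : ∀ (r r' : ℝ) (z : ℂ), (((r : ℂ) - r') * z).re = (r - r') * z.re := fun r r' z => by
      rw [← Complex.ofReal_sub, e1]
    simp only [Complex.add_re, Complex.sub_re, e1, e2, e3, e4, hf', Complex.one_re,
      Complex.ofReal_re] at h2
    nlinarith [h2]
  -- At t = 0 a term linear in h would dominate the quadratic one, so the expectation of A vanishes.
  have ha : a = 0 := by
    have h1 : ∀ h : ℝ, 0 ≤ K * (h * h) + (-a) * h + 0 := by
      intro h
      have := key h 0
      nlinarith
    have := discrim_le_zero h1
    rw [discrim] at this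
    nlinarith [sq_nonneg a]
  rw [ha] at key
  -- With h = l t every surviving term is of order at least t². The coefficient of t² is K l² - 2 s
  -- l + f, and its discriminant gives s² ≤ K f.
  have h5 : ∀ l : ℝ, 0 ≤ K * (l * l) + (-(2 * s)) * l + f := by
    intro l
    have := nonneg_of_quartic (c₀ := K * (l * l) + (-(2 * s)) * l + f) (c₁ := -l * s₃)
      (c₂ := l ^ 2 * K * s) (fun t => by
        have := key (l * t) t
        nlinarith [this])
    exact this
  have := discrim_le_zero h5
  rw [discrim] at this
  nlinarith [this]

end Fluctuation

/-! ### Double commutators of weighted spin sums with the Hamiltonian -/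

section DoubleCommutator

variable {V κ : Type*} [Fintype V] [DecidableEq V] [Fintype κ] [DecidableEq κ]

open scoped Matrix.Norms.L2Operator in
theorem norm_oneSite_le (x : V) (M : Matrix κ κ ℂ) : ‖oneSite x M‖ ≤ ‖M‖ :=
  NonUnitalStarAlgHom.norm_apply_le (oneSite x) M

theorem lie_sum_smul {A : Type*} [Ring A] [Algebra ℝ A] {s : Finset V} (g : V → ℝ) (S : V → A)
    (X : A) : X * (∑ z ∈ s, g z • S z) - (∑ z ∈ s, g z • S z) * X =
      ∑ z ∈ s, g z • (X * S z - S z * X) := by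
  simp only [Finset.mul_sum, Finset.sum_mul, mul_smul_comm, smul_mul_assoc, smul_sub,
    Finset.sum_sub_distrib]

theorem sum_smul_eq_two {A : Type*} [AddCommGroup A] [Module ℝ A] {x y : V} (hxy : x ≠ y) (g : V → ℝ)
    (F : V → A) (hF : ∀ z, z ≠ x → z ≠ y → F z = 0) : ∑ z, g z • F z = g x • F x + g y • F y := by
  rw [← Finset.sum_pair hxy (f := fun z => g z • F z)]
  symm
  refine Finset.sum_subset (Finset.subset_univ _) fun z _ hz => ?_
  simp only [Finset.mem_insert, Finset.mem_singleton, not_or] at hz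
  rw [hF z hz.1 hz.2, smul_zero]

/-- The double commutator of a bond term with a weighted sum of one-site terms whose uniform sum
commutes with the bond term. -/
theorem doubleComm_bond {A : Type*} [Ring A] [Algebra ℝ A] {x y : V} (hxy : x ≠ y) (g : V → ℝ)
    (S : V → A) (h : A) (hS : ∀ z, z ≠ x → z ≠ y → Commute h (S z))
    (hSS : ∀ z, z ≠ x → Commute (S x) (S z))
    (hsum : Commute h (S x + S y)) :
    let T := ∑ z, g z • S z
    T * (h * T - T * h) - (h * T - T * h) * T =
      (g x - g y) ^ 2 • (S x * (h * S x - S x * h) - (h * S x - S x * h) * S x) := by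
  intro T
  have h1 : h * S y - S y * h = -(h * S x - S x * h) := by
    have := hsum.eq
    rw [mul_add, add_mul] at this
    rw [eq_neg_iff_add_eq_zero, ← sub_eq_zero.2 this]
    abel
  have h2 : h * T - T * h = (g x - g y) • (h * S x - S x * h) := by
    rw [lie_sum_smul, sum_smul_eq_two hxy g (fun z => h * S z - S z * h)
      (fun z hz hz' => sub_eq_zero.2 (hS z hz hz').eq), h1]
    module
  set D := h * S x - S x * h with hD
  have h3 : ∀ z, z ≠ x → z ≠ y → D * S z - S z * D = 0 := by
    intro z hz hz'
    have c1 := hS z hz hz'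
    have c2 := hSS z hz
    exact sub_eq_zero.2 ((c1.mul_left c2).sub_left (c2.mul_left c1)).eq
  have h4 : D * S y - S y * D = -(D * S x - S x * D) := by
    have c : Commute D (S x + S y) := by
      have c2 : Commute (S x) (S x + S y) := (Commute.refl _).add_right (hSS y hxy.symm)
      exact (hsum.mul_left c2).sub_left (c2.mul_left hsum)
    have := c.eq
    rw [mul_add, add_mul] at this
    rw [eq_neg_iff_add_eq_zero, ← sub_eq_zero.2 this]
    abel
  have h5 : D * T - T * D = (g x - g y) • (D * S x - S x * D) := by
    rw [lie_sum_smul, sum_smul_eq_two hxy g (fun z => D * S z - S z * D) h3, h4]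
    module
  rw [h2, mul_smul_comm, smul_mul_assoc, ← smul_sub, ← neg_sub (D * T), h5, ← neg_sub (D * S x),
    ← smul_neg, smul_smul, sq]

/-- A field term does not commute with the uniform sum, so the weight itself appears here and not a
difference of weights. For the staggered field this is harmless only because it is multiplied by
|B|. -/
theorem doubleComm_site {A : Type*} [Ring A] [Algebra ℝ A] {x : V} (g : V → ℝ)
    (S : V → A) (h : A) (hS : ∀ z, z ≠ x → Commute h (S z))
    (hSS : ∀ z, z ≠ x → Commute (S x) (S z)) :
    let T := ∑ z, g z • S z
    T * (h * T - T * h) - (h * T - T * h) * T =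
      g x ^ 2 • (S x * (h * S x - S x * h) - (h * S x - S x * h) * S x) := by
  intro T
  have h2 : h * T - T * h = g x • (h * S x - S x * h) := by
    rw [lie_sum_smul, Finset.sum_eq_single x]
    · intro z _ hz
      rw [sub_eq_zero.2 (hS z hz).eq, smul_zero]
    · simp
  set D := h * S x - S x * h with hD
  have h5 : D * T - T * D = g x • (D * S x - S x * D) := by
    rw [lie_sum_smul, Finset.sum_eq_single x]
    · intro z _ hz
      have c1 := hS z hz
      have c2 := hSS z hz
      rw [sub_eq_zero.2 ((c1.mul_left c2).sub_left (c2.mul_left c1)).eq, smul_zero]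
    · simp
  rw [h2, mul_smul_comm, smul_mul_assoc, ← smul_sub, ← neg_sub (D * T), h5, ← neg_sub (D * S x),
    ← smul_neg, smul_smul, sq]

theorem norm_doubleComm_le {A : Type*} [NormedRing A] (s h : A) :
    ‖s * (h * s - s * h) - (h * s - s * h) * s‖ ≤ 4 * ‖s‖ ^ 2 * ‖h‖ := by
  have h1 : ‖h * s - s * h‖ ≤ 2 * ‖h‖ * ‖s‖ := by
    refine (norm_sub_le _ _).trans ?_
    have := norm_mul_le h s
    have := norm_mul_le s h
    linarith
  refine (norm_sub_le _ _).trans ?_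
  have h2 := norm_mul_le s (h * s - s * h)
  have h3 := norm_mul_le (h * s - s * h) s
  have h4 := mul_le_mul_of_nonneg_left h1 (norm_nonneg s)
  nlinarith

open scoped Matrix.Norms.L2Operator in
/-- A bound for the norms of all the double commutators of the terms of the Hamiltonian. -/
def commBound (s : Fin 3 → Matrix κ κ ℂ) : ℝ :=
  4 * ‖s 0‖ ^ 2 * (∑ a, ‖s a‖ ^ 2 + ‖s 2‖)

open scoped Matrix.Norms.L2Operator in
theorem commBound_nonneg (s : Fin 3 → Matrix κ κ ℂ) : 0 ≤ commBound s := by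
  exact mul_nonneg (mul_nonneg (by norm_num) (sq_nonneg _))
    (add_nonneg (Finset.sum_nonneg fun _ _ => sq_nonneg _) (norm_nonneg _))

theorem four_sq_mul_le {p q P Q : ℝ} (hp : 0 ≤ p) (hq : 0 ≤ q) (h : p ≤ P) (h' : q ≤ Q) :
    4 * p ^ 2 * q ≤ 4 * P ^ 2 * Q := by
  gcongr

/-- Invariance of the exchange interaction under simultaneous rotations of both spins about the
first axis. -/
theorem commute_bond_total {s : Fin 3 → Matrix κ κ ℂ}
    (h01 : s 0 * s 1 - s 1 * s 0 = Complex.I • s 2) (h20 : s 2 * s 0 - s 0 * s 2 = Complex.I • s 1)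
    {x y : V} (hxy : x ≠ y) :
    Commute (∑ a, oneSite x (s a) * oneSite y (s a)) (oneSite x (s 0) + oneSite y (s 0)) := by
  have c : ∀ a b, oneSite y (s b) * oneSite x (s a) = oneSite x (s a) * oneSite y (s b) :=
    fun a b => (oneSite_commute hxy.symm (s b) (s a)).eq
  have key : ∀ z : V, oneSite z (s 1) * oneSite z (s 0) =
      oneSite z (s 0) * oneSite z (s 1) - Complex.I • oneSite z (s 2) := by
    intro z
    rw [← map_mul, ← map_mul, ← map_smul, ← h01, map_sub]
    abel
  have key' : ∀ z : V, oneSite z (s 2) * oneSite z (s 0) =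
      oneSite z (s 0) * oneSite z (s 2) + Complex.I • oneSite z (s 1) := by
    intro z
    rw [← map_mul, ← map_mul, ← map_smul, ← h20, map_sub]
    abel
  rw [Commute, SemiconjBy, Fin.sum_univ_three]
  have c' : ∀ a b z, oneSite y (s b) * (oneSite x (s a) * z) =
      oneSite x (s a) * (oneSite y (s b) * z) := fun a b z => by
    rw [← mul_assoc, c, mul_assoc]
  have k' : ∀ (z : V) w, oneSite z (s 1) * (oneSite z (s 0) * w) =
      oneSite z (s 0) * (oneSite z (s 1) * w) - Complex.I • (oneSite z (s 2) * w) := fun z w => by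
    rw [← mul_assoc, key, sub_mul, mul_assoc, smul_mul_assoc]
  have k'' : ∀ (z : V) w, oneSite z (s 2) * (oneSite z (s 0) * w) =
      oneSite z (s 0) * (oneSite z (s 2) * w) + Complex.I • (oneSite z (s 1) * w) := fun z w => by
    rw [← mul_assoc, key', add_mul, mul_assoc, smul_mul_assoc]
  simp only [mul_add, add_mul, mul_assoc, c, c', key, key', k', k'', mul_sub, mul_smul_comm]
  module

-- Each bond contributes the square of a difference of weights, by `doubleComm_bond`. For slowly
-- varying g this is much smaller than Σ g_x², which only the field term produces.
open scoped Matrix.Norms.L2Operator in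
open Classical in
theorem re_doubleComm_afHam_le {s : Fin 3 → Matrix κ κ ℂ}
    (h01 : s 0 * s 1 - s 1 * s 0 = Complex.I • s 2) (h20 : s 2 * s 0 - s 0 * s 2 = Complex.I • s 1)
    {adj : V → V → Prop} (hirr : ∀ x, ¬ adj x x) (b g : V → ℝ)
    {φ : Matrix (V → κ) (V → κ) ℂ →ₗ[ℂ] ℂ} (hφ : IsPosState φ) :
    let T := ∑ z, g z • oneSite z (s 0)
    (φ (T * (afHam s adj b * T - T * afHam s adj b) -
      (afHam s adj b * T - T * afHam s adj b) * T)).re ≤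
      commBound s * (∑ x, ∑ y, (if adj x y then (g x - g y) ^ 2 else 0) + ∑ x, |b x| * g x ^ 2) := by
  intro T
  refine (hφ.re_le_norm _).trans ?_
  set F : Matrix (V → κ) (V → κ) ℂ →ₗ[ℝ] Matrix (V → κ) (V → κ) ℂ :=
    { toFun := fun h => T * (h * T - T * h) - (h * T - T * h) * T
      map_add' := by intro h h'; noncomm_ring
      map_smul' := by
        intro c h
        simp only [smul_mul_assoc, mul_smul_comm, ← smul_sub, RingHom.id_apply] } with hF
  change ‖F (afHam s adj b)‖ ≤ _
  have hb : ∀ x y, adj x y → ‖F (∑ a, oneSite x (s a) * oneSite y (s a))‖ ≤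
      commBound s * (g x - g y) ^ 2 := by
    intro x y hxy
    have hne : x ≠ y := fun h => hirr x (by rw [← h] at hxy; exact hxy)
    have h1 := doubleComm_bond hne g (fun z => oneSite z (s 0))
      (∑ a, oneSite x (s a) * oneSite y (s a))
      (fun z hz hz' => Commute.sum_left _ _ _ fun a _ =>
        (oneSite_commute hz.symm _ _).mul_left (oneSite_commute hz'.symm _ _))
      (fun z hz => oneSite_commute hz.symm _ _) (commute_bond_total h01 h20 hne)
    change F (∑ a, oneSite x (s a) * oneSite y (s a)) = _ at h1
    rw [h1, norm_smul, Real.norm_of_nonneg (sq_nonneg _), mul_comm]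
    refine mul_le_mul_of_nonneg_right ?_ (sq_nonneg _)
    refine (norm_doubleComm_le _ _).trans ?_
    have h2 : ‖∑ a, oneSite x (s a) * oneSite y (s a)‖ ≤ ∑ a, ‖s a‖ ^ 2 := by
      refine (norm_sum_le _ _).trans (Finset.sum_le_sum fun a _ => ?_)
      refine (norm_mul_le _ _).trans ?_
      rw [sq]
      exact mul_le_mul (norm_oneSite_le _ _) (norm_oneSite_le _ _) (norm_nonneg _) (norm_nonneg _)
    have h3 := norm_oneSite_le x (s 0)
    exact four_sq_mul_le (norm_nonneg _) (norm_nonneg _) h3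
      (h2.trans (le_add_of_nonneg_right (norm_nonneg _)))
  have hs : ∀ x, ‖F (b x • oneSite x (s 2))‖ ≤ commBound s * (|b x| * g x ^ 2) := by
    intro x
    have h1 := doubleComm_site (x := x) g (fun z => oneSite z (s 0)) (oneSite x (s 2))
      (fun z hz => oneSite_commute hz.symm _ _) (fun z hz => oneSite_commute hz.symm _ _)
    change F (oneSite x (s 2)) = _ at h1
    rw [map_smul, h1, norm_smul, norm_smul, Real.norm_of_nonneg (sq_nonneg _), Real.norm_eq_abs,
      ← mul_assoc, mul_comm]
    refine mul_le_mul_of_nonneg_right ?_ (by positivity)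
    refine (norm_doubleComm_le _ _).trans ?_
    have h3 := norm_oneSite_le x (s 0)
    have h4 := norm_oneSite_le x (s 2)
    exact four_sq_mul_le (norm_nonneg _) (norm_nonneg _) h3
      (h4.trans (le_add_of_nonneg_left (Finset.sum_nonneg fun _ _ => sq_nonneg _)))
  have hC := commBound_nonneg s
  rw [afHam, map_sub, map_smul, map_sum, map_sum, mul_add]
  refine (norm_sub_le _ _).trans (add_le_add ?_ ?_)
  · rw [norm_smul, Real.norm_of_nonneg (by norm_num)]
    have h1 : ‖∑ x, F (∑ y, if adj x y then ∑ a, oneSite x (s a) * oneSite y (s a) else 0)‖ ≤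
        commBound s * ∑ x, ∑ y, (if adj x y then (g x - g y) ^ 2 else 0) := by
      rw [Finset.mul_sum]
      refine (norm_sum_le _ _).trans (Finset.sum_le_sum fun x _ => ?_)
      rw [Finset.mul_sum, map_sum]
      refine (norm_sum_le _ _).trans (Finset.sum_le_sum fun y _ => ?_)
      split_ifs with h
      · exact hb x y h
      · simp
    have h2 := norm_nonneg (∑ x, F (∑ y, if adj x y then ∑ a, oneSite x (s a) * oneSite y (s a) else 0))
    linarith
  · rw [Finset.mul_sum]
    exact (norm_sum_le _ _).trans (Finset.sum_le_sum fun x _ => hs x)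

end DoubleCommutator

/-! ### The Heisenberg antiferromagnet in the periodic box -/

section Hamiltonian

variable {d n L : ℕ}

/-- The neighbour relation of the periodic box. -/
def BoxAdj (d L : ℕ) (x y : box d L) : Prop := PeriodicAdj L (x : Site d) y

theorem BoxAdj.symm {x y : box d L} (h : BoxAdj d L x y) : BoxAdj d L y x := PeriodicAdj.symm h

theorem BoxAdj.irrefl (hL : 0 < L) (x : box d L) : ¬ BoxAdj d L x x := by
  rintro ⟨i, -, h | h⟩
  · rw [sub_self, zero_sub, dvd_neg] at h
    have := Int.le_of_dvd one_pos h
    omega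
  · rw [sub_self, zero_add] at h
    have := Int.le_of_dvd one_pos h
    omega

theorem orderParam_eq (d n L : ℕ) :
    orderParam d n L = ∑ x : box d L, stagger (x : Site d) • oneSite x (spinVec n 2) := by
  refine Finset.sum_congr rfl fun x _ => ?_
  rw [siteOp_eq_oneSite, ← Complex.coe_smul, stagger]
  congr 1
  push_cast
  rfl

theorem heisenberg_eq (d n L : ℕ) : heisenberg d n L = afHam (spinVec n) (BoxAdj d L) 0 := by
  classical
  rw [heisenberg, afHam]
  simp only [siteOp_eq_oneSite, Pi.zero_apply, zero_smul, Finset.sum_const_zero, sub_zero]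
  have hc : (1 / 2 : ℂ) = ((1 / 2 : ℝ) : ℂ) := by norm_num
  rw [hc, Complex.coe_smul]
  refine congrArg _ (Finset.sum_congr rfl fun x _ => Finset.sum_congr rfl fun y _ => ?_)
  by_cases h : BoxAdj d L x y
  · rw [if_pos h, if_pos (show PeriodicAdj L (x : Site d) y from h), Fin.sum_univ_three]; rfl
  · rw [if_neg h, if_neg (show ¬ PeriodicAdj L (x : Site d) y from h)]

theorem hamiltonian_eq (d n L : ℕ) (B : ℝ) : hamiltonian d n L B =
    afHam (spinVec n) (BoxAdj d L) (fun x => B * stagger (x : Site d)) := by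
  rw [hamiltonian, heisenberg_eq, orderParam_eq, afHam, afHam]
  simp only [Pi.zero_apply, zero_smul, Finset.sum_const_zero, sub_zero, Finset.smul_sum,
    Complex.coe_smul, smul_smul]

theorem hamiltonian_zero (d n L : ℕ) : hamiltonian d n L 0 = heisenberg d n L := by
  simp [hamiltonian]

theorem afHam_isHermitian {V κ : Type*} [Fintype V] [DecidableEq V] [Fintype κ] [DecidableEq κ]
    {s : Fin 3 → Matrix κ κ ℂ} (hs : ∀ a, IsSelfAdjoint (s a))
    {adj : V → V → Prop} (hadj : ∀ x y, adj x y → adj y x) (b : V → ℝ) :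
    (afHam s adj b).IsHermitian := by
  classical
  have := shiftedHam_eq s hadj b 0
  simp only [Pi.zero_apply, add_zero] at this
  simp at this
  rw [← this]
  exact shiftedHam_isHermitian hs hadj _ _ _

theorem hamiltonian_isHermitian (d n L : ℕ) (B : ℝ) : (hamiltonian d n L B).IsHermitian := by
  rw [hamiltonian_eq]
  exact afHam_isHermitian (spinVec_isSelfAdjoint n) (fun x y h => h.symm) _

open Classical in
/-- The fluctuations of a weighted transverse magnetization in the ground state. -/
theorem fluctuation_le (hL : 0 < L) (B : ℝ) (k g : box d L → ℝ)
    (hg : ∀ x, g x = ∑ y, if BoxAdj d L x y then k x + k y else 0) :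
    (groundState (hamiltonian d n L B) ((∑ x, g x • oneSite x (spin1 n)) *
      (∑ x, g x • oneSite x (spin1 n)))).re ^ 2 ≤
      (∑ x, ∑ y, if BoxAdj d L x y then (k x + k y) ^ 2 else 0) *
        (commBound (spinVec n) * (∑ x, ∑ y, (if BoxAdj d L x y then (g x - g y) ^ 2 else 0) +
          |B| * ∑ x, g x ^ 2)) := by
  have hH := hamiltonian_isHermitian d n L B
  set T : LocalAlg n (box d L) := ∑ x, g x • oneSite x (spin1 n) with hT
  have hTs : star T = T := by
    rw [hT, star_sum]
    refine Finset.sum_congr rfl fun x _ => ?_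
    rw [star_smul, ← map_star, spin1_star]
    rfl
  set K : ℝ := 1 / 4 * ∑ x, ∑ y, if BoxAdj d L x y then (k x + k y) ^ 2 else 0 with hK
  -- The shift h k produces the field h g, with a constant quadratic in h; this is the energy bound
  -- required of the perturbation T.
  have h1 := groundState_sq_le hH hTs (K := K) (by
    intro h
    have h2 := groundEnergy_afHam_field (fun x y h => BoxAdj.symm h) (rotation_mul_star n)
      (spinVec_isSelfAdjoint n) (rotation_spin n) (adj := BoxAdj d L)
      (b := fun x => B * stagger (x : Site d)) (exists_mirror hL B) (fun x => h * k x)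
    rw [← hamiltonian_eq] at h2
    have e1 : ∀ x, (∑ y, if BoxAdj d L x y then h * k x + h * k y else 0) = h * g x := by
      intro x
      rw [hg, Finset.mul_sum]
      refine Finset.sum_congr rfl fun y _ => ?_
      split_ifs <;> ring
    have e2 : (1 / 4 * ∑ x, ∑ y, if BoxAdj d L x y then (h * k x + h * k y) ^ 2 else 0) =
        h ^ 2 * K := by
      rw [hK, mul_left_comm]
      congr 1
      rw [Finset.mul_sum]
      refine Finset.sum_congr rfl fun x _ => ?_
      rw [Finset.mul_sum]
      refine Finset.sum_congr rfl fun y _ => ?_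
      split_ifs <;> ring
    rw [e2] at h2
    simp only [e1, mul_smul, ← Finset.smul_sum] at h2
    rw [Complex.coe_smul, Complex.coe_smul, mul_smul]
    exact h2)
  have h3 := re_doubleComm_afHam_le (s := spinVec n) (spin_comm12 n) (spin_comm31 n)
    (adj := BoxAdj d L) (BoxAdj.irrefl hL) (fun x => B * stagger (x : Site d)) g
    (groundState_isPosState hH)
  rw [← hamiltonian_eq] at h3
  have h4 : ∑ x : box d L, |B * stagger (x : Site d)| * g x ^ 2 = |B| * ∑ x, g x ^ 2 := by
    rw [Finset.mul_sum]
    refine Finset.sum_congr rfl fun x _ => ?_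
    rw [abs_mul, stagger, abs_zpow, abs_neg, abs_one, one_zpow, mul_one]
  rw [h4] at h3
  change (groundState (hamiltonian d n L B) (T * (hamiltonian d n L B * T - T * hamiltonian d n L B) -
    (hamiltonian d n L B * T - T * hamiltonian d n L B) * T)).re ≤ _ at h3
  set S := ∑ x, ∑ y, if BoxAdj d L x y then (k x + k y) ^ 2 else 0 with hS
  set G := commBound (spinVec n) * (∑ x, ∑ y, (if BoxAdj d L x y then (g x - g y) ^ 2 else 0) +
          |B| * ∑ x, g x ^ 2) with hG
  have hS0 : 0 ≤ S := Finset.sum_nonneg fun x _ => Finset.sum_nonneg fun y _ => by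
    split_ifs
    · positivity
    · rfl
  have hG0 : 0 ≤ G := by
    refine mul_nonneg (commBound_nonneg _) (add_nonneg ?_ (by positivity))
    exact Finset.sum_nonneg fun x _ => Finset.sum_nonneg fun y _ => by
      split_ifs
      · positivity
      · rfl
  -- The factor 1/4 in K and the factor 1/2 before the double commutator are given away.
  refine h1.trans ?_
  rw [hK]
  nlinarith [mul_nonneg hS0 hG0, mul_le_mul_of_nonneg_left h3 hS0]

end Hamiltonian

/-! ### Symmetries -/

section Symmetry

variable {ι : Type*} [Fintype ι] [DecidableEq ι]

/-- A relabelling of the basis is conjugation by a permutation matrix, hence a unitary symmetry. -/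
theorem groundExpect_reindex {H : Matrix ι ι ℂ} (E : ι ≃ ι)
    (hE : Matrix.reindexAlgEquiv ℂ ℂ E H = H) (a : Matrix ι ι ℂ) :
    groundExpect H (Matrix.reindexAlgEquiv ℂ ℂ E a) = groundExpect H a := by
  set U : Matrix ι ι ℂ := Matrix.of fun i j => if E.symm i = j then 1 else 0 with hU
  have h1 : ∀ X : Matrix ι ι ℂ, U * X * star U = Matrix.reindexAlgEquiv ℂ ℂ E X := by
    intro X
    ext i j
    simp [hU, Matrix.mul_apply, Matrix.star_apply]
  have h2 : U * star U = 1 := by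
    have := h1 1
    rwa [mul_one, map_one] at this
  have h3 : star U * U = 1 := mul_eq_one_comm.1 h2
  have h4 : U * H = H * U := by
    have := h1 H
    rw [hE] at this
    calc U * H = U * H * star U * U := by rw [mul_assoc (U * H), h3, mul_one]
      _ = H * U := by rw [this]
  have h5 : star U * H = H * star U := by
    calc star U * H = star U * (H * U) * star U := by simp only [mul_assoc, h2, mul_one]
      _ = H * star U := by rw [← h4, ← mul_assoc, h3, one_mul]
  rw [← h1]
  have := groundExpect_conj (H := H) (U := star U) (by rwa [star_star]) h5 (by rwa [star_star]) a
  rwa [star_star] at this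

theorem groundEnergy_reindex [Nonempty ι] {H : Matrix ι ι ℂ} (hH : H.IsHermitian) (E : ι ≃ ι) :
    groundEnergy (Matrix.reindexAlgEquiv ℂ ℂ E H) = groundEnergy H := by
  have hH' : (Matrix.reindexAlgEquiv ℂ ℂ E H).IsHermitian := by
    rw [Matrix.coe_reindexAlgEquiv, Matrix.reindex_apply]
    exact hH.submatrix _
  refine eq_of_forall_le_iff fun e => ?_
  rw [← formGe_iff_le_groundEnergy hH, ← formGe_iff_le_groundEnergy hH', FormGe.reindex_iff]

variable {V : Type*} [Fintype V] [DecidableEq V] (n : ℕ)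

/-- Relabelling the sites by `τ`, and flipping all the spins. -/
def flipEquiv (τ : V ≃ V) : (V → Fin (n + 1)) ≃ (V → Fin (n + 1)) :=
  Equiv.arrowCongr τ Fin.revPerm

theorem reindex_flip_oneSite (τ : V ≃ V) (x : V) (M : Matrix (Fin (n + 1)) (Fin (n + 1)) ℂ) :
    Matrix.reindexAlgEquiv ℂ ℂ (flipEquiv n τ) (oneSite x M) =
      oneSite (τ x) (M.submatrix Fin.rev Fin.rev) := by
  ext σ ρ
  rw [Matrix.coe_reindexAlgEquiv, Matrix.reindex_apply, Matrix.submatrix_apply]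
  have h : ∀ σ : V → Fin (n + 1), (flipEquiv n τ).symm σ = (fun x => (σ x).rev) ∘ τ := fun σ => rfl
  rw [h, h, oneSite_reindex, oneSite_eq_prodOp, oneSite_eq_prodOp, prodOp_apply, prodOp_apply]
  refine Finset.prod_congr rfl fun y _ => ?_
  by_cases hy : y = τ x
  · subst hy; simp
  · rw [Pi.mulSingle_eq_of_ne hy, Pi.mulSingle_eq_of_ne hy]
    simp [Matrix.one_apply]

theorem reindex_flip_spin3 (τ : V ≃ V) (x : V) :
    Matrix.reindexAlgEquiv ℂ ℂ (flipEquiv n τ) (oneSite x (spin3 n)) = -oneSite (τ x) (spin3 n) := by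
  rw [reindex_flip_oneSite, ← map_neg]
  congr 1
  ext j k
  exact spin3_rev n j k

/-- Reversing the basis at each site preserves the first component and changes the sign of the other
two. The exchange terms are even in each component; the field term is odd. -/
theorem reindex_flip_afHam (τ : V ≃ V) {adj : V → V → Prop} (hτ : ∀ x y, adj (τ x) (τ y) ↔ adj x y)
    (b : V → ℝ) :
    Matrix.reindexAlgEquiv ℂ ℂ (flipEquiv n τ) (afHam (spinVec n) adj b) =
      afHam (spinVec n) adj (fun x => -b (τ.symm x)) := by
  classical
  have hr : ∀ (r : ℝ) (a : Matrix (V → Fin (n + 1)) (V → Fin (n + 1)) ℂ),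
      Matrix.reindexAlgEquiv ℂ ℂ (flipEquiv n τ) (r • a) =
        r • Matrix.reindexAlgEquiv ℂ ℂ (flipEquiv n τ) a := by
    intro r a
    rw [← Complex.coe_smul, map_smul, Complex.coe_smul]
  have hite : ∀ (p : Prop) [Decidable p] (a : Matrix (V → Fin (n + 1)) (V → Fin (n + 1)) ℂ),
      Matrix.reindexAlgEquiv ℂ ℂ (flipEquiv n τ) (if p then a else 0) =
        if p then Matrix.reindexAlgEquiv ℂ ℂ (flipEquiv n τ) a else 0 := by
    intro p _ a; split_ifs <;> simp
  have h0 : ∀ x : V, Matrix.reindexAlgEquiv ℂ ℂ (flipEquiv n τ) (oneSite x (spinVec n 0)) =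
      oneSite (τ x) (spinVec n 0) := by
    intro x
    rw [reindex_flip_oneSite]
    congr 1
    ext j k
    exact spin1_rev n j k
  have h1 : ∀ x : V, Matrix.reindexAlgEquiv ℂ ℂ (flipEquiv n τ) (oneSite x (spinVec n 1)) =
      -oneSite (τ x) (spinVec n 1) := by
    intro x
    rw [reindex_flip_oneSite, ← map_neg]
    congr 1
    ext j k
    exact spin2_rev n j k
  have h2 : ∀ x : V, Matrix.reindexAlgEquiv ℂ ℂ (flipEquiv n τ) (oneSite x (spinVec n 2)) =
      -oneSite (τ x) (spinVec n 2) := reindex_flip_spin3 n τ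
  have hb : ∀ x y : V, Matrix.reindexAlgEquiv ℂ ℂ (flipEquiv n τ)
      (∑ a, oneSite x (spinVec n a) * oneSite y (spinVec n a)) =
      ∑ a, oneSite (τ x) (spinVec n a) * oneSite (τ y) (spinVec n a) := by
    intro x y
    simp only [Fin.sum_univ_three, map_add, map_mul, h0, h1, h2, neg_mul_neg]
  rw [afHam, afHam, map_sub, hr]
  simp only [map_sum, hite]
  congr 1
  · refine congrArg _ (Eq.trans ?_ (Equiv.sum_comp τ _))
    refine Finset.sum_congr rfl fun x _ => Eq.trans ?_ (Equiv.sum_comp τ _)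
    refine Finset.sum_congr rfl fun y _ => ?_
    have := hb x y
    rw [map_sum] at this
    simp only [hτ, this]
  · refine Eq.trans ?_ (Equiv.sum_comp τ _)
    refine Finset.sum_congr rfl fun x _ => ?_
    rw [hr, h2, Equiv.symm_apply_apply, smul_neg, neg_smul]

end Symmetry

/-! ### Spin flip and translation symmetries of the periodic box -/

section BoxSymmetry

variable {d n L : ℕ}

/-- Flipping the spins without moving the sites reverses the field and preserves the spectrum. -/
theorem groundEnergy_neg_field (B : ℝ) :
    groundEnergy (hamiltonian d n L (-B)) = groundEnergy (hamiltonian d n L B) := by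
  rw [← groundEnergy_reindex (hamiltonian_isHermitian d n L B) (flipEquiv n (Equiv.refl _)),
    hamiltonian_eq, hamiltonian_eq, reindex_flip_afHam _ _ (fun x y => Iff.rfl)]
  congr 2
  ext x
  simp

/-- The translation of the torus by one step in the direction `i`. -/
def torusShift (i : Fin d) : Torus d L ≃ Torus d L := Equiv.addRight (Pi.single i 1)

theorem torusAdj_torusShift (i : Fin d) (x y : Torus d L) :
    TorusAdj (torusShift i x) (torusShift i y) ↔ TorusAdj x y := by
  refine exists_congr fun j => and_congr (forall_congr' fun k => imp_congr_right fun _ => ?_)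
    (or_congr ?_ ?_) <;> simp only [torusShift, Equiv.coe_addRight, Pi.add_apply]
  · exact add_left_inj _
  · rw [add_right_comm, add_left_inj]
  · rw [add_right_comm, add_left_inj]

theorem parity_torusShift (i : Fin d) (x : Torus d L) :
    parity (torusShift i x) = parity x + 1 := by
  simp only [parity, torusShift, Equiv.coe_addRight, Pi.add_apply, map_add, Finset.sum_add_distrib]
  congr 1
  rw [Finset.sum_eq_single i]
  · simp
  · intro j _ hj
    rw [Pi.single_eq_of_ne hj, map_zero]
  · simp

/-- The translation of the periodic box by one step in the direction `i`. -/
def boxShift (hL : 0 < L) (i : Fin d) : box d L ≃ box d L :=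
  (boxEquiv d L hL).trans ((torusShift i).trans (boxEquiv d L hL).symm)

theorem stagger_boxShift (hL : 0 < L) (i : Fin d) (x : box d L) :
    stagger (boxShift hL i x : Site d) = -stagger (x : Site d) := by
  rw [stagger_eq hL, stagger_eq hL, boxShift, Equiv.trans_apply, Equiv.trans_apply,
    Equiv.apply_symm_apply, parity_torusShift, paritySign_add_one]

theorem boxAdj_boxShift (hL : 0 < L) (i : Fin d) (x y : box d L) :
    BoxAdj d L (boxShift hL i x) (boxShift hL i y) ↔ BoxAdj d L x y := by
  rw [BoxAdj, BoxAdj, periodicAdj_iff hL, periodicAdj_iff hL, boxShift, Equiv.trans_apply,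
    Equiv.trans_apply, Equiv.trans_apply, Equiv.trans_apply,
    Equiv.apply_symm_apply, Equiv.apply_symm_apply, torusAdj_torusShift]

/-- A unit translation exchanges the sublattices and so reverses the staggered field; the spin flip
reverses it back. -/
theorem reindex_hamiltonian (hL : 0 < L) (i : Fin d) (B : ℝ) :
    Matrix.reindexAlgEquiv ℂ ℂ (flipEquiv n (boxShift hL i)) (hamiltonian d n L B) =
      hamiltonian d n L B := by
  rw [hamiltonian_eq, reindex_flip_afHam _ _ (boxAdj_boxShift hL i)]
  congr 1
  ext x
  have := stagger_boxShift hL i ((boxShift hL i).symm x)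
  rw [Equiv.apply_symm_apply] at this
  rw [this]
  ring

/-- The local staggered magnetization is translation invariant in finite volume. -/
theorem groundState_stagger_shift (hL : 0 < L) (i : Fin d) (B : ℝ) (x : box d L) :
    stagger (boxShift hL i x : Site d) •
      groundState (hamiltonian d n L B) (oneSite (boxShift hL i x) (spin3 n)) =
    stagger (x : Site d) • groundState (hamiltonian d n L B) (oneSite x (spin3 n)) := by
  rw [stagger_boxShift, groundState_apply, groundState_apply,
    ← groundExpect_reindex _ (reindex_hamiltonian hL i B) (oneSite x (spin3 n)),
    reindex_flip_spin3, ← groundState_apply, ← groundState_apply, map_neg, smul_neg, neg_smul]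

end BoxSymmetry

/-! ### Local observables in the quasi-local algebra -/

section Embedding

variable {d n : ℕ} {Γ Λ : Finset (Site d)}

theorem actCLM_embed (h : Γ ⊆ Λ) (a : LocalAlg n Γ) : actCLM Λ (embed h a) = actCLM Γ a := by
  classical
  ext f σ
  rw [actCLM_apply, actCLM_apply]
  symm
  have hup : ∀ τ : Config n Γ, (fun x : Γ => Λ.restrict (Function.updateFinset σ Γ τ) ⟨x, h x.2⟩) = τ := by
    intro τ
    ext x
    simp [Function.updateFinset]
  have hup' : ∀ τ : Config n Γ, Function.updateFinset σ Λ (Λ.restrict (Function.updateFinset σ Γ τ)) =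
      Function.updateFinset σ Γ τ := by
    intro τ
    ext x
    by_cases hx : x ∈ Λ
    · simp [Function.updateFinset, hx]
    · have hx' : x ∉ Γ := fun hx' => hx (h hx')
      simp [Function.updateFinset, hx, hx']
  -- Only configurations of Λ which agree with σ outside Γ contribute, and these correspond to the
  -- configurations of Γ.
  refine Finset.sum_of_injOn (fun τ => Λ.restrict (Function.updateFinset σ Γ τ)) ?_ ?_ ?_ ?_
  · intro τ _ τ' _ heq
    rw [← hup τ, ← hup τ']
    exact congrArg (fun ρ : Config n Λ => fun x : Γ => ρ ⟨x, h x.2⟩) heq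
  · intro τ _
    exact Finset.mem_coe.2 (Finset.mem_univ _)
  · intro ρ _ hρ
    rw [embed, Matrix.of_apply, if_neg, zero_mul]
    intro hc
    apply hρ
    refine ⟨fun x => ρ ⟨x, h x.2⟩, Finset.mem_coe.2 (Finset.mem_univ _), ?_⟩
    ext x
    by_cases hx : (x : Site d) ∈ Γ
    · simp [Function.updateFinset, hx]
    · have := hc x hx
      simp [Function.updateFinset, hx, ← this]
  · intro τ _
    rw [hup', embed, Matrix.of_apply, if_pos, hup]
    · rfl
    · intro x hx
      simp [Function.updateFinset, hx]

theorem obs_embed (h : Γ ⊆ Λ) (a : LocalAlg n Γ) : obs n Λ (embed h a) = obs n Γ a :=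
  Subtype.ext (actCLM_embed h a)

/-- Matrix entries are recovered by acting on point masses. Consequently algebraic identities for
`embed` can be verified in the quasi-local algebra, where `embed` is invisible. -/
theorem obs_injective : Function.Injective (obs n Γ) := by
  classical
  intro a b hab
  have hab' : actCLM Γ a = actCLM Γ b := congrArg Subtype.val hab
  ext ρ τ
  have key : ∀ c : LocalAlg n Γ, actCLM Γ c
      (lp.single 2 (Function.updateFinset (fun _ => 0) Γ τ) (1 : ℂ))
      (Function.updateFinset (fun _ => 0) Γ ρ) = c ρ τ := by
    intro c
    rw [actCLM_apply, Function.restrict_updateFinset]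
    simp only [Function.updateFinset_updateFinset_of_subset subset_rfl]
    rw [Finset.sum_eq_single τ]
    · simp
    · intro τ' _ hne
      rw [lp.single_apply, Pi.single_eq_of_ne, mul_zero]
      intro heq
      apply hne
      have := congrArg (Γ.restrict) heq
      simpa only [Function.restrict_updateFinset] using this
    · simp
  rw [← key a, ← key b, hab']

/-- The embedding of `𝔄_Γ` in `𝔄_Λ`, as a `*`-homomorphism. -/
def embedHom (h : Γ ⊆ Λ) : LocalAlg n Γ →⋆ₐ[ℂ] LocalAlg n Λ where
  toFun := embed h
  map_one' := obs_injective (by simp only [obs_embed, map_one])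
  map_mul' a b := obs_injective (by simp only [obs_embed, map_mul])
  map_zero' := obs_injective (by simp only [obs_embed, map_zero])
  map_add' a b := obs_injective (by simp only [obs_embed, map_add])
  commutes' c := obs_injective (by
    simp only [obs_embed, Algebra.algebraMap_eq_smul_one, map_smul, map_one])
  map_star' a := obs_injective (by simp only [obs_embed, map_star])

theorem embedHom_apply (h : Γ ⊆ Λ) (a : LocalAlg n Γ) : embedHom h a = embed h a := rfl

theorem obs_embedHom (h : Γ ⊆ Λ) (a : LocalAlg n Γ) : obs n Λ (embedHom h a) = obs n Γ a :=
  obs_embed h a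

theorem embedHom_oneSite (h : Γ ⊆ Λ) (x : Γ) (M : Matrix (Fin (n + 1)) (Fin (n + 1)) ℂ) :
    embedHom h (oneSite x M) = oneSite (⟨x, h x.2⟩ : Λ) M := by
  classical
  ext σ τ
  rw [embedHom_apply, embed, Matrix.of_apply, oneSite_apply, oneSite_apply]
  by_cases h1 : ∀ y : Λ, y ≠ ⟨x, h x.2⟩ → σ y = τ y
  · rw [if_pos h1, if_pos, if_pos]
    · intro y hy
      exact h1 _ fun h2 => hy (Subtype.ext (congrArg (fun z : Λ => (z : Site d)) h2))
    · intro y hy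
      refine h1 _ fun h2 => hy ?_
      rw [h2]; exact x.2
  · rw [if_neg h1]
    by_cases h2 : ∀ y : Λ, (y : Site d) ∉ Γ → σ y = τ y
    · rw [if_pos h2, if_neg]
      intro h3
      apply h1
      intro y hy
      by_cases hyΓ : (y : Site d) ∈ Γ
      · exact h3 ⟨y, hyΓ⟩ fun h4 => hy (Subtype.ext (congrArg (fun z : Γ => (z : Site d)) h4))
      · exact h2 y hyΓ
    · rw [if_neg h2]

/-- The matrix `M` at the site `x`, in the quasi-local algebra. -/
def siteObs {d : ℕ} (n : ℕ) (x : Site d) (M : Matrix (Fin (n + 1)) (Fin (n + 1)) ℂ) :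
    quasiLocal d n :=
  obs n {x} (oneSite ⟨x, Finset.mem_singleton_self x⟩ M)

theorem obs_oneSite (x : Γ) (M : Matrix (Fin (n + 1)) (Fin (n + 1)) ℂ) :
    obs n Γ (oneSite x M) = siteObs n (x : Site d) M := by
  rw [siteObs, ← obs_embedHom (Finset.singleton_subset_iff.2 x.2), embedHom_oneSite]

theorem spinObs2_eq (x : Site d) : spinObs2 n x = siteObs n x (spin2 n) := by
  rw [spinObs2, siteOp_eq_oneSite, siteObs]

end Embedding

/-! ### Restriction of states to finite regions -/

section LocalState

variable {d n : ℕ}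

/-- The restriction of a functional to `𝔄_Γ`. -/
def restrictState (ω : quasiLocal d n →L[ℂ] ℂ) (Γ : Finset (Site d)) : LocalAlg n Γ →ₗ[ℂ] ℂ :=
  (ω : quasiLocal d n →ₗ[ℂ] ℂ) ∘ₗ (obs n Γ : LocalAlg n Γ →ₐ[ℂ] quasiLocal d n).toLinearMap

theorem restrictState_apply (ω : quasiLocal d n →L[ℂ] ℂ) (Γ : Finset (Site d)) (a : LocalAlg n Γ) :
    restrictState ω Γ a = ω (obs n Γ a) := rfl

theorem IsState.restrictState {ω : quasiLocal d n →L[ℂ] ℂ} (hω : IsState ω) (Γ : Finset (Site d)) :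
    IsPosState (restrictState ω Γ) where
  one := by rw [restrictState_apply, map_one, hω.1]
  nonneg a := by
    rw [restrictState_apply, map_mul, map_star]
    exact hω.2 _

theorem finiteGroundState_eq {L : ℕ} {Γ : Finset (Site d)} (h : Γ ⊆ box d L) (B : ℝ)
    (a : LocalAlg n Γ) :
    finiteGroundState L B Γ a = groundState (hamiltonian d n L B) (embedHom h a) := by
  rw [finiteGroundState, dif_pos h, groundState_apply, embedHom_apply]

theorem box_mono {L M : ℕ} (h : L ≤ M) : box d L ⊆ box d M := by
  intro x hx
  rw [mem_box_iff] at hx ⊢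
  intro i
  have := hx i
  constructor <;> omega

theorem eventually_subset_box (Γ : Finset (Site d)) : ∀ᶠ L : ℕ in atTop, Γ ⊆ box d L := by
  have : ∀ x ∈ Γ, ∀ᶠ L : ℕ in atTop, x ∈ box d L := by
    intro x _
    have h : ∀ i, ∀ᶠ L : ℕ in atTop, -(L : ℤ) + 1 ≤ x i ∧ x i ≤ L := by
      intro i
      filter_upwards [eventually_ge_atTop ((x i).natAbs + 1)] with L hL
      constructor <;> omega
    filter_upwards [eventually_all.2 h] with L hL
    rw [mem_box_iff]
    exact hL
  filter_upwards [(Filter.eventually_all_finset Γ).2 this] with L hL x hx using hL x hx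

end LocalState

/-! ### Replacing a state inside a box by the ground state of the box -/

section Kraus

variable {ι : Type*} [Fintype ι] [DecidableEq ι]

/-- The matrix `|ψ⟩⟨i|`. -/
def ketBra (ψ : EuclideanSpace ℂ ι) (i : ι) : Matrix ι ι ℂ :=
  Matrix.of fun σ τ => if τ = i then ψ σ else 0

theorem sum_star_ketBra_mul {ψ : EuclideanSpace ℂ ι} (hψ : ‖ψ‖ = 1) :
    ∑ i, star (ketBra ψ i) * ketBra ψ i = 1 := by
  have h : ∑ σ, star (ψ σ) * ψ σ = 1 := by
    have := EuclideanSpace.norm_sq_eq ψ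
    rw [hψ] at this
    have h2 : ∀ σ, star (ψ σ) * ψ σ = ((‖ψ σ‖ ^ 2 : ℝ) : ℂ) := by
      intro σ
      rw [RCLike.star_def, mul_comm, Complex.mul_conj, Complex.normSq_eq_norm_sq]
    simp only [h2]
    rw [← Complex.ofReal_sum, ← this]
    simp
  ext a b
  rw [Matrix.sum_apply]
  simp only [Matrix.mul_apply, Matrix.star_apply, ketBra, Matrix.of_apply]
  by_cases hab : a = b
  · subst hab
    rw [Finset.sum_eq_single a]
    · simpa using h
    · intro i _ hi
      simp [hi.symm]
    · simp
  · rw [Matrix.one_apply_ne hab]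
    refine Finset.sum_eq_zero fun i _ => Finset.sum_eq_zero fun σ _ => ?_
    by_cases h1 : a = i
    · rw [if_neg (fun h2 : b = i => hab (h1.trans h2.symm)), mul_zero]
    · rw [if_neg h1, star_zero, zero_mul]

theorem mul_ketBra {H : Matrix ι ι ℂ} {ψ : EuclideanSpace ℂ ι} {E : ℂ}
    (hE : Matrix.toEuclideanLin H ψ = E • ψ) (i : ι) : H * ketBra ψ i = E • ketBra ψ i := by
  ext a b
  rw [Matrix.mul_apply, Matrix.smul_apply]
  simp only [ketBra, Matrix.of_apply]
  by_cases hb : b = i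
  · have := congrArg (fun v : EuclideanSpace ℂ ι => v a) hE
    simp only [hb, if_true]
    simpa [Matrix.toLpLin_apply, Matrix.mulVec, dotProduct] using this
  · simp [hb]

variable {d n : ℕ} {Γ Λ : Finset (Site d)}

/-- If `ψ` is an eigenvector of `H ∈ 𝔄_Γ` then a state of `𝔄_Λ` can be modified to a state which
agrees with `ψ` inside `Γ` and with the original state outside of `Γ`. -/
theorem exists_replaced_state (h : Γ ⊆ Λ) {ρ : LocalAlg n Λ →ₗ[ℂ] ℂ} (hρ : IsPosState ρ)
    {H : LocalAlg n Γ} {ψ : EuclideanSpace ℂ (Config n Γ)} (hψ : ‖ψ‖ = 1) {E : ℂ}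
    (hE : Matrix.toEuclideanLin H ψ = E • ψ) :
    ∃ ρ' : LocalAlg n Λ →ₗ[ℂ] ℂ, IsPosState ρ' ∧ ρ' (embedHom h H) = E ∧
      (∀ X, (∀ a, Commute (embedHom h a) X) → ρ' X = ρ X) ∧
      ∀ X, ∑ i, ρ (star (embedHom h (ketBra ψ i)) *
        (X * embedHom h (ketBra ψ i) - embedHom h (ketBra ψ i) * X)) = ρ' X - ρ X := by
  have h1 : ∑ i, star (embedHom h (ketBra ψ i)) * embedHom h (ketBra ψ i) = 1 := by
    simp only [← map_star, ← map_mul]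
    rw [← map_sum, sum_star_ketBra_mul hψ, map_one]
  -- The new state is X ↦ Σ_i ρ(V_i* X V_i) with V_i = |ψ⟩⟨i| ⊗ 1 and Σ V_i* V_i = 1. The last
  -- clause rewrites the energy change as a sum of terms ρ(V_i* [X, V_i]), the form in which the
  -- ground state condition is given.
  let ρ' : LocalAlg n Λ →ₗ[ℂ] ℂ := ∑ i, ρ ∘ₗ
    (LinearMap.mulLeft ℂ (star (embedHom h (ketBra ψ i)))) ∘ₗ
      (LinearMap.mulRight ℂ (embedHom h (ketBra ψ i)))
  have hρ' : ∀ X, ρ' X = ∑ i, ρ (star (embedHom h (ketBra ψ i)) * (X * embedHom h (ketBra ψ i))) := by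
    intro X
    simp [ρ', LinearMap.sum_apply]
  refine ⟨ρ', ⟨?_, ?_⟩, ?_, ?_, ?_⟩
  · rw [hρ']
    simp only [one_mul]
    rw [← map_sum, h1, hρ.one]
  · intro a
    rw [hρ']
    refine Finset.sum_nonneg fun i _ => ?_
    have := hρ.nonneg (a * embedHom h (ketBra ψ i))
    rwa [star_mul, mul_assoc, ← mul_assoc (star a)] at this
  · rw [hρ']
    simp only [← map_mul, mul_ketBra hE]
    simp only [map_smul, mul_smul_comm]
    rw [← Finset.smul_sum, ← map_sum, h1, hρ.one, smul_eq_mul, mul_one]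
  · intro X hX
    rw [hρ']
    simp only [← (hX _).eq, ← mul_assoc]
    rw [← map_sum, ← Finset.sum_mul, h1, one_mul]
  · intro X
    simp only [mul_sub, map_sub, Finset.sum_sub_distrib]
    rw [hρ']
    congr 1
    simp only [← mul_assoc]
    rw [← map_sum, ← Finset.sum_mul, h1, one_mul]

end Kraus

/-! ### Neighbours in the box -/

section Neighbours

variable {d : ℕ}

/-- Nearest neighbours in the lattice. -/
def LatticeAdj (x y : Site d) : Prop :=
  ∃ i, (∀ j, j ≠ i → x j = y j) ∧ (x i - y i = 1 ∨ y i - x i = 1)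

/-- The sites of the box which have neighbours outside of it. -/
def boundary (d L : ℕ) : Finset (Site d) :=
  (box d L).filter fun x => ∃ i, x i = -(L : ℤ) + 1 ∨ x i = L

theorem boundary_subset (d L : ℕ) : boundary d L ⊆ box d L := Finset.filter_subset _ _

theorem interior_of_notMem {L : ℕ} {x : Site d} (hx : x ∈ box d L) (h : x ∉ boundary d L) (i : Fin d) :
    -(L : ℤ) + 2 ≤ x i ∧ x i ≤ L - 1 := by
  rw [boundary, Finset.mem_filter, not_and, not_exists] at h
  have h1 := h hx i
  have h2 := mem_box_iff.1 hx i
  omega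

/-- From a site away from the faces no bond wraps around, so the neighbours do not depend on the
size M of the surrounding periodic box. -/
theorem periodicAdj_iff_latticeAdj {L M : ℕ} (h : L ≤ M) {x y : Site d}
    (hx : ∀ i, -(L : ℤ) + 2 ≤ x i ∧ x i ≤ L - 1) (hy : y ∈ box d M) :
    PeriodicAdj M x y ↔ LatticeAdj x y := by
  refine exists_congr fun i => and_congr_right fun _ => ?_
  have h1 := hx i
  have h2 := mem_box_iff.1 hy i
  constructor
  · rintro (⟨c, hc⟩ | ⟨c, hc⟩)
    · left
      have : c = 0 := by
        by_contra hne
        rcases lt_or_gt_of_ne hne with h | h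
        · nlinarith
        · nlinarith
      subst this; omega
    · right
      have : c = 0 := by
        by_contra hne
        rcases lt_or_gt_of_ne hne with h | h
        · nlinarith
        · nlinarith
      subst this; omega
  · rintro (hc | hc)
    · left; exact ⟨0, by omega⟩
    · right; exact ⟨0, by omega⟩

theorem LatticeAdj.mem_box {L : ℕ} {x y : Site d} (hx : ∀ i, -(L : ℤ) + 2 ≤ x i ∧ x i ≤ L - 1)
    (h : LatticeAdj x y) : y ∈ box d L := by
  obtain ⟨i, h1, h2⟩ := h
  rw [mem_box_iff]
  intro j
  have := hx j
  by_cases hj : j = i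
  · subst hj; omega
  · rw [← h1 j hj]; omega

open Classical in
theorem card_boxAdj_le {L : ℕ} (hL : 0 < L) (x : box d L) :
    (Finset.univ.filter fun y => BoxAdj d L x y).card ≤ 2 * d := by
  set z := boxEquiv d L hL x
  calc _ ≤ (Finset.univ.image fun p : Fin d × Bool => (boxEquiv d L hL).symm
          (Function.update z p.1 (if p.2 then z p.1 + 1 else z p.1 - 1))).card := by
        refine Finset.card_le_card fun y hy => ?_
        rw [Finset.mem_filter, BoxAdj, periodicAdj_iff hL] at hy
        obtain ⟨i, h1, h2⟩ := hy.2
        rw [Finset.mem_image]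
        rcases h2 with h2 | h2
        · refine ⟨(i, true), Finset.mem_univ _, ?_⟩
          rw [Equiv.symm_apply_eq, Function.update_eq_iff]
          exact ⟨by simp [h2, z], fun j hj => h1 j hj⟩
        · refine ⟨(i, false), Finset.mem_univ _, ?_⟩
          rw [Equiv.symm_apply_eq, Function.update_eq_iff]
          exact ⟨by simp [h2, z], fun j hj => h1 j hj⟩
    _ ≤ _ := Finset.card_image_le.trans (by simp [mul_comm])

theorem card_box (d L : ℕ) : (box d L).card = (2 * L) ^ d := by
  rw [box, Fintype.card_piFinset_const, Int.card_Icc, show ((L : ℤ) + 1 - (-(L : ℤ) + 1)).toNat = 2 * L by omega]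

/-- The boundary consists of 2d faces, each at most 1/(2L) of the box. -/
theorem card_boundary_mul_le (d L : ℕ) : (boundary d L).card * L ≤ d * (box d L).card := by
  classical
  have h1 : ∀ (i : Fin d) (c : ℤ), ((box d L).filter fun x => x i = c).card * (2 * L) ≤ (box d L).card := by
    intro i c
    have h2 : (box d L).filter (fun x => x i = c) ⊆
        Fintype.piFinset (Function.update (fun _ => Finset.Icc (-(L : ℤ) + 1) L) i {c}) := by
      intro x hx
      rw [Finset.mem_filter, mem_box_iff] at hx
      rw [Fintype.mem_piFinset]
      intro j
      by_cases hj : j = i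
      · subst hj; simp [hx.2]
      · rw [Function.update_of_ne hj, Finset.mem_Icc]; exact hx.1 j
    have h3 := Finset.card_le_card h2
    rw [Fintype.card_piFinset, ← Finset.mul_prod_erase _ _ (Finset.mem_univ i),
      Function.update_self, Finset.card_singleton, one_mul] at h3
    have h4 : ∏ j ∈ Finset.univ.erase i,
        (Function.update (fun _ => Finset.Icc (-(L : ℤ) + 1) (L : ℤ)) i {c} j).card =
        (2 * L) ^ (d - 1) := by
      rw [Finset.prod_congr rfl (g := fun _ => 2 * L), Finset.prod_const,
        Finset.card_erase_of_mem (Finset.mem_univ i), Finset.card_univ, Fintype.card_fin]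
      intro j hj
      rw [Function.update_of_ne (Finset.ne_of_mem_erase hj), Int.card_Icc]
      omega
    rw [h4] at h3
    have hd : d - 1 + 1 = d := by have := i.2; omega
    calc _ ≤ (2 * L) ^ (d - 1) * (2 * L) := Nat.mul_le_mul_right _ h3
      _ = _ := by rw [← pow_succ, hd, card_box]
  have h2 : boundary d L ⊆ Finset.univ.biUnion fun i : Fin d =>
      (box d L).filter (fun x => x i = -(L : ℤ) + 1) ∪ (box d L).filter (fun x => x i = L) := by
    intro x hx
    rw [boundary, Finset.mem_filter] at hx
    obtain ⟨i, hi⟩ := hx.2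
    rw [Finset.mem_biUnion]
    refine ⟨i, Finset.mem_univ _, ?_⟩
    rw [Finset.mem_union, Finset.mem_filter, Finset.mem_filter]
    exact hi.imp (fun h => ⟨hx.1, h⟩) (fun h => ⟨hx.1, h⟩)
  have h3 : (boundary d L).card ≤ ∑ i : Fin d, (((box d L).filter (fun x => x i = -(L : ℤ) + 1)).card +
      ((box d L).filter (fun x => x i = (L : ℤ))).card) :=
    (Finset.card_le_card h2).trans (Finset.card_biUnion_le.trans
      (Finset.sum_le_sum fun i _ => Finset.card_union_le _ _))
  have h4 : (boundary d L).card * (2 * L) ≤ d * (2 * (box d L).card) := by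
    calc _ ≤ _ := Nat.mul_le_mul_right _ h3
      _ = ∑ i : Fin d, (((box d L).filter (fun x => x i = -(L : ℤ) + 1)).card * (2 * L) +
      ((box d L).filter (fun x => x i = (L : ℤ))).card * (2 * L)) := by
          rw [Finset.sum_mul]; simp only [add_mul]
      _ ≤ ∑ i : Fin d, 2 * (box d L).card := Finset.sum_le_sum fun i _ => by
          have := h1 i (-(L : ℤ) + 1)
          have := h1 i L
          omega
      _ = _ := by simp
  nlinarith

end Neighbours

/-! ### Boundary estimate for the local energy -/

section Local

variable {d n : ℕ}

/-- The interaction of two spins. -/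
def bondOp {Λ : Finset (Site d)} (x y : Λ) : LocalAlg n Λ :=
  ∑ a, oneSite x (spinVec n a) * oneSite y (spinVec n a)

open scoped Matrix.Norms.L2Operator in
/-- A bound of the norm of the interaction. -/
def bondBound (n : ℕ) : ℝ := ∑ a, ‖spinVec n a‖ ^ 2

open scoped Matrix.Norms.L2Operator in
theorem bondBound_nonneg (n : ℕ) : 0 ≤ bondBound n := Finset.sum_nonneg fun _ _ => sq_nonneg _

open scoped Matrix.Norms.L2Operator in
theorem norm_bondOp_le {Λ : Finset (Site d)} (x y : Λ) : ‖bondOp (n := n) x y‖ ≤ bondBound n := by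
  refine (norm_sum_le _ _).trans (Finset.sum_le_sum fun a _ => ?_)
  refine (norm_mul_le _ _).trans ?_
  rw [sq]
  exact mul_le_mul (norm_oneSite_le _ _) (norm_oneSite_le _ _) (norm_nonneg _) (norm_nonneg _)

open Classical in
theorem map_hamiltonian {B : Type*} [AddCommGroup B] [Module ℂ B] (L : ℕ) (b : ℝ)
    (φ : LocalAlg n (box d L) →ₗ[ℂ] B) :
    φ (hamiltonian d n L b) = (1 / 2 : ℂ) • (∑ x, ∑ y, if BoxAdj d L x y then φ (bondOp x y) else 0) -
      ∑ x : box d L, (b * stagger (x : Site d) : ℂ) • φ (oneSite x (spinVec n 2)) := by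
  have hr : ∀ (r : ℝ) a, φ (r • a) = (r : ℂ) • φ a := by
    intro r a
    rw [← Complex.coe_smul, map_smul]
  have hite : ∀ (p : Prop) [Decidable p] (a : LocalAlg n (box d L)),
      φ (if p then a else 0) = if p then φ a else 0 := by
    intro p _ a; split_ifs <;> simp
  rw [hamiltonian_eq, afHam, map_sub, hr]
  simp only [map_sum φ, hite, hr, bondOp]
  push_cast
  rfl

theorem sum_inclusion {Γ Λ : Finset (Site d)} (h : Γ ⊆ Λ) {M : Type*} [AddCommMonoid M]
    (f : Λ → M) : ∑ x : Γ, f ⟨x, h x.2⟩ = ∑ x : Λ, if (x : Site d) ∈ Γ then f x else 0 := by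
  classical
  rw [← Finset.sum_filter]
  refine Finset.sum_bij (fun x _ => ⟨x, h x.2⟩) ?_ ?_ ?_ ?_
  · intro x _; simp
  · intro x _ y _ hxy; exact Subtype.ext (congrArg (fun z : Λ => (z : Site d)) hxy)
  · intro y hy; exact ⟨⟨y, (Finset.mem_filter.1 hy).2⟩, Finset.mem_univ _, rfl⟩
  · intro x _; rfl

theorem commute_obs {Γ Γ' : Finset (Site d)} (h : Disjoint Γ Γ') (a : LocalAlg n Γ)
    (b : LocalAlg n Γ') : Commute (obs n Γ a) (obs n Γ' b) := by
  refine Subtype.ext ?_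
  change actCLM Γ a * actCLM Γ' b = actCLM Γ' b * actCLM Γ a
  have h1 : ∀ (σ : Site d → Fin (n + 1)) (τ : Config n Γ),
      Γ'.restrict (Function.updateFinset σ Γ τ) = Γ'.restrict σ := by
    intro σ τ
    ext x
    have : (x : Site d) ∉ Γ := fun hx => Finset.disjoint_left.1 h hx x.2
    simp [Function.updateFinset, this]
  have h2 : ∀ (σ : Site d → Fin (n + 1)) (τ : Config n Γ'),
      Γ.restrict (Function.updateFinset σ Γ' τ) = Γ.restrict σ := by
    intro σ τ
    ext x
    have : (x : Site d) ∉ Γ' := fun hx => Finset.disjoint_left.1 h x.2 hx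
    simp [Function.updateFinset, this]
  have h3 : ∀ (σ : Site d → Fin (n + 1)) (τ : Config n Γ) (τ' : Config n Γ'),
      Function.updateFinset (Function.updateFinset σ Γ τ) Γ' τ' =
        Function.updateFinset (Function.updateFinset σ Γ' τ') Γ τ := by
    intro σ τ τ'
    ext x
    by_cases hx : x ∈ Γ
    · have : x ∉ Γ' := fun hx' => Finset.disjoint_left.1 h hx hx'
      simp [Function.updateFinset, hx, this]
    · simp [Function.updateFinset, hx]
  ext f σ
  simp only [mul_apply_eq_comp, actCLM_apply, h1, h2, h3, Finset.mul_sum]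
  rw [Finset.sum_comm]
  exact Finset.sum_congr rfl fun _ _ => Finset.sum_congr rfl fun _ _ => mul_left_comm _ _ _

theorem commute_embedHom_oneSite {Γ Λ : Finset (Site d)} (h : Γ ⊆ Λ) {x : Λ} (hx : (x : Site d) ∉ Γ)
    (M : Matrix (Fin (n + 1)) (Fin (n + 1)) ℂ) (a : LocalAlg n Γ) :
    Commute (embedHom h a) (oneSite x M) := by
  refine obs_injective ?_
  rw [map_mul, map_mul, obs_embedHom, obs_oneSite]
  exact commute_obs (Finset.disjoint_singleton_right.2 hx) _ _

-- A site has at most 2d neighbours for each of the two periodic structures, and a bond is counted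
-- from either end.
open Classical in
theorem boundary_sum_le {L M : ℕ} (hL : 0 < L) (h : L ≤ M) :
    ∑ x : box d M, ∑ y : box d M, ((if (x : Site d) ∈ boundary d L then 1 else 0) +
      (if (y : Site d) ∈ boundary d L then 1 else 0)) * ((if BoxAdj d M x y then 1 else 0) +
        (if (x : Site d) ∈ box d L ∧ (y : Site d) ∈ box d L ∧ PeriodicAdj L (x : Site d) y then 1 else 0)) ≤
      (8 * d * (boundary d L).card : ℝ) := by
  set A : box d M → box d M → ℝ := fun x y => (if BoxAdj d M x y then 1 else 0) +
        (if (x : Site d) ∈ box d L ∧ (y : Site d) ∈ box d L ∧ PeriodicAdj L (x : Site d) y then 1 else 0) with hA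
  have hsymm : ∀ x y, A x y = A y x := by
    intro x y
    have h1 : BoxAdj d M x y ↔ BoxAdj d M y x := ⟨fun h => h.symm, fun h => h.symm⟩
    have h2 : PeriodicAdj L (x : Site d) y ↔ PeriodicAdj L (y : Site d) x :=
      ⟨fun h => h.symm, fun h => h.symm⟩
    simp only [hA, h1, h2, and_left_comm]
  have hA1 : ∀ x, ∑ y, A x y ≤ 4 * d := by
    intro x
    rw [hA]
    simp only [Finset.sum_add_distrib]
    have h1 : (∑ y, if BoxAdj d M x y then (1 : ℝ) else 0) ≤ 2 * d := by
      rw [Finset.sum_boole]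
      exact_mod_cast card_boxAdj_le (hL.trans_le h) x
    have h2 : (∑ y : box d M, if (x : Site d) ∈ box d L ∧ (y : Site d) ∈ box d L ∧
        PeriodicAdj L (x : Site d) y then (1 : ℝ) else 0) ≤ 2 * d := by
      by_cases hx : (x : Site d) ∈ box d L
      · have := sum_inclusion (box_mono h)
          (fun y : box d M => if PeriodicAdj L (x : Site d) y then (1 : ℝ) else 0)
        simp only [hx, true_and, ite_and]
        rw [← this]
        have h3 := card_boxAdj_le hL (⟨x, hx⟩ : box d L)
        rw [Finset.sum_boole]
        exact_mod_cast h3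
      · simp [hx]
    linarith
  have h1 : ∑ x : box d M, ∑ y : box d M, (if (x : Site d) ∈ boundary d L then 1 else 0) * A x y ≤
      (boundary d L).card * (4 * d : ℝ) := by
    simp only [← Finset.mul_sum]
    calc _ ≤ ∑ x : box d M, (if (x : Site d) ∈ boundary d L then 1 else 0) * (4 * d : ℝ) :=
          Finset.sum_le_sum fun x _ => mul_le_mul_of_nonneg_left (hA1 x) (by split_ifs <;> norm_num)
      _ = _ := by
          rw [← Finset.sum_mul]
          congr 1
          have := sum_inclusion ((boundary_subset d L).trans (box_mono h))
            (fun _ => (1 : ℝ))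
          rw [← this]
          simp
  have h2 : ∑ x : box d M, ∑ y : box d M, (if (y : Site d) ∈ boundary d L then 1 else 0) * A x y =
      ∑ x : box d M, ∑ y : box d M, (if (x : Site d) ∈ boundary d L then 1 else 0) * A x y := by
    rw [Finset.sum_comm]
    simp only [hsymm]
  have h3 : ∀ x y : box d M, ((if (x : Site d) ∈ boundary d L then 1 else 0) +
      (if (y : Site d) ∈ boundary d L then 1 else 0)) * A x y =
      (if (x : Site d) ∈ boundary d L then 1 else 0) * A x y +
      (if (y : Site d) ∈ boundary d L then 1 else 0) * A x y := fun x y => add_mul _ _ _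
  change ∑ x : box d M, ∑ y : box d M, ((if (x : Site d) ∈ boundary d L then 1 else 0) +
      (if (y : Site d) ∈ boundary d L then 1 else 0)) * A x y ≤ _
  simp only [h3, Finset.sum_add_distrib]
  rw [h2]
  linarith

/-- The error made when the state in a box is replaced by the ground state of the box. -/
def surfaceError (d n L : ℕ) : ℝ := 8 * d * bondBound n * (boundary d L).card

/-- The left side is the change of the large-box energy when ρ is replaced inside the small box by
ψ. Up to surface bonds it equals the change of the small-box energy, which falls to the minimum.
Positivity of the left side thus makes ρ nearly minimal in the small box. -/
theorem local_energy_le {L M : ℕ} (hL : 0 < L) (h : L ≤ M) (B : ℝ)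
    {ψ : EuclideanSpace ℂ (Config n (box d L))} (hψ : ‖ψ‖ = 1)
    (hE : Matrix.toEuclideanLin (hamiltonian d n L B) ψ =
      (groundEnergy (hamiltonian d n L B) : ℂ) • ψ)
    {ρ : LocalAlg n (box d M) →ₗ[ℂ] ℂ} (hρ : IsPosState ρ) :
    (∑ i, ρ (star (embedHom (box_mono h) (ketBra ψ i)) *
        (hamiltonian d n M B * embedHom (box_mono h) (ketBra ψ i) -
          embedHom (box_mono h) (ketBra ψ i) * hamiltonian d n M B))).re ≤
      groundEnergy (hamiltonian d n L B) - (ρ (embedHom (box_mono h) (hamiltonian d n L B))).re +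
        surfaceError d n L := by
  classical
  obtain ⟨ρ', hρ', h1, h2, h3⟩ := exists_replaced_state (box_mono h) hρ hψ hE
  rw [h3]
  -- D is the change of an expectation under the replacement; it vanishes on observables supported
  -- outside the small box.
  set D : LocalAlg n (box d M) →ₗ[ℂ] ℂ := ρ' - ρ with hD
  set ε : LocalAlg n (box d L) →ₗ[ℂ] LocalAlg n (box d M) :=
    (embedHom (n := n) (box_mono (d := d) h)).toAlgHom.toLinearMap with hε
  have hεa : ∀ a, ε a = embedHom (box_mono h) a := fun a => rfl
  have hDe : D (embedHom (box_mono h) (hamiltonian d n L B)) =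
      groundEnergy (hamiltonian d n L B) - ρ (embedHom (box_mono h) (hamiltonian d n L B)) := by
    rw [hD, LinearMap.sub_apply, h1]
  have hbond : ∀ x y, ‖D (bondOp x y)‖ ≤ 2 * bondBound n := by
    intro x y
    rw [hD, LinearMap.sub_apply]
    have e1 := (hρ'.norm_le _).trans (norm_bondOp_le (n := n) x y)
    have e2 := (hρ.norm_le _).trans (norm_bondOp_le (n := n) x y)
    linarith [norm_sub_le (ρ' (bondOp x y)) (ρ (bondOp x y))]
  have hD1 : ∀ x : box d M, (x : Site d) ∉ box d L → D (oneSite x (spinVec n 2)) = 0 := by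
    intro x hx
    rw [hD, LinearMap.sub_apply, h2 _ (commute_embedHom_oneSite _ hx _), sub_self]
  have hD2 : ∀ x y : box d M, (x : Site d) ∉ box d L → (y : Site d) ∉ box d L →
      D (bondOp x y) = 0 := by
    intro x y hx hy
    rw [hD, LinearMap.sub_apply, h2, sub_self]
    intro a
    refine Commute.sum_right _ _ _ fun c _ => ?_
    exact (commute_embedHom_oneSite _ hx _ _).mul_right (commute_embedHom_oneSite _ hy _ _)
  have hadj : ∀ x y : box d M, (x : Site d) ∈ box d L → (x : Site d) ∉ boundary d L →
      (BoxAdj d M x y ↔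
        ((x : Site d) ∈ box d L ∧ (y : Site d) ∈ box d L ∧ PeriodicAdj L (x : Site d) y)) := by
    intro x y hx hxb
    have hi := interior_of_notMem hx hxb
    rw [BoxAdj, periodicAdj_iff_latticeAdj h hi y.2]
    constructor
    · intro hxy
      have hy := hxy.mem_box hi
      exact ⟨hx, hy, (periodicAdj_iff_latticeAdj le_rfl hi hy).2 hxy⟩
    · rintro ⟨-, hy, hxy⟩
      exact (periodicAdj_iff_latticeAdj le_rfl hi hy).1 hxy
  -- The one-site terms cancel. What remains compares the bonds of the large box with those of the
  -- small periodic box.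
  have key : D (hamiltonian d n M B) - D (embedHom (box_mono h) (hamiltonian d n L B)) =
      (1 / 2 : ℂ) * ∑ x : box d M, ∑ y : box d M, ((if BoxAdj d M x y then 1 else 0) -
        (if (x : Site d) ∈ box d L ∧ (y : Site d) ∈ box d L ∧ PeriodicAdj L (x : Site d) y
          then 1 else 0)) * D (bondOp x y) := by
    have e1 := map_hamiltonian (n := n) L B (D ∘ₗ ε)
    have e2 := map_hamiltonian (n := n) M B D
    have e3 : ∀ x : box d L, (D ∘ₗ ε) (oneSite x (spinVec n 2)) =
        D (oneSite (⟨x, box_mono h x.2⟩ : box d M) (spinVec n 2)) := by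
      intro x
      rw [LinearMap.comp_apply, hεa, embedHom_oneSite]
    have e4 : ∀ x y : box d L, (D ∘ₗ ε) (bondOp x y) =
        D (bondOp (⟨x, box_mono h x.2⟩ : box d M) ⟨y, box_mono h y.2⟩) := by
      intro x y
      rw [LinearMap.comp_apply, hεa, bondOp, map_sum]
      simp only [map_mul, embedHom_oneSite]
      rfl
    simp only [e3, e4] at e1
    rw [LinearMap.comp_apply, hεa] at e1
    rw [sum_inclusion (box_mono h) (fun x : box d M =>
      (B * stagger (x : Site d) : ℂ) • D (oneSite x (spinVec n 2)))] at e1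
    have e5 : ∀ x : box d L, (∑ y : box d L, if BoxAdj d L x y then
        D (bondOp (⟨x, box_mono h x.2⟩ : box d M) ⟨y, box_mono h y.2⟩) else 0) =
        ∑ y : box d M, if (y : Site d) ∈ box d L then if PeriodicAdj L (x : Site d) y then
        D (bondOp (⟨x, box_mono h x.2⟩ : box d M) y) else 0 else 0 := by
      intro x
      exact sum_inclusion (box_mono h) (fun y : box d M => if PeriodicAdj L (x : Site d) y then
        D (bondOp (⟨x, box_mono h x.2⟩ : box d M) y) else 0)
    simp only [e5] at e1
    rw [sum_inclusion (box_mono h) (fun x : box d M => ∑ y : box d M, if (y : Site d) ∈ box d L then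
      if PeriodicAdj L (x : Site d) y then D (bondOp x y) else 0 else 0)] at e1
    have e6 : ∑ x : box d M, (B * stagger (x : Site d) : ℂ) • D (oneSite x (spinVec n 2)) =
        ∑ x : box d M, if (x : Site d) ∈ box d L then
          (B * stagger (x : Site d) : ℂ) • D (oneSite x (spinVec n 2)) else 0 := by
      refine Finset.sum_congr rfl fun x _ => ?_
      split_ifs with hx
      · rfl
      · rw [hD1 x hx, smul_zero]
    rw [e1, e2, e6, sub_sub_sub_cancel_right, ← smul_sub, smul_eq_mul, ← Finset.sum_sub_distrib]
    congr 1
    refine Finset.sum_congr rfl fun x _ => ?_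
    by_cases hx : (x : Site d) ∈ box d L
    · rw [if_pos hx, ← Finset.sum_sub_distrib]
      refine Finset.sum_congr rfl fun y _ => ?_
      simp only [hx, true_and, ite_and, sub_mul, ite_mul, one_mul, zero_mul]
    · rw [if_neg hx, sub_zero]
      refine Finset.sum_congr rfl fun y _ => ?_
      simp only [hx, false_and, if_false, sub_zero, ite_mul, one_mul, zero_mul]
  have hle : ‖D (hamiltonian d n M B) - D (embedHom (box_mono h) (hamiltonian d n L B))‖ ≤
      surfaceError d n L := by
    rw [key, norm_mul]
    have e0 : ‖(1 / 2 : ℂ)‖ = 1 / 2 := by norm_num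
    rw [e0]
    -- The two bond sets agree at interior sites of the small box, and D kills bonds lying wholly
    -- outside it. So only bonds with an end in the boundary contribute.
    have e1 : ∀ x y : box d M, ‖((if BoxAdj d M x y then 1 else 0) -
        (if (x : Site d) ∈ box d L ∧ (y : Site d) ∈ box d L ∧ PeriodicAdj L (x : Site d) y
          then 1 else 0)) * D (bondOp x y)‖ ≤
        ((if (x : Site d) ∈ boundary d L then 1 else 0) +
      (if (y : Site d) ∈ boundary d L then 1 else 0)) * ((if BoxAdj d M x y then 1 else 0) +
        (if (x : Site d) ∈ box d L ∧ (y : Site d) ∈ box d L ∧ PeriodicAdj L (x : Site d) y then 1 else 0)) * (2 * bondBound n) := by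
      intro x y
      by_cases hb : (x : Site d) ∈ boundary d L ∨ (y : Site d) ∈ boundary d L
      · have hone : (1 : ℝ) ≤ (if (x : Site d) ∈ boundary d L then 1 else 0) +
            (if (y : Site d) ∈ boundary d L then 1 else 0) := by
          rcases hb with hb | hb <;> simp only [hb, if_true] <;> split_ifs <;> norm_num
        rw [norm_mul]
        refine mul_le_mul ?_ (hbond x y) (norm_nonneg _) ?_
        · refine le_trans ?_ (le_mul_of_one_le_left ?_ hone)
          · refine (norm_sub_le _ _).trans (add_le_add ?_ ?_) <;> split_ifs <;> simp
          · refine add_nonneg ?_ ?_ <;> split_ifs <;> norm_num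
        · refine mul_nonneg (zero_le_one.trans hone) (add_nonneg ?_ ?_) <;> split_ifs <;> norm_num
      · rw [not_or] at hb
        have hz : ((if BoxAdj d M x y then 1 else 0) -
            (if (x : Site d) ∈ box d L ∧ (y : Site d) ∈ box d L ∧ PeriodicAdj L (x : Site d) y
              then 1 else 0)) * D (bondOp x y) = 0 := by
          by_cases hx : (x : Site d) ∈ box d L
          · rw [mul_eq_zero]; left
            rw [sub_eq_zero]
            exact if_congr (hadj x y hx hb.1) rfl rfl
          · by_cases hy : (y : Site d) ∈ box d L
            · rw [mul_eq_zero]; left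
              rw [sub_eq_zero]
              refine if_congr ?_ rfl rfl
              have := hadj y x hy hb.2
              constructor
              · intro hxy
                obtain ⟨e1, e2, e3⟩ := this.1 hxy.symm
                exact ⟨e2, e1, e3.symm⟩
              · rintro ⟨e1, e2, e3⟩
                exact (this.2 ⟨e2, e1, e3.symm⟩).symm
            · rw [hD2 x y hx hy, mul_zero]
        rw [hz, norm_zero]
        refine mul_nonneg (mul_nonneg (add_nonneg ?_ ?_) (add_nonneg ?_ ?_))
          (mul_nonneg zero_le_two (bondBound_nonneg n)) <;> split_ifs <;> norm_num
    have e2 := (norm_sum_le Finset.univ _).trans (Finset.sum_le_sum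
      fun (x : box d M) (_ : x ∈ Finset.univ) => (norm_sum_le Finset.univ _).trans
        (Finset.sum_le_sum fun (y : box d M) (_ : y ∈ Finset.univ) => e1 x y))
    simp only [← Finset.sum_mul] at e2
    have e3 := mul_le_mul_of_nonneg_right (boundary_sum_le (d := d) hL h)
      (mul_nonneg zero_le_two (bondBound_nonneg n))
    rw [surfaceError]
    linarith
  have hre := (Complex.re_le_norm _).trans hle
  rw [hDe] at hre
  simp only [hD, LinearMap.sub_apply, Complex.sub_re, Complex.ofReal_re] at hre ⊢
  linarith

end Local

/-! ### The staggered magnetization of the zero-field limit -/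

section Magnetization

variable {d n : ℕ}

/-- The finite-volume inequality a*[H, a] ≥ 0 with a = |ψ⟩⟨i| bounds the energy in the larger boxes,
and the bound passes to the limit since the surface error depends only on L. -/
theorem IsFieldGroundState.energy_le {B : ℝ} {ω : quasiLocal d n →L[ℂ] ℂ}
    (hω : IsFieldGroundState B ω) {L : ℕ} (hL : 0 < L) :
    (ω (obs n (box d L) (hamiltonian d n L B))).re ≤
      groundEnergy (hamiltonian d n L B) + surfaceError d n L := by
  obtain ⟨-, M, hM, hlim⟩ := hω
  obtain ⟨ψ, hψ, hE⟩ := exists_groundVector (hamiltonian_isHermitian d n L B)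
  refine le_of_tendsto ((Complex.continuous_re.tendsto _).comp
    (hlim (box d L) (hamiltonian d n L B))) ?_
  filter_upwards [hM.eventually_ge_atTop L] with k hk
  have hH := hamiltonian_isHermitian d n (M k) B
  rw [Function.comp_apply, finiteGroundState_eq (box_mono hk)]
  have h1 := local_energy_le hL hk B hψ hE (groundState_isPosState hH)
  rw [Complex.re_sum] at h1
  have h2 := Finset.sum_nonneg fun (i : Config n (box d L)) (_ : i ∈ Finset.univ) =>
    groundState_commutator_nonneg hH (embedHom (box_mono hk) (ketBra ψ i))
  linarith

/-- The same estimate, where the defining condition of ω takes the place of the finite-volume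
inequality. -/
theorem IsGroundState.energy_le {ω : quasiLocal d n →L[ℂ] ℂ}
    (hω : IsGroundState ω) {L : ℕ} (hL : 0 < L) :
    (ω (obs n (box d L) (heisenberg d n L))).re ≤
      groundEnergy (hamiltonian d n L 0) + surfaceError d n L := by
  obtain ⟨hst, hlim⟩ := hω
  obtain ⟨ψ, hψ, hE⟩ := exists_groundVector (hamiltonian_isHermitian d n L 0)
  choose r hr hrlim using fun i => hlim (box d L) (ketBra ψ i)
  have h1 := tendsto_finsetSum Finset.univ fun i _ => hrlim i
  have h2 : 0 ≤ groundEnergy (hamiltonian d n L 0) + surfaceError d n L -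
      (ω (obs n (box d L) (heisenberg d n L))).re := by
    have h3 : (0 : ℝ) ≤ (∑ i, (r i : ℂ)).re := by
      rw [Complex.re_sum]
      exact Finset.sum_nonneg fun i _ => hr i
    refine h3.trans (le_of_tendsto ((Complex.continuous_re.tendsto _).comp h1) ?_)
    filter_upwards [eventually_ge_atTop L] with M hM
    have h4 := local_energy_le hL hM 0 hψ hE (hst.restrictState (box d M))
    simp only [restrictState_apply, map_mul, map_star, map_sub, obs_embedHom, hamiltonian_zero] at h4
    rw [Function.comp_apply]
    simp only [Ring.lie_def, hamiltonian_zero]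
    linarith
  linarith

theorem re_hamiltonian (ω : quasiLocal d n →L[ℂ] ℂ) (L : ℕ) (B : ℝ) :
    (ω (obs n (box d L) (hamiltonian d n L B))).re =
      (ω (obs n (box d L) (heisenberg d n L))).re -
        B * (ω (obs n (box d L) (orderParam d n L))).re := by
  rw [hamiltonian, map_sub, map_sub, map_smul, map_smul, smul_eq_mul, Complex.sub_re,
    Complex.re_ofReal_mul]

theorem IsState.groundEnergy_le {ω : quasiLocal d n →L[ℂ] ℂ} (hω : IsState ω) (L : ℕ) (B : ℝ) :
    groundEnergy (hamiltonian d n L B) ≤ (ω (obs n (box d L) (heisenberg d n L))).re -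
      B * (ω (obs n (box d L) (orderParam d n L))).re := by
  have := groundEnergy_le_re (hamiltonian_isHermitian d n L B) (hω.restrictState (box d L))
  rwa [restrictState_apply, re_hamiltonian] at this

/-- The order parameter in the field is at least the order parameter in any ground state at zero
field, up to a surface term. -/
theorem order_le {B : ℝ} {ω ω' : quasiLocal d n →L[ℂ] ℂ} (hω : IsGroundState ω)
    (hω' : IsFieldGroundState B ω') {L : ℕ} (hL : 0 < L) :
    B * |(ω (obs n (box d L) (orderParam d n L))).re| ≤
      B * (ω' (obs n (box d L) (orderParam d n L))).re + 2 * surfaceError d n L := by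
  -- Each state is a trial state for the other Hamiltonian, and each is minimal for its own up to a
  -- surface error. Using ω also for the field -B, of equal energy, gives the absolute value.
  have h1 := hω.energy_le hL
  have h2 := hω'.energy_le hL
  have h3 := hω'.1.groundEnergy_le L 0
  have h4 := hω.1.groundEnergy_le L B
  have h5 := hω.1.groundEnergy_le L (-B)
  rw [groundEnergy_neg_field] at h5
  rw [re_hamiltonian] at h2
  rw [zero_mul, sub_zero] at h3
  rcases abs_cases (ω (obs n (box d L) (orderParam d n L))).re with ⟨h, -⟩ | ⟨h, -⟩ <;> rw [h] <;>
    linarith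

theorem obs_orderParam (L : ℕ) : obs n (box d L) (orderParam d n L) =
    ∑ x : box d L, (stagger (x : Site d) : ℂ) • siteObs n (x : Site d) (spin3 n) := by
  rw [orderParam_eq, map_sum]
  refine Finset.sum_congr rfl fun x _ => ?_
  rw [← Complex.coe_smul, map_smul, obs_oneSite]
  rfl

theorem boxShift_apply {L : ℕ} (hL : 0 < L) (i : Fin d) (x : box d L) (hx : (x : Site d) + Pi.single i 1 ∈ box d L) :
    boxShift hL i x = ⟨(x : Site d) + Pi.single i 1, hx⟩ := by
  rw [boxShift, Equiv.trans_apply, Equiv.trans_apply, Equiv.symm_apply_eq]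
  ext j
  change boxEquiv d L hL x j + (Pi.single i 1 : Torus d L) j =
    (((x : Site d) j + (Pi.single i 1 : Site d) j : ℤ) : ZMod (2 * L))
  rw [boxEquiv_apply]
  by_cases hj : j = i
  · subst hj; simp
  · simp [hj]

/-- The staggered magnetization at a site. -/
def staggeredMag (ω : quasiLocal d n →L[ℂ] ℂ) (x : Site d) : ℂ :=
  stagger x * ω (siteObs n x (spin3 n))

/-- In a large enough periodic box the step from x does not wrap around, so the finite-volume
invariance survives the limit. -/
theorem IsFieldGroundState.staggeredMag_add_single {B : ℝ} {ω : quasiLocal d n →L[ℂ] ℂ}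
    (hω : IsFieldGroundState B ω) (x : Site d) (i : Fin d) :
    staggeredMag ω (x + Pi.single i 1) = staggeredMag ω x := by
  obtain ⟨-, M, hM, hlim⟩ := hω
  have hl : ∀ y : Site d, Tendsto (fun k => (stagger y : ℂ) * finiteGroundState (M k) B {y}
      (oneSite ⟨y, Finset.mem_singleton_self y⟩ (spin3 n))) atTop (𝓝 (staggeredMag ω y)) :=
    fun y => (hlim {y} _).const_mul _
  refine tendsto_nhds_unique (hl _) ((hl x).congr' ?_)
  filter_upwards [hM.eventually (eventually_subset_box {x}),
    hM.eventually (eventually_subset_box {x + Pi.single i 1}), hM.eventually_gt_atTop 0]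
    with k h1 h2 h3
  have h1' := Finset.singleton_subset_iff.1 h1
  have h2' := Finset.singleton_subset_iff.1 h2
  have := groundState_stagger_shift (n := n) h3 i B ⟨x, h1'⟩
  rw [boxShift_apply h3 i ⟨x, h1'⟩ h2'] at this
  rw [finiteGroundState_eq h1, finiteGroundState_eq h2, embedHom_oneSite, embedHom_oneSite]
  simpa [← Complex.coe_smul] using this.symm

theorem eq_of_forall_add_single {α : Type*} {f : Site d → α}
    (h : ∀ x i, f (x + Pi.single i 1) = f x) (x y : Site d) : f x = f y := by
  have h1 : ∀ i, Function.Periodic f (Pi.single i (1 : ℤ)) := fun i x => h x i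
  have h2 : ∀ (v : Site d) (s : Finset (Fin d)),
      Function.Periodic f (∑ i ∈ s, v i • Pi.single i (1 : ℤ)) := by
    classical
    intro v s
    induction s using Finset.induction_on with
    | empty => intro x; simp
    | insert i s hi ih =>
      rw [Finset.sum_insert hi]
      exact ((h1 i).zsmul _).add_period ih
  have h3 := h2 (x - y) Finset.univ y
  have h4 : ∑ i, (x - y) i • (Pi.single i (1 : ℤ) : Site d) = x - y := by
    ext j
    simp [Finset.sum_apply, Pi.single_apply]
  rw [h4] at h3
  rw [← h3]
  congr 1
  abel

/-- If the density of the order parameter were eventually below every δ in absolute value it would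
tend to 0, and so would its limsup. The absolute value allows for a negative magnetization, and the
bound is only along infinitely many boxes. -/
theorem exists_frequently_order {ω : quasiLocal d n →L[ℂ] ℂ} (hω : magnetization ω ≠ 0) :
    ∃ δ : ℝ, 0 < δ ∧ ∃ᶠ L : ℕ in atTop,
      δ * (box d L).card ≤ |(ω (obs n (box d L) (orderParam d n L))).re| := by
  by_contra! hcon
  apply hω
  refine Tendsto.limsup_eq ?_
  rw [Metric.tendsto_atTop]
  intro ε hε
  have h1 := hcon ε hε
  obtain ⟨N, hN⟩ := eventually_atTop.1 (h1.and (eventually_gt_atTop 0))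
  refine ⟨N, fun L hL => ?_⟩
  obtain ⟨h2, h3⟩ := hN L hL
  have h4 : (0 : ℝ) < (box d L).card := by
    rw [card_box]; positivity
  rw [Real.dist_eq, sub_zero, abs_div, abs_of_pos h4, div_lt_iff₀ h4]
  exact h2

/-- With m the site-independent magnetization of ω', `order_le` reads B(δ - m)|Λ| ≤ surface terms,
for infinitely many boxes. The surface terms are O(|Λ|/L), so δ ≤ m. Here B is fixed while L grows,
which is why δ does not depend on B. -/
theorem IsFieldGroundState.le_staggeredMag {B δ : ℝ} (hB : 0 < B) {ω ω' : quasiLocal d n →L[ℂ] ℂ}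
    (hω : IsGroundState ω) (hω' : IsFieldGroundState B ω')
    (hδ : ∃ᶠ L : ℕ in atTop,
      δ * (box d L).card ≤ |(ω (obs n (box d L) (orderParam d n L))).re|) (x : Site d) :
    δ ≤ (staggeredMag ω' x).re := by
  by_contra! hlt
  set m := (staggeredMag ω' x).re with hm
  have h1 : ∀ L, (ω' (obs n (box d L) (orderParam d n L))).re = (box d L).card * m := by
    intro L
    rw [obs_orderParam, map_sum, Complex.re_sum]
    have : ∀ y : box d L, (ω' ((stagger (y : Site d) : ℂ) • siteObs n (y : Site d) (spin3 n))).re = m := by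
      intro y
      rw [map_smul, smul_eq_mul, hm,
        eq_of_forall_add_single hω'.staggeredMag_add_single x y]
      rfl
    rw [Finset.sum_congr rfl fun y _ => this y]
    simp
  have h2 : ∃ᶠ L : ℕ in atTop, B * (δ - m) * L ≤ 16 * d ^ 2 * bondBound n := by
    refine (hδ.and_eventually (eventually_gt_atTop 0)).mono fun L hL => ?_
    have h3 := order_le hω hω' hL.2
    rw [h1] at h3
    have h4 : (0 : ℝ) < (box d L).card := by
      have := hL.2
      rw [card_box]; positivity
    have h5 : ((boundary d L).card * L : ℝ) ≤ d * (box d L).card := by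
      exact_mod_cast card_boundary_mul_le d L
    have h6 := mul_le_mul_of_nonneg_left hL.1 hB.le
    rw [surfaceError] at h3
    have h7 : B * (δ - m) * (box d L).card ≤ 16 * d * bondBound n * (boundary d L).card := by
      linarith
    have hL0 : (0 : ℝ) ≤ L := Nat.cast_nonneg L
    have h8 := mul_le_mul_of_nonneg_right h7 hL0
    have h9 := mul_le_mul_of_nonneg_left h5
      (mul_nonneg (by positivity : (0 : ℝ) ≤ 16 * d) (bondBound_nonneg n))
    refine le_of_mul_le_mul_right ?_ h4
    nlinarith
  have h3 : Tendsto (fun L : ℕ => B * (δ - m) * L) atTop atTop :=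
    tendsto_natCast_atTop_atTop.const_mul_atTop (mul_pos hB (sub_pos.2 hlt))
  exact h2 ((h3.eventually_gt_atTop _).mono fun L hL => not_le.2 hL)

theorem IsZeroFieldLimit.isState {ω₀ : quasiLocal d n →L[ℂ] ℂ} (hω₀ : IsZeroFieldLimit ω₀) :
    IsState ω₀ := by
  obtain ⟨B, ω, -, -, h, hlim⟩ := hω₀
  refine ⟨tendsto_nhds_unique (hlim 1) ?_, fun a => ge_of_tendsto' (hlim _) fun k => (h k).1.2 a⟩
  simp only [(h _).1.1]
  exact tendsto_const_nhds

/-- Long range order in some ground state implies spontaneous magnetization in the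
zero-field limit. -/
theorem IsZeroFieldLimit.exists_le_staggeredMag {ω₀ : quasiLocal d n →L[ℂ] ℂ}
    (hω₀ : IsZeroFieldLimit ω₀)
    (hmag : ∃ ω : quasiLocal d n →L[ℂ] ℂ, IsGroundState ω ∧ magnetization ω ≠ 0) :
    ∃ δ : ℝ, 0 < δ ∧ ∀ x, δ ≤ (staggeredMag ω₀ x).re := by
  obtain ⟨ω, hω, hne⟩ := hmag
  obtain ⟨δ, hδ, hfreq⟩ := exists_frequently_order hne
  obtain ⟨B, ω', hB, -, h, hlim⟩ := hω₀
  refine ⟨δ, hδ, fun x => ?_⟩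
  refine ge_of_tendsto' ((Complex.continuous_re.tendsto _).comp ((hlim _).const_mul _)) fun k => ?_
  exact IsFieldGroundState.le_staggeredMag (hB k) hω (h k) hfreq x

end Magnetization

/-! ### Transverse fluctuations in a fixed region -/

section TestFunction

variable {d : ℕ}

/-- The `2 d` unit steps of the lattice. -/
def step (p : Fin d × Bool) : Site d := Pi.single p.1 (if p.2 then 1 else -1)

theorem norm_step (p : Fin d × Bool) : ‖step p‖ = 1 := by
  rw [step, Pi.norm_single]
  split_ifs <;> simp

theorem step_injective : Function.Injective (step (d := d)) := by
  rintro ⟨i, b⟩ ⟨j, c⟩ h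
  have h1 := congrFun h i
  simp only [step, Pi.single_eq_same] at h1
  by_cases hij : i = j
  · subst hij
    rw [Pi.single_eq_same] at h1
    cases b <;> cases c <;> simp_all
  · rw [Pi.single_eq_of_ne hij] at h1
    cases b <;> simp at h1

theorem latticeAdj_iff {x y : Site d} : LatticeAdj x y ↔ ∃ p, y = x + step p := by
  constructor
  · rintro ⟨i, h1, h2 | h2⟩
    · refine ⟨(i, false), funext fun j => ?_⟩
      by_cases hj : j = i
      · subst hj
        simp only [step, Pi.add_apply, Pi.single_eq_same]
        simp; omega
      · simp [step, hj, h1 j hj]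
    · refine ⟨(i, true), funext fun j => ?_⟩
      by_cases hj : j = i
      · subst hj
        simp only [step, Pi.add_apply, Pi.single_eq_same]
        simp; omega
      · simp [step, hj, h1 j hj]
  · rintro ⟨⟨i, b⟩, rfl⟩
    refine ⟨i, fun j hj => by simp [step, hj], ?_⟩
    cases b <;> simp [step]

theorem LatticeAdj.norm_sub {x y : Site d} (h : LatticeAdj x y) : ‖x - y‖ = 1 := by
  obtain ⟨p, rfl⟩ := latticeAdj_iff.1 h
  rw [sub_add_cancel_left, norm_neg, norm_step]

open Classical in
theorem sum_latticeAdj {L : ℕ} {x : Site d} (hx : ∀ i, -(L : ℤ) + 2 ≤ x i ∧ x i ≤ L - 1)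
    (f : Site d → ℝ) :
    (∑ y : box d L, if LatticeAdj x y then f y else 0) = ∑ p, f (x + step p) := by
  symm
  refine Finset.sum_of_injOn (fun p => ⟨x + step p, LatticeAdj.mem_box hx (latticeAdj_iff.2 ⟨p, rfl⟩)⟩)
    ?_ ?_ ?_ ?_
  · intro p _ q _ h
    exact step_injective (add_left_cancel (congrArg (fun z : box d L => (z : Site d)) h))
  · intro p _
    exact Finset.mem_coe.2 (Finset.mem_univ _)
  · intro y _ hy
    refine if_neg fun h => hy ?_
    obtain ⟨p, hp⟩ := latticeAdj_iff.1 h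
    exact ⟨p, Finset.mem_coe.2 (Finset.mem_univ _), Subtype.ext hp.symm⟩
  · intro p _
    rw [if_pos (latticeAdj_iff.2 ⟨p, rfl⟩)]

/-- The test function `max (0, R - ‖x‖)`. -/
def tent (R : ℕ) (x : Site d) : ℝ := max 0 (R - ‖x‖)

/-- The sum of `tent x + tent y` over the neighbours `y` of `x`. -/
def bondTent (R : ℕ) (x : Site d) : ℝ := ∑ p, (tent R x + tent R (x + step p))

theorem tent_nonneg (R : ℕ) (x : Site d) : 0 ≤ tent R x := le_max_left _ _

theorem tent_le (R : ℕ) (x : Site d) : tent R x ≤ R :=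
  max_le (Nat.cast_nonneg R) (sub_le_self _ (norm_nonneg x))

theorem abs_tent_sub_le (R : ℕ) (x y : Site d) : |tent R x - tent R y| ≤ ‖x - y‖ := by
  rw [tent, tent]
  refine (abs_max_sub_max_le_max _ _ _ _).trans ?_
  rw [sub_self, abs_zero, sub_sub_sub_cancel_left, max_eq_right (abs_nonneg _), norm_sub_rev]
  exact abs_norm_sub_norm_le y x

theorem mem_box_of_norm_lt {N : ℕ} {x : Site d} (h : ‖x‖ < N) : x ∈ box d N := by
  rw [mem_box_iff]
  intro i
  have h1 := (norm_le_pi_norm x i).trans_lt h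
  rw [Int.norm_eq_abs] at h1
  have h2 : |x i| < (N : ℤ) := by exact_mod_cast h1
  rw [abs_lt] at h2
  omega

theorem tent_eq_zero {R : ℕ} {x : Site d} (h : x ∉ box d R) : tent R x = 0 := by
  rw [tent, max_eq_left]
  by_contra! h1
  exact h (mem_box_of_norm_lt (sub_pos.1 h1))

theorem bondTent_nonneg (R : ℕ) (x : Site d) : 0 ≤ bondTent R x :=
  Finset.sum_nonneg fun _ _ => add_nonneg (tent_nonneg _ _) (tent_nonneg _ _)

theorem tent_le_bondTent (hd : 0 < d) (R : ℕ) (x : Site d) : tent R x ≤ bondTent R x :=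
  (le_add_of_nonneg_right (tent_nonneg _ _)).trans (Finset.single_le_sum
    (f := fun p => tent R x + tent R (x + step p))
    (fun _ _ => add_nonneg (tent_nonneg _ _) (tent_nonneg _ _))
    (Finset.mem_univ ((⟨0, hd⟩, true) : Fin d × Bool)))

/-- Each of the 2d steps contributes two differences of the tent, which is 1-Lipschitz. So
neighbouring values differ by a constant independent of R, although the height is of order R. -/
theorem abs_bondTent_sub_le (R : ℕ) (x y : Site d) :
    |bondTent R x - bondTent R y| ≤ 4 * d * ‖x - y‖ := by
  rw [bondTent, bondTent, ← Finset.sum_sub_distrib]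
  calc _ ≤ ∑ p : Fin d × Bool, 2 * ‖x - y‖ := by
        refine (Finset.abs_sum_le_sum_abs _ _).trans (Finset.sum_le_sum fun p _ => ?_)
        have h1 := abs_tent_sub_le R x y
        have h2 := abs_tent_sub_le R (x + step p) (y + step p)
        rw [add_sub_add_right_eq_sub] at h2
        have h3 := abs_add_le (tent R x - tent R y) (tent R (x + step p) - tent R (y + step p))
        rw [show tent R x + tent R (x + step p) - (tent R y + tent R (y + step p)) =
          tent R x - tent R y + (tent R (x + step p) - tent R (y + step p)) by ring]
        linarith
    _ = _ := by simp; ring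

theorem bondTent_eq_zero {R : ℕ} {x : Site d} (h : x ∉ box d (R + 1)) : bondTent R x = 0 := by
  refine Finset.sum_eq_zero fun p _ => ?_
  have hx : (R : ℝ) + 1 ≤ ‖x‖ := by
    by_contra! h1
    exact h (mem_box_of_norm_lt (by exact_mod_cast h1))
  have h2 : ‖x‖ ≤ ‖x + step p‖ + 1 := by
    have := norm_sub_le (x + step p) (step p)
    rwa [add_sub_cancel_right, norm_step] at this
  rw [tent, tent, max_eq_left (by linarith), max_eq_left (by linarith), add_zero]

theorem bondTent_le (R : ℕ) (x : Site d) : bondTent R x ≤ 4 * d * R := by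
  calc bondTent R x ≤ ∑ p : Fin d × Bool, 2 * (R : ℝ) :=
        Finset.sum_le_sum fun p _ => by linarith [tent_le R x, tent_le R (x + step p)]
    _ = _ := by simp; ring

end TestFunction

/-! ### The fluctuation bound for the tent profile, uniform in the volume -/

section LocalFluctuation

variable {d n : ℕ}

theorem BoxAdj.latticeAdj {N L : ℕ} (h : N + 1 ≤ L) {x y : box d L} (hx : (x : Site d) ∈ box d N)
    (hxy : BoxAdj d L x y) : LatticeAdj (x : Site d) y := by
  refine (periodicAdj_iff_latticeAdj le_rfl (fun i => ?_) y.2).1 hxy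
  have := mem_box_iff.1 hx i
  omega

-- Once L exceeds R by a margin, the support does not see the boundary, and the lattice profile is
-- the one that Gaussian domination associates with the tent on the torus.
open Classical in
theorem bondTent_eq_sum {R L : ℕ} (h : R + 3 ≤ L) (x : box d L) :
    bondTent R (x : Site d) =
      ∑ y : box d L, if BoxAdj d L x y then tent R (x : Site d) + tent R (y : Site d) else 0 := by
  by_cases hx : (x : Site d) ∈ box d (R + 1)
  · have hi : ∀ i, -(L : ℤ) + 2 ≤ (x : Site d) i ∧ (x : Site d) i ≤ L - 1 := by
      intro i
      have := mem_box_iff.1 hx i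
      push_cast at this
      omega
    rw [bondTent, ← sum_latticeAdj hi (fun y => tent R (x : Site d) + tent R y)]
    refine Finset.sum_congr rfl fun y _ => ?_
    exact if_congr (periodicAdj_iff_latticeAdj le_rfl hi y.2).symm rfl rfl
  · rw [bondTent_eq_zero hx, tent_eq_zero fun h => hx (box_mono (Nat.le_succ R) h)]
    refine (Finset.sum_eq_zero fun y _ => ?_).symm
    split_ifs with hxy
    · rw [zero_add]
      refine tent_eq_zero fun hy => hx ?_
      refine LatticeAdj.mem_box (fun i => ?_) (hxy.symm.latticeAdj (by omega) hy)
      have := mem_box_iff.1 hy i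
      push_cast
      omega
    · rfl

-- Sums over bonds that meet a fixed box are bounded by the volume of that box, whatever the size L
-- of the torus.
open Classical in
theorem sum_boxAdj_le {N L : ℕ} (hL : 0 < L) (h : N ≤ L) {c : ℝ} (hc : 0 ≤ c)
    {f : box d L → box d L → ℝ} (hf : ∀ x y, BoxAdj d L x y →
      f x y ≤ c * ((if (x : Site d) ∈ box d N then 1 else 0) +
        (if (y : Site d) ∈ box d N then 1 else 0))) :
    (∑ x, ∑ y, if BoxAdj d L x y then f x y else 0) ≤ c * (4 * d * (box d N).card) := by
  have h1 : (∑ x : box d L, ∑ y, if BoxAdj d L x y then (if (x : Site d) ∈ box d N then (1 : ℝ) else 0)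
      else 0) ≤ 2 * d * (box d N).card := by
    calc _ ≤ ∑ x : box d L, if (x : Site d) ∈ box d N then (2 * d : ℝ) else 0 := by
          refine Finset.sum_le_sum fun x _ => ?_
          split_ifs
          · rw [Finset.sum_boole]
            exact_mod_cast card_boxAdj_le hL x
          · simp
      _ = _ := by
          rw [← sum_inclusion (box_mono h) (fun _ => (2 * d : ℝ))]
          simp [mul_comm]
  have h2 : (∑ x : box d L, ∑ y, if BoxAdj d L x y then (if (y : Site d) ∈ box d N then (1 : ℝ) else 0)
      else 0) = ∑ x : box d L, ∑ y, if BoxAdj d L x y then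
        (if (x : Site d) ∈ box d N then (1 : ℝ) else 0) else 0 := by
    rw [Finset.sum_comm]
    refine Finset.sum_congr rfl fun x _ => Finset.sum_congr rfl fun y _ => ?_
    exact if_congr ⟨fun h => h.symm, fun h => h.symm⟩ rfl rfl
  calc _ ≤ ∑ x : box d L, ∑ y : box d L, c * ((if BoxAdj d L x y then
          (if (x : Site d) ∈ box d N then (1 : ℝ) else 0) else 0) +
          if BoxAdj d L x y then (if (y : Site d) ∈ box d N then (1 : ℝ) else 0) else 0) := by
        refine Finset.sum_le_sum fun x _ => Finset.sum_le_sum fun y _ => ?_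
        by_cases hxy : BoxAdj d L x y
        · simp only [if_pos hxy]
          exact hf x y hxy
        · simp [hxy]
    _ = c * ((∑ x : box d L, ∑ y, if BoxAdj d L x y then
          (if (x : Site d) ∈ box d N then (1 : ℝ) else 0) else 0) +
          ∑ x : box d L, ∑ y, if BoxAdj d L x y then
          (if (y : Site d) ∈ box d N then (1 : ℝ) else 0) else 0) := by
        simp only [← Finset.mul_sum, Finset.sum_add_distrib]
    _ ≤ _ := by
        rw [h2]
        exact mul_le_mul_of_nonneg_left (by linarith) hc

/-- The weighted transverse magnetization. -/
def transverse (n R : ℕ) : LocalAlg n (box d (R + 1)) :=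
  ∑ x : box d (R + 1), bondTent R (x : Site d) • oneSite x (spin1 n)

theorem embedHom_real_smul {Γ Λ : Finset (Site d)} (h : Γ ⊆ Λ) (r : ℝ) (a : LocalAlg n Γ) :
    embedHom h (r • a) = r • embedHom h a := by
  rw [← Complex.coe_smul, map_smul, Complex.coe_smul]

theorem embedHom_transverse {R L : ℕ} (h : R + 1 ≤ L) :
    embedHom (box_mono h) (transverse n R) =
      ∑ x : box d L, bondTent R (x : Site d) • oneSite x (spin1 n) := by
  rw [transverse, map_sum]
  simp only [embedHom_real_smul, embedHom_oneSite]
  rw [sum_inclusion (box_mono h) (fun x : box d L => bondTent R (x : Site d) • oneSite x (spin1 n))]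
  refine Finset.sum_congr rfl fun x _ => ?_
  split_ifs with hx
  · rfl
  · rw [bondTent_eq_zero hx, zero_smul]

open Classical in
theorem sum_tent_sq_le {R L : ℕ} (h : R + 3 ≤ L) :
    (∑ x : box d L, ∑ y : box d L, if BoxAdj d L x y then
      (tent R (x : Site d) + tent R (y : Site d)) ^ 2 else 0) ≤
    (2 * R) ^ 2 * (4 * d * (box d (R + 1)).card) := by
  have hL : 0 < L := by omega
  have hRL : R + 1 ≤ L := by omega
  refine sum_boxAdj_le (d := d) hL hRL (c := (2 * R) ^ 2) (by positivity)
    (f := fun x y => (tent R (x : Site d) + tent R (y : Site d)) ^ 2) (by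
      intro x y _
      have b1 := tent_le R (x : Site d)
      have b2 := tent_le R (y : Site d)
      have b3 := tent_nonneg R (x : Site d)
      have b4 := tent_nonneg R (y : Site d)
      have b5 : (tent R (x : Site d) + tent R (y : Site d)) ^ 2 ≤ (2 * R) ^ 2 := by
        gcongr; linarith
      have b6 : (0 : ℝ) ≤ (2 * R) ^ 2 := by positivity
      split_ifs with hx hy hy
      · linarith
      · linarith
      · linarith
      · rw [tent_eq_zero fun h => hx (box_mono (Nat.le_succ R) h),
          tent_eq_zero fun h => hy (box_mono (Nat.le_succ R) h)]
        simp)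

open Classical in
theorem sum_bondTent_sub_sq_le {R L : ℕ} (h : R + 3 ≤ L) :
    (∑ x : box d L, ∑ y : box d L, if BoxAdj d L x y then
      (bondTent R (x : Site d) - bondTent R (y : Site d)) ^ 2 else 0) ≤
    (4 * d) ^ 2 * (4 * d * (box d (R + 1)).card) := by
  have hL : 0 < L := by omega
  have hRL : R + 1 ≤ L := by omega
  refine sum_boxAdj_le (d := d) hL hRL (c := (4 * d) ^ 2) (by positivity)
    (f := fun x y => (bondTent R (x : Site d) - bondTent R (y : Site d)) ^ 2) (by
      intro x y hxy
      have b5 : LatticeAdj (x : Site d) y →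
          (bondTent R (x : Site d) - bondTent R (y : Site d)) ^ 2 ≤ (4 * d) ^ 2 := by
        intro hl
        rw [← sq_abs]
        have := abs_bondTent_sub_le R (x : Site d) y
        rw [hl.norm_sub, mul_one] at this
        gcongr
      have b6 : (0 : ℝ) ≤ (4 * d) ^ 2 := by positivity
      by_cases hx : (x : Site d) ∈ box d (R + 1)
      · have := b5 (hxy.latticeAdj (by omega) hx)
        rw [if_pos hx]
        split_ifs <;> linarith
      · by_cases hy : (y : Site d) ∈ box d (R + 1)
        · have hl := hxy.symm.latticeAdj (by omega) hy
          have hl' : LatticeAdj (x : Site d) y := by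
            obtain ⟨i, e1, e2⟩ := hl
            exact ⟨i, fun j hj => (e1 j hj).symm, e2.symm⟩
          have := b5 hl'
          rw [if_pos hy, if_neg hx]
          linarith
        · rw [bondTent_eq_zero hx, bondTent_eq_zero hy, if_neg hx, if_neg hy]
          simp)

theorem sum_bondTent_sq_le {R L : ℕ} (hRL : R + 1 ≤ L) :
    ∑ x : box d L, bondTent R (x : Site d) ^ 2 ≤ (4 * d * R) ^ 2 * (box d (R + 1)).card := by
  classical
  calc _ ≤ ∑ x : box d L, if (x : Site d) ∈ box d (R + 1) then ((4 * d * R) ^ 2 : ℝ) else 0 := by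
        refine Finset.sum_le_sum fun x _ => ?_
        split_ifs with hx
        · have := bondTent_le R (x : Site d)
          have := bondTent_nonneg R (x : Site d)
          gcongr
        · rw [bondTent_eq_zero hx]; simp
    _ = _ := by
        rw [← sum_inclusion (box_mono hRL) (fun _ => ((4 * d * R) ^ 2 : ℝ))]
        simp [mul_comm]

/-- The first factor is of order R² times the volume of the support and the second, apart from |B|,
of the order of that volume; no power of L occurs. -/
theorem finite_fluctuation_le {R L : ℕ} (h : R + 3 ≤ L) (B : ℝ) :
    (groundState (hamiltonian d n L B) (embedHom (box_mono (show R + 1 ≤ L by omega))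
      (transverse n R * transverse n R))).re ^ 2 ≤
    ((2 * R) ^ 2 * (4 * d * (box d (R + 1)).card)) * (commBound (spinVec n) *
      ((4 * d) ^ 2 * (4 * d * (box d (R + 1)).card) +
        |B| * ((4 * d * R) ^ 2 * (box d (R + 1)).card))) := by
  classical
  have hL : 0 < L := by omega
  have hRL : R + 1 ≤ L := by omega
  rw [map_mul, embedHom_transverse hRL]
  have h0 := @HeisenbergAF.fluctuation_le d n L hL B (fun x => tent R (x : Site d))
    (fun x => bondTent R (x : Site d)) (fun x => bondTent_eq_sum h x)
  refine h0.trans ?_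
  have h1 := sum_tent_sq_le (d := d) h
  have h2 := sum_bondTent_sub_sq_le (d := d) h
  have h3 := sum_bondTent_sq_le (d := d) hRL
  have h4 := commBound_nonneg (spinVec n)
  refine mul_le_mul h1 (mul_le_mul_of_nonneg_left (add_le_add h2
    (mul_le_mul_of_nonneg_left h3 (abs_nonneg B))) h4) ?_ (by positivity)
  refine mul_nonneg h4 (add_nonneg ?_ (mul_nonneg (abs_nonneg B)
    (Finset.sum_nonneg fun _ _ => sq_nonneg _)))
  exact Finset.sum_nonneg fun x _ => Finset.sum_nonneg fun y _ => by
    split_ifs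
    · positivity
    · rfl

/-- The transverse fluctuations in the zero-field limit. -/
theorem IsZeroFieldLimit.fluctuation_le {ω₀ : quasiLocal d n →L[ℂ] ℂ} (hω₀ : IsZeroFieldLimit ω₀)
    (R : ℕ) :
    (restrictState ω₀ (box d (R + 1)) (transverse n R * transverse n R)).re ^ 2 ≤
    ((2 * R) ^ 2 * (4 * d * (box d (R + 1)).card)) * (commBound (spinVec n) *
      ((4 * d) ^ 2 * (4 * d * (box d (R + 1)).card))) := by
  obtain ⟨B, ω, hB, hB0, h, hlim⟩ := hω₀
  -- The bound holds for all large boxes at fixed R, hence for each field state; it is continuous in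
  -- the field, and its field term vanishes at 0.
  set U : ℝ → ℝ := fun b => ((2 * R) ^ 2 * (4 * d * (box d (R + 1)).card)) * (commBound (spinVec n) *
      ((4 * d) ^ 2 * (4 * d * (box d (R + 1)).card) +
        |b| * ((4 * d * R) ^ 2 * (box d (R + 1)).card))) with hU
  have h1 : ∀ k, (restrictState (ω k) (box d (R + 1)) (transverse n R * transverse n R)).re ^ 2 ≤
      U (B k) := by
    intro k
    obtain ⟨-, M, hM, hl⟩ := h k
    refine le_of_tendsto (((Complex.continuous_re.pow 2).tendsto _).comp (hl (box d (R + 1)) _)) ?_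
    filter_upwards [hM.eventually_ge_atTop (R + 3)] with j hj
    rw [Function.comp_apply, finiteGroundState_eq (box_mono (show R + 1 ≤ M j by omega))]
    exact finite_fluctuation_le hj (B k)
  have hUc : Continuous U := by
    rw [hU]
    fun_prop
  have h2 := le_of_tendsto_of_tendsto' (((Complex.continuous_re.pow 2).tendsto _).comp
    (hlim (obs n (box d (R + 1)) (transverse n R * transverse n R))))
    ((hUc.tendsto 0).comp hB0) h1
  refine h2.trans (le_of_eq ?_)
  simp only [hU, abs_zero, zero_mul, add_zero]

end LocalFluctuation

/-! ### Decay of correlations and the uncertainty relation -/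

section Counting

variable {d : ℕ}

theorem norm_le_siteDist (x y : Site d) : ‖x - y‖ ≤ siteDist x y := by
  rw [pi_norm_le_iff_of_nonneg (show 0 ≤ siteDist x y from Real.sqrt_nonneg _)]
  intro i
  rw [Int.norm_eq_abs, siteDist, Pi.sub_apply, Int.cast_sub, ← Real.sqrt_sq_eq_abs]
  exact Real.sqrt_le_sqrt (Finset.single_le_sum (f := fun i => ((x i : ℝ) - y i) ^ 2)
    (fun _ _ => sq_nonneg _) (Finset.mem_univ i))

theorem one_le_norm {z : Site d} (hz : z ≠ 0) : 1 ≤ ‖z‖ := by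
  obtain ⟨i, hi⟩ := Function.ne_iff.1 hz
  refine le_trans ?_ (norm_le_pi_norm z i)
  rw [Int.norm_eq_abs]
  exact_mod_cast Int.one_le_abs hi

theorem mem_boundary_of_notMem {M : ℕ} {z : Site d} (h1 : z ∈ box d (M + 1)) (h2 : z ∉ box d M) :
    z ∈ boundary d (M + 1) ∧ (M : ℝ) ≤ ‖z‖ := by
  rw [mem_box_iff, not_forall] at h2
  obtain ⟨i, hi⟩ := h2
  have h3 := mem_box_iff.1 h1 i
  push_cast at h3
  refine ⟨Finset.mem_filter.2 ⟨h1, i, ?_⟩, ?_⟩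
  · push_cast
    omega
  · refine le_trans ?_ (norm_le_pi_norm z i)
    rw [Int.norm_eq_abs]
    have : (M : ℤ) ≤ |z i| := by
      rw [le_abs]
      omega
    exact_mod_cast this

theorem card_boundary_le (hd : 0 < d) {M : ℕ} (hM : 0 < M) :
    ((boundary d (M + 1)).card : ℝ) ≤ d * 4 ^ d * M ^ (d - 1) := by
  have h1 := card_boundary_mul_le d (M + 1)
  have e : d - 1 + 1 = d := by omega
  have h2 : (boundary d (M + 1)).card ≤ d * (2 ^ d * (M + 1) ^ (d - 1)) := by
    refine Nat.le_of_mul_le_mul_right (h1.trans (le_of_eq ?_)) (Nat.succ_pos M)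
    rw [card_box, mul_pow]
    conv_lhs => rw [← e, pow_succ (M + 1), e]
    ring
  have h3 : (M + 1) ^ (d - 1) ≤ (2 * M) ^ (d - 1) := Nat.pow_le_pow_left (by omega) _
  have h4 : d * (2 ^ d * (M + 1) ^ (d - 1)) ≤ d * 4 ^ d * M ^ (d - 1) := by
    calc _ ≤ d * (2 ^ d * (2 * M) ^ (d - 1)) := by gcongr
      _ = d * (2 ^ d * 2 ^ (d - 1)) * M ^ (d - 1) := by rw [mul_pow]; ring
      _ ≤ d * (2 ^ d * 2 ^ d) * M ^ (d - 1) := by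
          gcongr
          · norm_num
          · omega
      _ = _ := by rw [← mul_pow]; norm_num
  exact_mod_cast h2.trans h4

/-- Going from M to M + 1 adds a shell of O(M^{d-1}) sites at distance at least M, hence a bounded
contribution. -/
theorem sum_inv_norm_pow_le (hd : 2 ≤ d) {M : ℕ} (hM : 1 ≤ M) :
    ∑ z ∈ box d M, (‖z‖ ^ (d - 1))⁻¹ ≤ d * 4 ^ d * M := by
  induction M, hM using Nat.le_induction with
  | base =>
    have h1 : ∀ z ∈ box d 1, (‖z‖ ^ (d - 1))⁻¹ ≤ 1 := by
      intro z _
      by_cases hz : z = 0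
      · rw [hz, norm_zero, zero_pow (by omega), inv_zero]
        exact zero_le_one
      · exact inv_le_one_of_one_le₀ (one_le_pow₀ (one_le_norm hz))
    refine (Finset.sum_le_sum h1).trans ?_
    rw [Finset.sum_const, nsmul_eq_mul, mul_one, card_box]
    have h2 : (2 * 1) ^ d ≤ d * 4 ^ d := by
      calc (2 * 1) ^ d ≤ 4 ^ d := Nat.pow_le_pow_left (by norm_num) _
        _ ≤ _ := Nat.le_mul_of_pos_left _ (by omega)
    push_cast
    rw [mul_one]
    exact_mod_cast h2
  | succ M hM ih =>
    rw [← Finset.sum_sdiff (box_mono (Nat.le_succ M))]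
    have hM0 : (0 : ℝ) < (M : ℝ) ^ (d - 1) := by positivity
    have h1 : ∑ z ∈ box d (M + 1) \ box d M, (‖z‖ ^ (d - 1))⁻¹ ≤ d * 4 ^ d := by
      calc _ ≤ ∑ z ∈ box d (M + 1) \ box d M, ((M : ℝ) ^ (d - 1))⁻¹ := by
            refine Finset.sum_le_sum fun z hz => ?_
            rw [Finset.mem_sdiff] at hz
            have := (mem_boundary_of_notMem hz.1 hz.2).2
            gcongr
        _ ≤ (boundary d (M + 1)).card * ((M : ℝ) ^ (d - 1))⁻¹ := by
            rw [Finset.sum_const, nsmul_eq_mul]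
            gcongr
            intro z hz
            rw [Finset.mem_sdiff] at hz
            exact (mem_boundary_of_notMem hz.1 hz.2).1
        _ ≤ (d * 4 ^ d * M ^ (d - 1)) * ((M : ℝ) ^ (d - 1))⁻¹ := by
            gcongr
            exact card_boundary_le (by omega) hM
        _ = _ := mul_inv_cancel_right₀ hM0.ne' _
    push_cast
    linarith

theorem sum_sub_le {N : ℕ} {x : Site d} (hx : x ∈ box d N) {W : Site d → ℝ} (hW : ∀ z, 0 ≤ W z) :
    ∑ y ∈ box d N, W (x - y) ≤ ∑ z ∈ box d (2 * N), W z := by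
  classical
  rw [← Finset.sum_image (f := W) (g := fun y => x - y) (fun a _ b _ h => sub_right_injective h)]
  refine Finset.sum_le_sum_of_subset_of_nonneg ?_ fun z _ _ => hW z
  intro z hz
  obtain ⟨y, hy, rfl⟩ := Finset.mem_image.1 hz
  rw [mem_box_iff]
  intro i
  have h1 := mem_box_iff.1 hx i
  have h2 := mem_box_iff.1 hy i
  simp only [Pi.sub_apply]
  push_cast
  omega

/-- A tent of height 2r is at least r on the box of size r, which has (2r)^d sites. -/
theorem sum_tent_ge (r : ℕ) : (r : ℝ) * (2 * r) ^ d ≤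
    ∑ x : box d (2 * r + 1), tent (2 * r) (x : Site d) := by
  classical
  rw [Finset.sum_coe_sort (box d (2 * r + 1)) (fun x => tent (2 * r) x)]
  calc (r : ℝ) * (2 * r) ^ d = ∑ x ∈ box d r, (r : ℝ) := by
        rw [Finset.sum_const, nsmul_eq_mul, card_box]; push_cast; ring
    _ ≤ ∑ x ∈ box d r, tent (2 * r) x := by
        refine Finset.sum_le_sum fun x hx => ?_
        refine le_max_of_le_right ?_
        have : ‖x‖ ≤ r := by
          rw [pi_norm_le_iff_of_nonneg (Nat.cast_nonneg r)]
          intro i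
          rw [Int.norm_eq_abs]
          have h1 := mem_box_iff.1 hx i
          have h2 : |x i| ≤ (r : ℤ) := by
            rw [abs_le]; omega
          exact_mod_cast h2
        push_cast
        linarith
    _ ≤ _ := Finset.sum_le_sum_of_subset_of_nonneg (box_mono (by omega))
        fun x _ _ => tent_nonneg _ x

end Counting

/-! ### The uncertainty relation against rapid decay -/

section Contradiction

variable {d n : ℕ}

/-- The staggered transverse magnetization of a box. -/
def staggered2 (d n N : ℕ) : LocalAlg n (box d N) :=
  ∑ x : box d N, stagger (x : Site d) • oneSite x (spin2 n)

theorem star_sum_smul_oneSite {V κ : Type*} [Fintype V] [DecidableEq V] [Fintype κ] [DecidableEq κ]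
    {M : Matrix κ κ ℂ} (hM : star M = M) (g : V → ℝ) :
    star (∑ x, g x • oneSite x M) = ∑ x, g x • oneSite x M := by
  rw [star_sum]
  refine Finset.sum_congr rfl fun x _ => ?_
  rw [star_smul, ← map_star, hM]
  rfl

theorem commutator_sum_smul_oneSite {V κ : Type*} [Fintype V] [DecidableEq V] [Fintype κ]
    [DecidableEq κ] (M M' : Matrix κ κ ℂ) (g s : V → ℝ) :
    (∑ x, g x • oneSite x M) * (∑ x, s x • oneSite x M') -
      (∑ x, s x • oneSite x M') * (∑ x, g x • oneSite x M) =
      ∑ x, (g x * s x) • oneSite x (M * M' - M' * M) := by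
  have h : (∑ x, s x • oneSite x M') * (∑ x, g x • oneSite x M) =
      ∑ x, ∑ y, (s y • oneSite y M') * (g x • oneSite x M) := by
    rw [Finset.sum_mul_sum, Finset.sum_comm]
  rw [h, Finset.sum_mul_sum, ← Finset.sum_sub_distrib]
  refine Finset.sum_congr rfl fun x _ => ?_
  rw [← Finset.sum_sub_distrib, Finset.sum_eq_single x]
  · rw [smul_mul_smul_comm, smul_mul_smul_comm, mul_comm (s x), ← smul_sub, map_sub, map_mul,
      map_mul]
  · intro y _ hy
    rw [smul_mul_smul_comm, smul_mul_smul_comm, mul_comm (s y), ← smul_sub,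
      oneSite_commute hy, sub_self, smul_zero]
  · simp

theorem restrictState_real_smul (ω : quasiLocal d n →L[ℂ] ℂ) (Γ : Finset (Site d)) (r : ℝ)
    (a : LocalAlg n Γ) : restrictState ω Γ (r • a) = r * restrictState ω Γ a := by
  rw [← Complex.coe_smul, map_smul, smul_eq_mul]

/-- Different sites commute and [S^(1), S^(2)] = i S^(3), so the signs carried by the second factor
turn the commutator into the weighted staggered magnetization. -/
theorem im_commutator (ω : quasiLocal d n →L[ℂ] ℂ) (R : ℕ) :
    (restrictState ω (box d (R + 1)) (transverse n R * staggered2 d n (R + 1) -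
      staggered2 d n (R + 1) * transverse n R)).im =
      ∑ x : box d (R + 1), bondTent R (x : Site d) * (staggeredMag ω (x : Site d)).re := by
  have hc : spin1 n * spin2 n - spin2 n * spin1 n = Complex.I • spin3 n := spin_comm12 n
  rw [transverse, staggered2, commutator_sum_smul_oneSite, hc, map_sum, Complex.im_sum]
  refine Finset.sum_congr rfl fun x _ => ?_
  rw [restrictState_real_smul, map_smul, map_smul, restrictState_apply, obs_oneSite, staggeredMag,
    Complex.im_ofReal_mul, Complex.re_ofReal_mul, smul_eq_mul, mul_assoc]
  simp

/-- The staggered signs have modulus 1, so absolute decay is all that matters. -/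
theorem re_staggered2_sq_le (ω : quasiLocal d n →L[ℂ] ℂ) (N : ℕ) :
    (restrictState ω (box d N) (staggered2 d n N * staggered2 d n N)).re ≤
      ∑ x : box d N, ∑ y : box d N,
        ‖ω (siteObs n (x : Site d) (spin2 n) * siteObs n (y : Site d) (spin2 n))‖ := by
  rw [staggered2, Finset.sum_mul_sum, map_sum, Complex.re_sum]
  refine Finset.sum_le_sum fun x _ => ?_
  rw [map_sum, Complex.re_sum]
  refine Finset.sum_le_sum fun y _ => (Complex.re_le_norm _).trans ?_
  rw [smul_mul_smul_comm, restrictState_real_smul, norm_mul, restrictState_apply, map_mul,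
    obs_oneSite, obs_oneSite]
  refine mul_le_of_le_one_left (norm_nonneg _) ?_
  rw [Complex.norm_real, norm_mul, stagger, stagger, norm_zpow, norm_zpow, norm_neg, norm_one,
    one_zpow, one_zpow, one_mul]

open scoped Matrix.Norms.L2Operator in
theorem IsState.norm_le {ω : quasiLocal d n →L[ℂ] ℂ} (hω : IsState ω) {Γ : Finset (Site d)}
    (x y : Γ) : ‖ω (siteObs n (x : Site d) (spin2 n) * siteObs n (y : Site d) (spin2 n))‖ ≤
      ‖spin2 n‖ ^ 2 := by
  have := (hω.restrictState Γ).norm_le (oneSite x (spin2 n) * oneSite y (spin2 n))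
  rw [restrictState_apply, map_mul, obs_oneSite, obs_oneSite] at this
  refine this.trans ((norm_mul_le _ _).trans ?_)
  rw [sq]
  exact mul_le_mul (norm_oneSite_le _ _) (norm_oneSite_le _ _) (norm_nonneg _) (norm_nonneg _)

/-- Rapid decay of the correlations makes the fluctuations small. -/
theorem exists_staggered2_sq_le (hd : 2 ≤ d) {ω : quasiLocal d n →L[ℂ] ℂ} (hω : IsState ω)
    (h : (fun p : Site d × Site d => ω (spinObs2 n p.1 * spinObs2 n p.2))
        =o[Filter.comap (fun p : Site d × Site d => siteDist p.1 p.2) Filter.atTop]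
          (fun p : Site d × Site d => siteDist p.1 p.2 ^ (-((d : ℤ) - 1)))) {ε : ℝ} (hε : 0 < ε) :
    ∃ D : ℝ, ∀ N : ℕ, 1 ≤ N →
      (restrictState ω (box d N) (staggered2 d n N * staggered2 d n N)).re ≤
        (box d N).card * (ε * (d * 4 ^ d * (2 * N)) + D) := by
  classical
  have h1 := Asymptotics.isLittleO_iff.1 h hε
  rw [eventually_comap] at h1
  obtain ⟨r0, h2⟩ := eventually_atTop.1 h1
  -- The lower bound 1 keeps distances beyond the cutoff positive, so that the two sites are
  -- distinct.
  obtain ⟨r, hr⟩ := exists_nat_ge (max r0 1)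
  obtain ⟨b, hb⟩ : ∃ b : ℝ, 0 ≤ b ∧ ∀ N : ℕ, ∀ x y : box d N,
      ‖ω (siteObs n (x : Site d) (spin2 n) * siteObs n (y : Site d) (spin2 n))‖ ≤ b :=
    open scoped Matrix.Norms.L2Operator in
    ⟨‖spin2 n‖ ^ 2, by positivity, fun N x y => hω.norm_le x y⟩
  -- A translation-invariant majorant: the decay hypothesis at large distance, and the trivial bound
  -- b within the cutoff r. Its short-range part gives the constant D, its tail the term linear in
  -- N. The sup norm is used because it is at most the Euclidean distance.
  set W : Site d → ℝ := fun z => ε * (‖z‖ ^ (d - 1))⁻¹ + b * (if z ∈ box d r then 1 else 0) with hW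
  have hW0 : ∀ z, 0 ≤ W z := by
    intro z
    have h1 : (0 : ℝ) ≤ if z ∈ box d r then 1 else 0 := by split_ifs <;> norm_num
    have := hb.1
    simp only [hW]
    positivity
  have hle : ∀ N : ℕ, ∀ x y : box d N,
      ‖ω (siteObs n (x : Site d) (spin2 n) * siteObs n (y : Site d) (spin2 n))‖ ≤
        W ((x : Site d) - y) := by
    intro N x y
    by_cases hxy : (r : ℝ) ≤ siteDist (x : Site d) y
    · have h3 := h2 _ ((le_max_left _ _).trans (hr.trans hxy)) (x, y) rfl
      rw [spinObs2_eq, spinObs2_eq] at h3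
      refine h3.trans (le_add_of_le_of_nonneg ?_ (mul_nonneg hb.1 (by split_ifs <;> norm_num)))
      have hpos : 0 < siteDist (x : Site d) y :=
        zero_lt_one.trans_le ((le_max_right _ _).trans (hr.trans hxy))
      have hne : (x : Site d) - y ≠ 0 := by
        intro h0
        rw [sub_eq_zero] at h0
        rw [h0] at hpos
        simp [siteDist] at hpos
      have hn := one_le_norm hne
      have e : (d : ℤ) - 1 = ((d - 1 : ℕ) : ℤ) := by omega
      rw [e, zpow_neg, zpow_natCast, norm_inv, norm_pow, Real.norm_of_nonneg hpos.le]
      have := norm_le_siteDist (x : Site d) y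
      gcongr
    · rw [not_le] at hxy
      have h3 : (x : Site d) - y ∈ box d r :=
        mem_box_of_norm_lt ((norm_le_siteDist _ _).trans_lt hxy)
      simp only [hW, if_pos h3, mul_one]
      exact (hb.2 N x y).trans (le_add_of_nonneg_left (by positivity))
  refine ⟨b * (box d r).card, fun N hN => (re_staggered2_sq_le ω N).trans ?_⟩
  calc _ ≤ ∑ x : box d N, (ε * (d * 4 ^ d * (2 * N)) + b * (box d r).card) := by
        refine Finset.sum_le_sum fun x _ => ?_
        refine (Finset.sum_le_sum fun y _ => hle N x y).trans ?_
        rw [Finset.sum_coe_sort (box d N) (fun y => W ((x : Site d) - y))]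
        refine (sum_sub_le x.2 hW0).trans ?_
        simp only [hW, Finset.sum_add_distrib, ← Finset.mul_sum]
        have h5 := sum_inv_norm_pow_le hd (M := 2 * N) (by omega)
        push_cast at h5
        refine add_le_add (mul_le_mul_of_nonneg_left h5 hε.le) (mul_le_mul_of_nonneg_left ?_ hb.1)
        rw [Finset.sum_boole]
        exact_mod_cast Finset.card_le_card fun z hz => (Finset.mem_filter.1 hz).2
    _ = _ := by simp; ring

theorem box_card_le (r : ℕ) (hr : 1 ≤ r) :
    ((box d (2 * r + 1)).card : ℝ) ≤ 3 ^ d * (2 * r) ^ d := by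
  rw [card_box, ← mul_pow]
  push_cast
  have : (1 : ℝ) ≤ r := by exact_mod_cast hr
  exact pow_le_pow_left₀ (by positivity) (by linarith) d

set_option maxHeartbeats 1000000 in
/-- Spontaneous magnetization excludes rapid decay of the transverse correlations. -/
theorem IsZeroFieldLimit.not_isLittleO (hd : 2 ≤ d) {ω₀ : quasiLocal d n →L[ℂ] ℂ}
    (hω₀ : IsZeroFieldLimit ω₀) {δ : ℝ} (hδ : 0 < δ) (hm : ∀ x, δ ≤ (staggeredMag ω₀ x).re) :
    ¬ (fun p : Site d × Site d => ω₀ (spinObs2 n p.1 * spinObs2 n p.2))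
        =o[Filter.comap (fun p : Site d × Site d => siteDist p.1 p.2) Filter.atTop]
          (fun p : Site d × Site d => siteDist p.1 p.2 ^ (-((d : ℤ) - 1))) := by
  intro hdecay
  have hst := hω₀.isState
  set c := commBound (spinVec n) with hc
  have hc0 : 0 ≤ c := commBound_nonneg _
  -- K is chosen so that the fluctuation bound at R = 2r reads F ≤ K r (2r)^d.
  set K : ℝ := √(4 ^ 2 * (4 * d * 3 ^ d) * (c * ((4 * d) ^ 2 * (4 * d * 3 ^ d)))) with hK
  have hK0 : 0 ≤ K := Real.sqrt_nonneg _
  have hK2 : K ^ 2 = 4 ^ 2 * (4 * d * 3 ^ d) * (c * ((4 * d) ^ 2 * (4 * d * 3 ^ d))) :=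
    Real.sq_sqrt (by positivity)
  set P : ℝ := 4 * K * 3 ^ d * (6 * (d * 4 ^ d)) with hP
  have hP0 : 0 ≤ P := by positivity
  -- This ε makes P ε ≤ δ²/2, so the tail of the correlations absorbs at most half of the left side;
  -- P + 1 avoids dividing by P, which may vanish.
  have hε : 0 < δ ^ 2 / (2 * (P + 1)) := by positivity
  obtain ⟨D, hD⟩ := exists_staggered2_sq_le hd hst hdecay hε
  set ε := δ ^ 2 / (2 * (P + 1)) with hεdef
  have key : ∀ r : ℕ, 1 ≤ r → δ ^ 2 * r ≤ δ ^ 2 / 2 * r + 4 * K * 3 ^ d * |D| := by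
    intro r hr
    have hr1 : (1 : ℝ) ≤ r := by exact_mod_cast hr
    set V : ℝ := (2 * r) ^ d with hV
    have hV0 : 0 < V := by positivity
    have hcard := box_card_le (d := d) r hr
    rw [← hV] at hcard
    have hF := hω₀.fluctuation_le (2 * r)
    have hX := hD (2 * r + 1) (by omega)
    have hA : star (transverse (d := d) n (2 * r)) = transverse n (2 * r) :=
      star_sum_smul_oneSite (spin1_star n) _
    have hC : star (staggered2 d n (2 * r + 1)) = staggered2 d n (2 * r + 1) :=
      star_sum_smul_oneSite (spin2_star n) _
    have hU := (hst.restrictState (box d (2 * r + 1))).uncertainty hA hC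
    rw [im_commutator] at hU
    set F := (restrictState ω₀ (box d (2 * r + 1)) (transverse n (2 * r) * transverse n (2 * r))).re
    set X := (restrictState ω₀ (box d (2 * r + 1))
      (staggered2 d n (2 * r + 1) * staggered2 d n (2 * r + 1))).re
    have hsum : δ * (r * V) ≤ ∑ x : box d (2 * r + 1),
        bondTent (2 * r) (x : Site d) * (staggeredMag ω₀ (x : Site d)).re := by
      calc δ * (r * V) ≤ δ * ∑ x : box d (2 * r + 1), tent (2 * r) (x : Site d) :=
            mul_le_mul_of_nonneg_left (sum_tent_ge r) hδ.le
        _ ≤ δ * ∑ x : box d (2 * r + 1), bondTent (2 * r) (x : Site d) :=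
            mul_le_mul_of_nonneg_left
              (Finset.sum_le_sum fun x _ => tent_le_bondTent (by omega) _ _) hδ.le
        _ = ∑ x : box d (2 * r + 1), bondTent (2 * r) (x : Site d) * δ := by
            rw [Finset.mul_sum]; simp only [mul_comm]
        _ ≤ _ := Finset.sum_le_sum fun x _ =>
            mul_le_mul_of_nonneg_left (hm x) (bondTent_nonneg _ _)
    have hF2 : F ≤ K * (r * V) := by
      refine abs_le_of_sq_le_sq' (b := K * (r * V)) ?_ (by positivity) |>.2
      refine hF.trans ?_
      rw [mul_pow K, hK2]
      push_cast
      calc _ ≤ ((2 * (2 * r)) ^ 2 * (4 * d * (3 ^ d * V))) * (c * ((4 * d) ^ 2 * (4 * d * (3 ^ d * V)))) := by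
            gcongr
        _ = _ := by ring
    have hX2 : X ≤ 3 ^ d * V * (ε * (6 * (d * 4 ^ d) * r) + |D|) := by
      refine hX.trans ?_
      push_cast
      have e1 : (d * 4 ^ d * (2 * (2 * r + 1)) : ℝ) ≤ 6 * (d * 4 ^ d) * r := by
        have : (0 : ℝ) ≤ d * 4 ^ d := by positivity
        nlinarith
      calc _ ≤ ((box d (2 * r + 1)).card : ℝ) * (ε * (6 * (d * 4 ^ d) * r) + |D|) := by
            gcongr
            exact le_abs_self D
        _ ≤ _ := by gcongr
    have hFX : F * X ≤ (K * (r * V)) * (3 ^ d * V * (ε * (6 * (d * 4 ^ d) * r) + |D|)) := by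
      refine mul_le_mul hF2 hX2 ?_ (by positivity)
      have := (Complex.le_def.1 ((hst.restrictState (box d (2 * r + 1))).nonneg
        (staggered2 d n (2 * r + 1)))).1
      rwa [hC] at this
    -- The uncertainty relation with all three estimates inserted; both sides carry the common
    -- factor r V².
    have hfin : (δ * (r * V)) ^ 2 ≤
        4 * ((K * (r * V)) * (3 ^ d * V * (ε * (6 * (d * 4 ^ d) * r) + |D|))) := by
      have h0 : 0 ≤ δ * (r * V) := by positivity
      have := pow_le_pow_left₀ h0 hsum 2
      linarith
    have hrV : 0 < r * V ^ 2 := by positivity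
    have h6 : δ ^ 2 * r ≤ P * ε * r + 4 * K * 3 ^ d * |D| := by
      refine le_of_mul_le_mul_left ?_ hrV
      calc r * V ^ 2 * (δ ^ 2 * r) = (δ * (r * V)) ^ 2 := by ring
        _ ≤ _ := hfin
        _ = _ := by rw [hP]; ring
    have h7 : P * ε ≤ δ ^ 2 / 2 := by
      rw [hεdef, ← mul_div_assoc, div_le_div_iff₀ (by positivity) (by norm_num)]
      nlinarith [sq_nonneg δ]
    exact h6.trans (add_le_add_left (mul_le_mul_of_nonneg_right h7 (Nat.cast_nonneg r)) _)
  -- The inequality bounds (δ²/2) r by a constant, which fails for large r.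
  obtain ⟨r, hr⟩ := exists_nat_gt (max 1 (4 * K * 3 ^ d * |D| / (δ ^ 2 / 2)))
  have h1 : (1 : ℝ) ≤ r := (le_max_left _ _).trans hr.le
  have h2 := (le_max_right _ _).trans_lt hr
  rw [div_lt_iff₀ (by positivity)] at h2
  have h3 := key r (by exact_mod_cast h1)
  linarith

end Contradiction

end HeisenbergAF

end

open HeisenbergAF Asymptotics in
/-- The transverse correlations of the zero-field limit `ω₀` of the ground states do not decay as
`o(|x - y|^{-(d-1)})` if some infinite-volume ground state has a non-vanishing spontaneous
magnetization. -/
theorem mainTheorem3 (d n : ℕ) (hd : 2 ≤ d) (hn : 1 ≤ n)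
    (hmag : ∃ ω : quasiLocal d n →L[ℂ] ℂ, IsGroundState ω ∧ magnetization ω ≠ 0)
    (ω₀ : quasiLocal d n →L[ℂ] ℂ) (hω₀ : IsZeroFieldLimit ω₀) :
    ¬ (fun p : Site d × Site d => ω₀ (spinObs2 n p.1 * spinObs2 n p.2))
        =o[Filter.comap (fun p : Site d × Site d => siteDist p.1 p.2) Filter.atTop]
          (fun p : Site d × Site d => siteDist p.1 p.2 ^ (-((d : ℤ) - 1))) := by
  obtain ⟨δ, hδ, hm⟩ := hω₀.exists_le_staggeredMag hmag
  exact hω₀.not_isLittleO hd hδ hm
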